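/- **Types.** Session types, value types and name types of the calculus $\mathsf{HO}$ are $S ::= \mathsf{end} \mid\; !\langle U\rangle;S \mid\; ?(U);S \mid \oplus\{l:S_l\}_{l\in L} \mid \&\{l:S_l\}_{l\in L}$ ($L$ a finite non-empty set of labels), $U ::= C\multimap\diamond \mid C\to\diamond$, $\;C ::= S \mid \langle U\rangle$; $\overline S$ is the dual of $S$. The *core fragment* omits $\oplus$ and $\&$. *Minimal* session types are polyadic and have no sequencing: $M ::= \mathsf{end} \mid\; !\langle \widetilde U\rangle;\mathsf{end} \mid\; ?(\widetilde U);\mathsf{end} \mid \oplus\{l:M_l\}_{l\in L} \mid \&\{l:M_l\}_{l\in L}$, $U ::= \widetilde C\multimap\diamond \mid \widetilde C\to\diamond$, $\;C ::= M \mid \langle U\rangle$ (non-empty tuples; again the core fragment omits $\oplus,\&$). **Processes.** Names $u$ are session endpoints $s,\overline s$, shared names $a$, or name variables $y$ (the parameters of abstractions). Processes and values are $P ::= \mathbf 0 \mid u!\langle V\rangle.P \mid u?(x).P \mid u\triangleleft l.P \mid u\triangleright\{l:P_l\}_{l\in L} \mid V\,u \mid P\mid Q \mid (\nu s{:}S)P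 \mid (\nu a{:}\langle U\rangle)P$, $V ::= x \mid \lambda^{\multimap} y{:}C.\,P \mid \lambda^{\to} y{:}C.\,P$ (the arrow is that of the type of the abstraction), and likewise with tuples in the polyadic calculus, where restrictions of sessions need not be annotated. $\mathrm{fv}(\cdot)$ is the set of free value variables $x$ (fixed enumeration), and $P$ is closed if it has no free value variables and no free name variables. **Typing.** In $\Gamma;\Lambda;\Delta\vdash P\triangleright\diamond$ and $\Gamma;\Lambda;\Delta\vdash V\triangleright U$, $\Gamma$ assigns types $\widetilde C\to\diamond$ to value variables and $\langle U\rangle$ to shared names and name variables, $\Lambda$ assigns $\widetilde C\multimap\diamond$ to value variables, and $\Delta$ assigns session types to endpoints and name variables; the domains are disjoint; $\Lambda$ and $\Delta$ are linear and are split between subterms, $\Gamma$ is shared. The rules are those of higher-order session types: $\mathbf 0$ is typed with $\Lambda=\Delta=\emptyset$; an assignment $u:\mathsf{end}$ may be added to $\Delta$; a value variable of $\Gamma$ may be used once as a linear one; variables are typed with exactly their own assignment; an abstraction has the type given by its annotations if its body is typable with its parameters added, and a $\lambda^{\to}$ must moreover be typed with $\Lambda=\Delta=\emptyset$; $V\,u$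 is typed if $V$ has type $C\multimap\diamond$ or $C\to\diamond$ and $u$ has type $C$; outputs and inputs on $u:{!}\langle U\rangle;S$, $u:{?}(U);S$ continue with $u:S$; on a shared $u:\langle U\rangle$ one value of type $U$ is sent (with no linear value variables) or received; selection and branching continue with $u:S_l$; $P\mid Q$ splits $\Lambda$ and $\Delta$; $(\nu s{:}S)P$ adds $s:S,\ \overline s:\overline S$; $(\nu a{:}\langle U\rangle)P$ adds $a:\langle U\rangle$. A process is *typed with standard (resp. minimal) session types* if all types in the derivation are standard as above (resp. minimal). **Decomposition of types.** $\mathcal G(\mathsf{end})=\mathsf{end}$; $\mathcal G(!\langle U\rangle;S)$ is $!\langle\mathcal G(U)\rangle;\mathsf{end}$ if $S=\mathsf{end}$ and $!\langle\mathcal G(U)\rangle;\mathsf{end},\ \mathcal G(S)$ otherwise, and likewise for inputs; $\mathcal G(\oplus\{l:S_l\})=\oplus\{l:{?}(\mathcal G(\overline{S_l})\multimap\diamond);\mathsf{end}\}$; $\mathcal G(\&\{l:S_l\})=\&\{l:{!}\langle\mathcal G(S_l)\multimap\diamond\rangle;\mathsf{end}\}$; $\mathcal G(C\multimap\diamond)=\mathcal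 G(C)\multimap\diamond$, $\mathcal G(C\to\diamond)=\mathcal G(C)\to\diamond$, $\mathcal G(\langle U\rangle)=\langle\mathcal G(U)\rangle$. On environments, $\mathcal G$ maps $x:U$ to $x:\mathcal G(U)$, $u_i:\langle U\rangle$ to $u_i:\langle\mathcal G(U)\rangle$, and $u_i:S$ to $u_i:M_1,\dots,u_{i+n-1}:M_n$ where $\mathcal G(S)=M_1,\dots,M_n$. The substitution $\sigma$ *initializes* names: it replaces each name $n$ by the indexed name $n_1$. **Decomposition of processes.** The degree $\#(\cdot)$ is: $\#\mathbf 0=\#(u\triangleright\{l:P_l\})=1$, $\#(u!\langle V\rangle.P)=\#V+\#P+1$, $\#(u?(x).P)=\#P+1$, $\#(u\triangleleft l.P)=\#P+2$, $\#(V\,u)=\#V+1$, $\#(P\mid Q)=\#P+\#Q+1$, $\#((\nu n)P)=\#P$, $\#x=\#(\lambda^{\to}y.P)=0$, $\#(\lambda^{\multimap}y.P)=\#P$. Let $c_k,\overline{c_k}$ be reserved session names (propagators). Write $\overline{c_k}!\langle\widetilde x\rangle$ for $\overline{c_k}!\langle\widetilde x\rangle.\mathbf 0$; when $\widetilde x$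 is empty, a propagator carries the dummy value $\lambda^{\to} y{:}\mathsf{end}.\mathbf 0$. For $u_i$ of current type $S$ let $\widetilde u=(u_i,\dots,u_{i+|\mathcal G(S)|-1})$; for $u_i$ of shared type $\widetilde u=u_i$. Let $u_i^{+}$ be $u_{i+1}$ if the current type of $u_i$ is a session type, and $u_i$ otherwise. The breakdown $\mathcal B^k_{\tilde x}$ is - $\mathcal B^k_{\tilde x}(u_i!\langle V\rangle.Q)=c_k?(\widetilde x).u_i!\langle\mathcal V^{k+1}_{\tilde w}(V')\rangle.\overline{c_{k+\#V+1}}!\langle\widetilde z\rangle\mid\mathcal B^{k+\#V+1}_{\tilde z}(Q')$, with $\widetilde w=\mathrm{fv}(V)$, $\widetilde z=\mathrm{fv}(Q)$, $V'=V\{u_i^+/u_i\}$, $Q'=Q\{u_i^+/u_i\}$; - $\mathcal B^k_{\tilde x}(u_i?(y).Q)=c_k?(\widetilde x).u_i?(y).\overline{c_{k+1}}!\langle\widetilde z\rangle\mid\mathcal B^{k+1}_{\tilde z}(Q\{u_i^+/u_i\})$, $\widetilde z=\mathrm{fv}(Q)$; - $\mathcal B^k_{\tilde x}(V\,u_i)=c_k?(\widetilde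 x).\mathcal V^{k+1}_{\tilde x}(V)\,\widetilde u$; - $\mathcal B^k_{\tilde x}((\nu s{:}S)P)=(\nu\widetilde s{:}\mathcal G(S))\,\mathcal B^k_{\tilde x}(P\{s_1\overline{s_1}/s\overline s\})$ with $\widetilde s=(s_1,\dots,s_{|\mathcal G(S)|})$, and $\mathcal B^k_{\tilde x}((\nu a{:}\langle U\rangle)P)=(\nu a_1{:}\langle\mathcal G(U)\rangle)\,\mathcal B^k_{\tilde x}(P\{a_1/a\})$; - $\mathcal B^k_{\tilde x}(Q\mid R)=c_k?(\widetilde x).\overline{c_{k+1}}!\langle\widetilde y\rangle.\overline{c_{k+\#Q+1}}!\langle\widetilde z\rangle\mid\mathcal B^{k+1}_{\tilde y}(Q)\mid\mathcal B^{k+\#Q+1}_{\tilde z}(R)$, $\widetilde y=\mathrm{fv}(Q)$, $\widetilde z=\mathrm{fv}(R)$; - $\mathcal B^k_{\tilde x}(\mathbf 0)=c_k?().\mathbf 0$; - $\mathcal B^k_{\tilde x}(u_i\triangleright\{l:P_l\})=c_k?(\widetilde x).u_i\triangleright\{l: u_i!\langle\lambda^{\multimap}\widetilde{y^u}{:}\mathcal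 G(S_l).(\nu c_{k+1}\cdots c_{k+\#P_l})(\overline{c_{k+1}}!\langle\widetilde{x_l}\rangle\mid\mathcal B^{k+1}_{\tilde x_l}(P_l\{y^u_1/u_i\}))\rangle.\mathbf 0\}$, $\widetilde{x_l}=\mathrm{fv}(P_l)$, $S_l$ the type of $u_i$ in $P_l$; - $\mathcal B^k_{\tilde x}(u_i\triangleleft l.P)=c_k?(\widetilde x).\overline{c_{k+1}}!\langle\lambda^{\multimap}\widetilde y{:}\mathcal G(\overline{S_l}).\,u_i\triangleleft l.u_i?(z).\overline{c_{k+2}}!\langle\widetilde x\rangle.z\,\widetilde y\rangle\mid(\nu\widetilde v{:}\mathcal G(S_l))(c_{k+1}?(w).w\,\widetilde{\overline v}\mid\mathcal B^{k+2}_{\tilde x}(P\{v_{i+1}/u_i\}))$, with $\widetilde v=(v_{i+1},\dots,v_{i+|\mathcal G(S_l)|})$ fresh; - $\mathcal V^k_{\tilde x}(y)=y$; $\;\mathcal V^k_{\tilde x}(\lambda^{\multimap}y{:}C.P)=\lambda^{\multimap}\widetilde y{:}\mathcal G(C).(\overline{c_k}!\langle\widetilde x\rangle\mid\mathcal B^k_{\tilde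 x}(P\{y_1/y\}))$; $\;\mathcal V^k_{\tilde x}(\lambda^{\to}y{:}C.P)=\lambda^{\to}\widetilde y{:}\mathcal G(C).(\nu c_k\cdots c_{k+\#P-1})(\overline{c_k}!\langle\widetilde x\rangle\mid\mathcal B^k_{\tilde x}(P\{y_1/y\}))$, with $\widetilde y=(y_1,\dots,y_{|\mathcal G(C)|})$. The *decomposition* of a closed $P$ is $\mathcal D(P)=(\nu c_k\cdots c_{k+\#P-1})(\overline{c_k}!\langle\rangle\mid\mathcal B^k_{\epsilon}(P\sigma))$, for an arbitrary $k>0$. **Theorem (Typability of the Decomposition).** Let $P$ be a closed $\mathsf{HO}$ process of the core fragment in which no session name is used after its last communication, that is: in $u!\langle V\rangle.Q$ with $u:{!}\langle U\rangle;\mathsf{end}$ and in $u?(x).Q$ with $u:{?}(U);\mathsf{end}$, the name $u$ occurs free neither in $V$ nor in $Q$. If $\Gamma;\emptyset;\Delta\vdash P\triangleright\diamond$ with standard session types, then $\mathcal G(\Gamma\sigma);\emptyset;\mathcal G(\Delta\sigma)\vdash\mathcal D(P)\triangleright\diamond$ with minimal session types. The same holds for the extension of the calculus and of both type systems with selection and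 branching. -/

import Mathlib

/-! # Types -/

/-- Labels of selections and branchings. -/
abbrev Label := ℕ

/-- The two arrows of abstraction types: `lin` is the linear arrow, `shr` the shared one. -/
inductive Arrow
  | lin
  | shr
  deriving DecidableEq

mutual
  /-- Session types `S`: termination, output `!⟨U₁,…,Uₙ⟩;S`, input `?(U₁,…,Uₙ);S`,
  selection `⊕{l : S_l}` and branching `&{l : S_l}` over a finite set of labels. -/
  inductive STy : Type
    | done : STy
    | out (Us : List VTy) (S : STy) : STy
    | inp (Us : List VTy) (S : STy) : STy
    | sel (L : Finset Label) (S : L → STy) : STy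
    | bra (L : Finset Label) (S : L → STy) : STy
  /-- Value types `U`: abstractions `(C₁,…,Cₙ) ⊸ ⋄` and `(C₁,…,Cₙ) → ⋄`. -/
  inductive VTy : Type
    | hot (m : Arrow) (Cs : List CTy) : VTy
  /-- Name types `C`: a session type, or the type `⟨U⟩` of a shared name. -/
  inductive CTy : Type
    | sess (S : STy) : CTy
    | chan (U : VTy) : CTy
end

/-- The dual session type. -/
def STy.dual : STy → STy
  | .done => .done
  | .out Us S => .inp Us S.dual
  | .inp Us S => .out Us S.dual
  | .sel L S => .bra L fun l => (S l).dual
  | .bra L S => .sel L fun l => (S l).dual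

mutual
  /-- The standard (monadic, non-recursive) session types. The flag says whether labelled choice
  belongs to the language (`false`: core fragment). Label sets are non-empty. -/
  inductive STy.Std : Bool → STy → Prop
    | done {c : Bool} : STy.Std c .done
    | out {c : Bool} {U : VTy} {S : STy} : VTy.Std c U → STy.Std c S → STy.Std c (.out [U] S)
    | inp {c : Bool} {U : VTy} {S : STy} : VTy.Std c U → STy.Std c S → STy.Std c (.inp [U] S)
    | sel {L : Finset Label} {S : L → STy} :
        L.Nonempty → (∀ l, STy.Std true (S l)) → STy.Std true (.sel L S)
    | bra {L : Finset Label} {S : L → STy} :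
        L.Nonempty → (∀ l, STy.Std true (S l)) → STy.Std true (.bra L S)
  inductive VTy.Std : Bool → VTy → Prop
    | hot {c : Bool} {m : Arrow} {C : CTy} : CTy.Std c C → VTy.Std c (.hot m [C])
  inductive CTy.Std : Bool → CTy → Prop
    | sess {c : Bool} {S : STy} : STy.Std c S → CTy.Std c (.sess S)
    | chan {c : Bool} {U : VTy} : VTy.Std c U → CTy.Std c (.chan U)
end

mutual
  /-- The minimal session types: an input or an output is always followed by `done`. The flag says
  whether labelled choice belongs to the language. Tuples and label sets are non-empty. -/
  inductive STy.Minimal : Bool → STy → Prop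
    | done {c : Bool} : STy.Minimal c .done
    | out {c : Bool} {Us : List VTy} :
        Us ≠ [] → (∀ U ∈ Us, VTy.Minimal c U) → STy.Minimal c (.out Us .done)
    | inp {c : Bool} {Us : List VTy} :
        Us ≠ [] → (∀ U ∈ Us, VTy.Minimal c U) → STy.Minimal c (.inp Us .done)
    | sel {L : Finset Label} {M : L → STy} :
        L.Nonempty → (∀ l, STy.Minimal true (M l)) → STy.Minimal true (.sel L M)
    | bra {L : Finset Label} {M : L → STy} :
        L.Nonempty → (∀ l, STy.Minimal true (M l)) → STy.Minimal true (.bra L M)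
  inductive VTy.Minimal : Bool → VTy → Prop
    | hot {c : Bool} {m : Arrow} {Cs : List CTy} :
        Cs ≠ [] → (∀ C ∈ Cs, CTy.Minimal c C) → VTy.Minimal c (.hot m Cs)
  inductive CTy.Minimal : Bool → CTy → Prop
    | sess {c : Bool} {S : STy} : STy.Minimal c S → CTy.Minimal c (.sess S)
    | chan {c : Bool} {U : VTy} : VTy.Minimal c U → CTy.Minimal c (.chan U)
end

/-- A type language: the session types and the value types that typing judgements may mention. -/
structure TypeLang where
  ses : STy → Prop
  val : VTy → Prop

/-- The language of standard session types. -/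
def TypeLang.std (c : Bool) : TypeLang := ⟨STy.Std c, VTy.Std c⟩

/-- The language of minimal session types. -/
def TypeLang.minimal (c : Bool) : TypeLang := ⟨STy.Minimal c, VTy.Minimal c⟩

/-! # Processes -/

/-- Identifiers over a set `B` of base identifiers: the two endpoints `s` (`bar = false`) and
`s̄` (`bar = true`) of a session, shared names, and name variables (the parameters of
abstractions). -/
inductive Name (B : Type) : Type
  | sess (s : B) (bar : Bool) : Name B
  | shared (a : B) : Name B
  | var (y : B) : Name B
  deriving DecidableEq

/-- The dual endpoint; duality is only relevant for session names. -/
def Name.dual {B : Type} : Name B → Name B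
  | .sess s bar => .sess s (!bar)
  | n => n

mutual
  /-- (Polyadic) `HO` processes over base identifiers `B` and value variables `X`.
  `resS s ann P` restricts the session name `s`, binding both `s` and `s̄`; `ann` is its type
  annotation, if there is one. `resA a U P` restricts the shared name `a`, of type `⟨U⟩`. -/
  inductive Proc (B X : Type) : Type
    | nil : Proc B X
    | out (u : Name B) (Vs : List (Val B X)) (P : Proc B X) : Proc B X
    | inp (u : Name B) (xs : List X) (P : Proc B X) : Proc B X
    | sel (u : Name B) (l : Label) (P : Proc B X) : Proc B X
    | bra (u : Name B) (L : Finset Label) (P : L → Proc B X) : Proc B X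
    | app (V : Val B X) (us : List (Name B)) : Proc B X
    | par (P Q : Proc B X) : Proc B X
    | resS (s : B) (ann : Option STy) (P : Proc B X) : Proc B X
    | resA (a : B) (U : VTy) (P : Proc B X) : Proc B X
  /-- Values: value variables, and abstractions `λ(y₁:C₁,…,yₙ:Cₙ).P` annotated with the arrow
  of their type. -/
  inductive Val (B X : Type) : Type
    | var (x : X) : Val B X
    | abs (m : Arrow) (ps : List (B × CTy)) (P : Proc B X) : Val B X
end

section Occurrences
variable {B X : Type} [DecidableEq B] [DecidableEq X]

mutual
  /-- Free value variables. -/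
  def Proc.fv : Proc B X → Finset X
    | .nil => ∅
    | .out _ Vs P => Val.fvs Vs ∪ P.fv
    | .inp _ xs P => P.fv \ xs.toFinset
    | .sel _ _ P => P.fv
    | .bra _ _ P => Finset.univ.biUnion fun l => (P l).fv
    | .app V _ => V.fv
    | .par P Q => P.fv ∪ Q.fv
    | .resS _ _ P => P.fv
    | .resA _ _ P => P.fv
  def Val.fv : Val B X → Finset X
    | .var x => {x}
    | .abs _ _ P => P.fv
  def Val.fvs : List (Val B X) → Finset X
    | [] => ∅
    | V :: Vs => V.fv ∪ Val.fvs Vs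
end

mutual
  /-- Free identifiers: free session names, shared names and name variables. -/
  def Proc.fn : Proc B X → Finset (Name B)
    | .nil => ∅
    | .out u Vs P => {u} ∪ Val.fns Vs ∪ P.fn
    | .inp u _ P => {u} ∪ P.fn
    | .sel u _ P => {u} ∪ P.fn
    | .bra u _ P => {u} ∪ Finset.univ.biUnion fun l => (P l).fn
    | .app V us => V.fn ∪ us.toFinset
    | .par P Q => P.fn ∪ Q.fn
    | .resS s _ P => P.fn \ {.sess s false, .sess s true}
    | .resA a _ P => P.fn \ {.shared a}
  def Val.fn : Val B X → Finset (Name B)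
    | .var _ => ∅
    | .abs _ ps P => P.fn \ (ps.map fun p => Name.var p.1).toFinset
  def Val.fns : List (Val B X) → Finset (Name B)
    | [] => ∅
    | V :: Vs => V.fn ∪ Val.fns Vs
end

/-- A process is closed if it has no free variable, neither a value variable nor a name variable. -/
def Proc.Closed (P : Proc B X) : Prop :=
  P.fv = ∅ ∧ ∀ y : B, Name.var y ∉ P.fn

end Occurrences

mutual
  /-- Every session restriction carries its type annotation. -/
  def Proc.Annotated {B X : Type} : Proc B X → Prop
    | .nil => True
    | .out _ Vs P => Val.Annotateds Vs ∧ P.Annotated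
    | .inp _ _ P => P.Annotated
    | .sel _ _ P => P.Annotated
    | .bra _ _ P => ∀ l, (P l).Annotated
    | .app V _ => V.Annotated
    | .par P Q => P.Annotated ∧ Q.Annotated
    | .resS _ ann P => ann ≠ none ∧ P.Annotated
    | .resA _ _ P => P.Annotated
  def Val.Annotated {B X : Type} : Val B X → Prop
    | .var _ => True
    | .abs _ _ P => P.Annotated
  def Val.Annotateds {B X : Type} : List (Val B X) → Prop
    | [] => True
    | V :: Vs => V.Annotated ∧ Val.Annotateds Vs
end

/-! # The type system -/

/-- Shared environments `Γ`: value variables `x : (C₁,…,Cₙ) → ⋄`, and shared names and name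
variables `u : ⟨U⟩`. The leftmost entry of an identifier counts. -/
structure SEnv (B X : Type) where
  vals : List (X × List CTy)
  chans : List (Name B × VTy)

/-- Linear environments `Λ`: value variables `x : (C₁,…,Cₙ) ⊸ ⋄`. -/
abbrev LEnv (X : Type) := Multiset (X × List CTy)

/-- Session environments `Δ`: session names and name variables `u : S`. -/
abbrev DEnv (B : Type) := Multiset (Name B × STy)

section Typing
variable {B X : Type} [DecidableEq B] [DecidableEq X]

/-- `Γ ∖ xs`, for value variables. -/
def SEnv.eraseVals (Γ : SEnv B X) (xs : List X) : SEnv B X :=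
  ⟨Γ.vals.filter fun p => p.1 ∉ xs, Γ.chans⟩

/-- The variables of `xs` that are bound at shared types. -/
def sharedVars (xs : List (X × VTy)) : List (X × List CTy) :=
  xs.filterMap fun
    | (x, .hot .shr Cs) => some (x, Cs)
    | (_, .hot .lin _) => none

/-- The variables of `xs` that are bound at linear types. -/
def linearVars (xs : List (X × VTy)) : List (X × List CTy) :=
  xs.filterMap fun
    | (x, .hot .lin Cs) => some (x, Cs)
    | (_, .hot .shr _) => none

/-- The shared environment under a binder of the value variables `xs`. -/
def SEnv.bindVals (Γ : SEnv B X) (xs : List (X × VTy)) : SEnv B X :=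
  ⟨sharedVars xs ++ (Γ.eraseVals (xs.map Prod.fst)).vals, Γ.chans⟩

/-- The parameters of `ps` that are shared, and those that are sessions. -/
def sharedParams (ps : List (B × CTy)) : List (Name B × VTy) :=
  ps.filterMap fun
    | (y, .chan U) => some (.var y, U)
    | (_, .sess _) => none

def sessionParams (ps : List (B × CTy)) : List (Name B × STy) :=
  ps.filterMap fun
    | (y, .sess S) => some (.var y, S)
    | (_, .chan _) => none

/-- The shared environment under a binder of the name variables `ps`. -/
def SEnv.bindParams (Γ : SEnv B X) (ps : List (B × CTy)) : SEnv B X :=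
  ⟨Γ.vals, sharedParams ps ++ Γ.chans.filter fun p => p.1 ∉ ps.map fun q => Name.var q.1⟩

/-- The shared environment under a restriction of `a : ⟨U⟩`. -/
def SEnv.bindShared (Γ : SEnv B X) (a : B) (U : VTy) : SEnv B X :=
  ⟨Γ.vals, (.shared a, U) :: Γ.chans⟩

/-- The environments of a judgement: their domains are disjoint, no identifier occurs twice in `Λ`
or in `Δ`, `Γ` has no session names, `Δ` has no shared names, and all types belong to the type
language. -/
structure EnvOk (F : TypeLang) (Γ : SEnv B X) (Λ : LEnv X) (Δ : DEnv B) : Prop where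
  nodup_lin : (Λ.map Prod.fst).Nodup
  nodup_ses : (Δ.map Prod.fst).Nodup
  disj_lin : ∀ p ∈ Λ, Γ.vals.lookup p.1 = none
  disj_ses : ∀ p ∈ Δ, Γ.chans.lookup p.1 = none
  kind_chan : ∀ p ∈ Γ.chans, ∀ s bar, p.1 ≠ .sess s bar
  kind_ses : ∀ p ∈ Δ, ∀ a, p.1 ≠ .shared a
  ty_val : ∀ p ∈ Γ.vals, F.val (.hot .shr p.2)
  ty_chan : ∀ p ∈ Γ.chans, F.val p.2
  ty_lin : ∀ p ∈ Λ, F.val (.hot .lin p.2)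
  ty_ses : ∀ p ∈ Δ, F.ses p.2

/-- `Γ;∅;Δ ⊢ u₁,…,uₙ ▷ C₁,…,Cₙ`. -/
inductive NamesTyped (Γ : SEnv B X) : DEnv B → List (Name B) → List CTy → Prop
  | nil : NamesTyped Γ 0 [] []
  | sess {Δ : DEnv B} {us : List (Name B)} {Cs : List CTy} (u : Name B) (S : STy) :
      NamesTyped Γ Δ us Cs → NamesTyped Γ ((u, S) ::ₘ Δ) (u :: us) (.sess S :: Cs)
  | shared {Δ : DEnv B} {us : List (Name B)} {Cs : List CTy} (u : Name B) (U : VTy) :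
      Γ.chans.lookup u = some U → NamesTyped Γ Δ us Cs →
      NamesTyped Γ Δ (u :: us) (.chan U :: Cs)

mutual
  /-- `Γ;Λ;Δ ⊢ P ▷ ⋄`, where every judgement of the derivation is in the type language `F`. -/
  inductive Typed (F : TypeLang) : SEnv B X → LEnv X → DEnv B → Proc B X → Prop
    | nil {Γ : SEnv B X} :
        EnvOk F Γ 0 0 → Typed F Γ 0 0 .nil
    | endW {Γ : SEnv B X} {Λ : LEnv X} {Δ : DEnv B} {P : Proc B X} (u : Name B) :
        Typed F Γ Λ Δ P → EnvOk F Γ Λ ((u, .done) ::ₘ Δ) → Typed F Γ Λ ((u, .done) ::ₘ Δ) P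
    | eprom {Γ : SEnv B X} {Λ : LEnv X} {Δ : DEnv B} {P : Proc B X} (x : X) (Cs : List CTy) :
        Γ.vals.lookup x = some Cs → Typed F (Γ.eraseVals [x]) ((x, Cs) ::ₘ Λ) Δ P →
        EnvOk F Γ Λ Δ → Typed F Γ Λ Δ P
    | app {Γ : SEnv B X} {Λ : LEnv X} {Δ₁ Δ₂ : DEnv B} {V : Val B X} {us : List (Name B)}
        (m : Arrow) (Cs : List CTy) :
        ValTyped F Γ Λ Δ₁ V (.hot m Cs) → NamesTyped Γ Δ₂ us Cs →
        EnvOk F Γ Λ (Δ₁ + Δ₂) → Typed F Γ Λ (Δ₁ + Δ₂) (.app V us)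
    | send {Γ : SEnv B X} {Λ₁ Λ₂ : LEnv X} {Δ₁ Δ₂ Δ : DEnv B} {u : Name B} {P : Proc B X}
        {Vs : List (Val B X)} (Us : List VTy) (S : STy) :
        Typed F Γ Λ₁ Δ₁ P → ValsTyped F Γ Λ₂ Δ₂ Vs Us → Δ₁ + Δ₂ = (u, S) ::ₘ Δ →
        EnvOk F Γ (Λ₁ + Λ₂) ((u, .out Us S) ::ₘ Δ) →
        Typed F Γ (Λ₁ + Λ₂) ((u, .out Us S) ::ₘ Δ) (.out u Vs P)
    | rcv {Γ : SEnv B X} {Λ : LEnv X} {Δ : DEnv B} {u : Name B} {xs : List X} {P : Proc B X}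
        (Us : List VTy) (S : STy) :
        xs.Nodup → xs.length = Us.length →
        Typed F (Γ.bindVals (xs.zip Us)) (linearVars (xs.zip Us) + Λ) ((u, S) ::ₘ Δ) P →
        EnvOk F Γ Λ ((u, .inp Us S) ::ₘ Δ) →
        Typed F Γ Λ ((u, .inp Us S) ::ₘ Δ) (.inp u xs P)
    | req {Γ : SEnv B X} {Λ : LEnv X} {Δ₁ Δ₂ : DEnv B} {u : Name B} {P : Proc B X} {V : Val B X}
        (U : VTy) :
        Γ.chans.lookup u = some U → Typed F Γ Λ Δ₁ P → ValTyped F Γ 0 Δ₂ V U →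
        EnvOk F Γ Λ (Δ₁ + Δ₂) → Typed F Γ Λ (Δ₁ + Δ₂) (.out u [V] P)
    | acc {Γ : SEnv B X} {Λ : LEnv X} {Δ : DEnv B} {u : Name B} {x : X} {P : Proc B X} (U : VTy) :
        Γ.chans.lookup u = some U →
        Typed F (Γ.bindVals [(x, U)]) (linearVars [(x, U)] + Λ) Δ P →
        EnvOk F Γ Λ Δ → Typed F Γ Λ Δ (.inp u [x] P)
    | sel {Γ : SEnv B X} {Λ : LEnv X} {Δ : DEnv B} {u : Name B} {P : Proc B X}
        (L : Finset Label) (S : L → STy) (l : L) :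
        Typed F Γ Λ ((u, S l) ::ₘ Δ) P → EnvOk F Γ Λ ((u, .sel L S) ::ₘ Δ) →
        Typed F Γ Λ ((u, .sel L S) ::ₘ Δ) (.sel u l P)
    | bra {Γ : SEnv B X} {Λ : LEnv X} {Δ : DEnv B} {u : Name B} (L : Finset Label)
        {P : L → Proc B X} (S : L → STy) :
        (∀ l : L, Typed F Γ Λ ((u, S l) ::ₘ Δ) (P l)) → EnvOk F Γ Λ ((u, .bra L S) ::ₘ Δ) →
        Typed F Γ Λ ((u, .bra L S) ::ₘ Δ) (.bra u L P)
    | par {Γ : SEnv B X} {Λ₁ Λ₂ : LEnv X} {Δ₁ Δ₂ : DEnv B} {P Q : Proc B X} :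
        Typed F Γ Λ₁ Δ₁ P → Typed F Γ Λ₂ Δ₂ Q → EnvOk F Γ (Λ₁ + Λ₂) (Δ₁ + Δ₂) →
        Typed F Γ (Λ₁ + Λ₂) (Δ₁ + Δ₂) (.par P Q)
    | resS {Γ : SEnv B X} {Λ : LEnv X} {Δ : DEnv B} {P : Proc B X} (s : B) (ann : Option STy)
        (S : STy) :
        ann = none ∨ ann = some S →
        Typed F Γ Λ ((.sess s false, S) ::ₘ (.sess s true, S.dual) ::ₘ Δ) P →
        EnvOk F Γ Λ Δ → Typed F Γ Λ Δ (.resS s ann P)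
    | resA {Γ : SEnv B X} {Λ : LEnv X} {Δ : DEnv B} {P : Proc B X} (a : B) (U : VTy) :
        Typed F (Γ.bindShared a U) Λ Δ P →
        EnvOk F Γ Λ Δ → Typed F Γ Λ Δ (.resA a U P)
  /-- `Γ;Λ;Δ ⊢ V ▷ U`. The annotation of an abstraction is the arrow of its type: `absLin` is the
  rule for abstractions, `absShr` is that rule followed by promotion. -/
  inductive ValTyped (F : TypeLang) : SEnv B X → LEnv X → DEnv B → Val B X → VTy → Prop
    | shVar {Γ : SEnv B X} (x : X) (Cs : List CTy) :
        Γ.vals.lookup x = some Cs → EnvOk F Γ 0 0 → ValTyped F Γ 0 0 (.var x) (.hot .shr Cs)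
    | linVar {Γ : SEnv B X} (x : X) (Cs : List CTy) :
        EnvOk F Γ {(x, Cs)} 0 → ValTyped F Γ {(x, Cs)} 0 (.var x) (.hot .lin Cs)
    | absLin {Γ : SEnv B X} {Λ : LEnv X} {Δ : DEnv B} {P : Proc B X} (ps : List (B × CTy)) :
        (ps.map Prod.fst).Nodup → Typed F (Γ.bindParams ps) Λ (sessionParams ps + Δ) P →
        EnvOk F Γ Λ Δ → F.val (.hot .lin (ps.map Prod.snd)) →
        ValTyped F Γ Λ Δ (.abs .lin ps P) (.hot .lin (ps.map Prod.snd))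
    | absShr {Γ : SEnv B X} {P : Proc B X} (ps : List (B × CTy)) :
        (ps.map Prod.fst).Nodup → Typed F (Γ.bindParams ps) 0 (sessionParams ps) P →
        EnvOk F Γ 0 0 → F.val (.hot .shr (ps.map Prod.snd)) →
        ValTyped F Γ 0 0 (.abs .shr ps P) (.hot .shr (ps.map Prod.snd))
  /-- `Γ;Λ;Δ ⊢ V₁,…,Vₙ ▷ U₁,…,Uₙ`. -/
  inductive ValsTyped (F : TypeLang) :
      SEnv B X → LEnv X → DEnv B → List (Val B X) → List VTy → Prop
    | nil {Γ : SEnv B X} : ValsTyped F Γ 0 0 [] []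
    | cons {Γ : SEnv B X} {Λ₁ Λ₂ : LEnv X} {Δ₁ Δ₂ : DEnv B} {V : Val B X} {Vs : List (Val B X)}
        {U : VTy} {Us : List VTy} :
        ValTyped F Γ Λ₁ Δ₁ V U → ValsTyped F Γ Λ₂ Δ₂ Vs Us →
        ValsTyped F Γ (Λ₁ + Λ₂) (Δ₁ + Δ₂) (V :: Vs) (U :: Us)
end

end Typing

/-! # Decomposition of types and environments -/

mutual
  /-- The decomposition `𝒢(S)`, a list of minimal session types. -/
  def STy.decomp : STy → List STy
    | .done => [.done]
    | .out Us .done => [.out (VTy.decomps Us) .done]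
    | .out Us S => .out (VTy.decomps Us) .done :: S.decomp
    | .inp Us .done => [.inp (VTy.decomps Us) .done]
    | .inp Us S => .inp (VTy.decomps Us) .done :: S.decomp
    | .sel L S => [.sel L fun l =>
        .inp [.hot .lin ((S l).decomp.map fun M => .sess M.dual)] .done]
    | .bra L S => [.bra L fun l => .out [.hot .lin ((S l).decomp.map fun M => .sess M)] .done]
  /-- `𝒢(U)`. -/
  def VTy.decomp : VTy → VTy
    | .hot m Cs => .hot m (CTy.decomps Cs)
  /-- `𝒢(C)`. -/
  def CTy.decomp : CTy → List CTy
    | .sess S => S.decomp.map fun M => .sess M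
    | .chan U => [.chan U.decomp]
  def VTy.decomps : List VTy → List VTy
    | [] => []
    | U :: Us => U.decomp :: VTy.decomps Us
  /-- `𝒢(C₁,…,Cₙ) = 𝒢(C₁),…,𝒢(Cₙ)`. -/
  def CTy.decomps : List CTy → List CTy
    | [] => []
    | C :: Cs => C.decomp ++ CTy.decomps Cs
end

theorem STy.dual_dual : ∀ S : STy, S.dual.dual = S
  | .done => rfl
  | .out Us S => by simp only [STy.dual, STy.dual_dual S]
  | .inp Us S => by simp only [STy.dual, STy.dual_dual S]
  | .sel L S => by simp only [STy.dual, fun l => STy.dual_dual (S l)]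
  | .bra L S => by simp only [STy.dual, fun l => STy.dual_dual (S l)]

theorem STy.decomp_dual : ∀ S : STy, S.dual.decomp = S.decomp.map STy.dual
  | .done => by simp [STy.dual, STy.decomp]
  | .out Us S => by
      have h := STy.decomp_dual S
      cases S <;> simp_all [STy.dual, STy.decomp]
  | .inp Us S => by
      have h := STy.decomp_dual S
      cases S <;> simp_all [STy.dual, STy.decomp]
  | .sel L S => by
      simp [STy.dual, STy.decomp, fun l => STy.decomp_dual (S l), Function.comp_def]
  | .bra L S => by
      simp [STy.dual, STy.decomp, fun l => STy.decomp_dual (S l), Function.comp_def,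
        STy.dual_dual]

/-- The clause for selection in its usual form, `𝒢(⊕{l : S_l}) = ⊕{l : ?(𝒢(S̄_l) ⊸ ⋄);end}`. -/
theorem STy.decomp_sel (L : Finset Label) (S : L → STy) :
    (STy.sel L S).decomp =
      [.sel L fun l => .inp [.hot .lin ((S l).dual.decomp.map fun M => .sess M)] .done] := by
  simp [STy.decomp, STy.decomp_dual, Function.comp_def]

/-- Base identifiers of decomposed processes. `idx n i` is the indexed name `n_i`; `prop k` is the
reserved propagator `c_k`; `sel u i` is the fresh session on which the endpoint `u` continues after
a selection, its index being `i`; `bra u i` is the parameter `y^u_i` that replaces `u` in the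
branches of a branching on `u`; `aux i` are further fresh parameters. -/
inductive TBase : Type
  | idx (n : ℕ) (i : ℕ) : TBase
  | prop (k : ℕ) : TBase
  | sel (u : Name ℕ) (i : ℕ) : TBase
  | bra (u : Name ℕ) (i : ℕ) : TBase
  | aux (i : ℕ) : TBase
  deriving DecidableEq

/-- Value variables of decomposed processes: those of the source, and auxiliary ones. -/
inductive TVar : Type
  | src (x : ℕ) : TVar
  | aux (i : ℕ) : TVar
  deriving DecidableEq

/-- The index of a base identifier. -/
def TBase.index : TBase → ℕ
  | .idx _ i => i
  | .prop k => k
  | .sel _ i => i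
  | .bra _ i => i
  | .aux i => i

/-- Increase the index by `j`. -/
def TBase.shift (j : ℕ) : TBase → TBase
  | .idx n i => .idx n (i + j)
  | .prop k => .prop (k + j)
  | .sel u i => .sel u (i + j)
  | .bra u i => .bra u (i + j)
  | .aux i => .aux (i + j)

/-- The base identifiers `b_i, …, b_{i+n-1}`, for `b = b_i`. -/
def TBase.tuple (b : TBase) (n : ℕ) : List TBase :=
  (List.range n).map fun j => b.shift j

/-- The base identifier under a name. -/
def Name.base {B : Type} : Name B → B
  | .sess s _ => s
  | .shared a => a
  | .var y => y

/-- Increase the index of a name: `u_i` becomes `u_{i+j}`. -/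
def Name.shift (j : ℕ) : Name TBase → Name TBase
  | .sess s bar => .sess (s.shift j) bar
  | .shared a => .shared (a.shift j)
  | .var y => .var (y.shift j)

/-- The names `u_i, …, u_{i+n-1}`, for `u = u_i`. -/
def Name.tuple (u : Name TBase) (n : ℕ) : List (Name TBase) :=
  (List.range n).map fun j => u.shift j

/-- Initialization of a name: `n` becomes `n_1`. -/
def Name.init : Name ℕ → Name TBase
  | .sess s bar => .sess (.idx s 1) bar
  | .shared a => .shared (.idx a 1)
  | .var y => .var (.idx y 1)

/-- `Γσ`, where `σ` initializes the names. -/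
def SEnv.init (Γ : SEnv ℕ ℕ) : SEnv TBase TVar :=
  ⟨Γ.vals.map fun p => (.src p.1, p.2), Γ.chans.map fun p => (p.1.init, p.2)⟩

/-- `Δσ`, where `σ` initializes the names. -/
def initSessions (Δ : List (Name ℕ × STy)) : List (Name TBase × STy) :=
  Δ.map fun p => (p.1.init, p.2)

/-- `𝒢(Γ)`. -/
def SEnv.decomp (Γ : SEnv TBase TVar) : SEnv TBase TVar :=
  ⟨Γ.vals.map fun p => (p.1, CTy.decomps p.2), Γ.chans.map fun p => (p.1, p.2.decomp)⟩

/-- `𝒢(Δ)`: an assignment `u_i : S` becomes `(u_i,…,u_{i+n-1}) : 𝒢(S)`, where `n = |𝒢(S)|`. -/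
def decompSessions (Δ : List (Name TBase × STy)) : List (Name TBase × STy) :=
  Δ.flatMap fun p => (p.1.tuple p.2.decomp.length).zip p.2.decomp

/-! # Type information -/

/-- The type of a name after a communication on it. -/
def CTy.tail : CTy → CTy
  | .sess (.out _ S) => .sess S
  | .sess (.inp _ S) => .sess S
  | C => C

/-- The session type of a name after the choice of label `l` on it. -/
def CTy.choose (l : Label) : CTy → STy
  | .sess (.sel L S) => if h : l ∈ L then S ⟨l, h⟩ else .done
  | .sess (.bra L S) => if h : l ∈ L then S ⟨l, h⟩ else .done
  | _ => .done

/-- The types of the names under a binder of the name variables `ps`. -/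
def typesParams {B : Type} [DecidableEq B] (τ : Name B → CTy) (ps : List (B × CTy)) :
    Name B → CTy :=
  ps.foldl (fun τ p => Function.update τ (.var p.1) p.2) τ

/-- The types of the names under a restriction of `s : S`. -/
def typesSession {B : Type} [DecidableEq B] (τ : Name B → CTy) (s : B) (S : STy) :
    Name B → CTy :=
  Function.update (Function.update τ (.sess s false) (.sess S)) (.sess s true) (.sess S.dual)

/-- The types that `Γ` and `Δ` assign to names. -/
def typesEnv {B X : Type} [DecidableEq B] (Γ : SEnv B X) (Δ : List (Name B × STy)) :
    Name B → CTy :=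
  fun u =>
    match Δ.lookup u with
    | some S => .sess S
    | none =>
      match Γ.chans.lookup u with
      | some U => .chan U
      | none => .sess .done

section Tidy
variable {B X : Type} [DecidableEq B]

mutual
  /-- No session occurs after its last communication: in `u!⟨V⟩.P` with `u : !⟨U⟩;end`, and in
  `u?(x).P` with `u : ?(U);end`, the name `u` occurs neither in `V` nor in `P`. Here `τ` gives the
  types of the names. -/
  def Proc.Tidy : (Name B → CTy) → Proc B X → Prop
    | _, .nil => True
    | τ, .out u Vs P =>
        ((τ u).tail = .sess .done → u ∉ Val.fns Vs ∧ u ∉ P.fn) ∧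
          Val.Tidys (Function.update τ u (τ u).tail) Vs ∧
          P.Tidy (Function.update τ u (τ u).tail)
    | τ, .inp u _ P =>
        ((τ u).tail = .sess .done → u ∉ P.fn) ∧ P.Tidy (Function.update τ u (τ u).tail)
    | τ, .sel u l P => P.Tidy (Function.update τ u (.sess ((τ u).choose l)))
    | τ, .bra u _ P => ∀ l, (P l).Tidy (Function.update τ u (.sess ((τ u).choose l)))
    | τ, .app V _ => V.Tidy τ
    | τ, .par P Q => P.Tidy τ ∧ Q.Tidy τ
    | τ, .resS s ann P => P.Tidy (typesSession τ s (ann.getD .done))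
    | τ, .resA a U P => P.Tidy (Function.update τ (.shared a) (.chan U))
  def Val.Tidy : (Name B → CTy) → Val B X → Prop
    | _, .var _ => True
    | τ, .abs _ ps P => P.Tidy (typesParams τ ps)
  def Val.Tidys : (Name B → CTy) → List (Val B X) → Prop
    | _, [] => True
    | τ, V :: Vs => V.Tidy τ ∧ Val.Tidys τ Vs
end

end Tidy

/-! # Decomposition of processes -/

section Degree
variable {B X : Type}

mutual
  /-- The degree of a process and of a value. -/
  def Proc.degree : Proc B X → ℕ
    | .nil => 1
    | .out _ Vs P => Val.degrees Vs + P.degree + 1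
    | .inp _ _ P => P.degree + 1
    | .sel _ _ P => P.degree + 2
    | .bra _ _ _ => 1
    | .app V _ => V.degree + 1
    | .par P Q => P.degree + Q.degree + 1
    | .resS _ _ P => P.degree
    | .resA _ _ P => P.degree
  def Val.degree : Val B X → ℕ
    | .var _ => 0
    | .abs .lin _ P => P.degree
    | .abs .shr _ _ => 0
  def Val.degrees : List (Val B X) → ℕ
    | [] => 0
    | V :: Vs => V.degree + Val.degrees Vs
end

/-- `(ν s₁:S₁) ⋯ (ν sₙ:Sₙ) P`. -/
def Proc.resMany (ss : List (B × Option STy)) (P : Proc B X) : Proc B X :=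
  ss.foldr (fun p Q => .resS p.1 p.2 Q) P

end Degree

/-- The propagators `c_k` and `c̄_k`. -/
def propIn (k : ℕ) : Name TBase := .sess (.prop k) false
def propOut (k : ℕ) : Name TBase := .sess (.prop k) true

/-- The names `c_k, …, c_{k+n-1}`, without type annotations. -/
def props (k n : ℕ) : List (TBase × Option STy) :=
  ((TBase.prop k).tuple n).map fun c => (c, none)

/-- The value `λx.0` of type `end → ⋄` that is sent when there is nothing to send. -/
def dummy : Val TBase TVar := .abs .shr [(.aux 1, .sess .done)] .nil

/-- The values sent along a propagator with context `xs`. -/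
def packed (xs : List ℕ) : List (Val TBase TVar) :=
  if xs = [] then [dummy] else xs.map fun x => .var (.src x)

/-- The variables received along a propagator with context `xs`. -/
def unpacked (xs : List ℕ) : List TVar :=
  if xs = [] then [.aux 0] else xs.map TVar.src

/-- The context of a set of free variables: a fixed enumeration without repetitions. -/
def context (s : Finset ℕ) : List ℕ := s.sort (· ≤ ·)

/-- The current indexed names of the source names. -/
abbrev NameMap := Name ℕ → Name TBase

/-- `{u_{i+1}/u_i}` if `u_i` has a session type, and the identity otherwise. -/
def incrName (τ : Name ℕ → CTy) (ρ : NameMap) (u : Name ℕ) : NameMap :=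
  match τ u with
  | .sess _ => Function.update ρ u ((ρ u).shift 1)
  | .chan _ => ρ

/-- `{y_1/y}` for the name variables `ps`. -/
def initParams (ρ : NameMap) (ps : List (ℕ × CTy)) : NameMap :=
  ps.foldl (fun ρ p => Function.update ρ (.var p.1) (.var (.idx p.1 1))) ρ

/-- The parameters `(b_i,…,b_{i+n-1}) : 𝒢(C)` for `b = b_i` and `n = |𝒢(C)|`. -/
def paramTuple (b : TBase) (C : CTy) : List (TBase × CTy) :=
  (b.tuple C.decomp.length).zip C.decomp

/-- The annotated sessions `(b_i,…,b_{i+n-1}) : 𝒢(S)` for `b = b_i` and `n = |𝒢(S)|`. -/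
def sessionTuple (b : TBase) (S : STy) : List (TBase × Option STy) :=
  (b.tuple S.decomp.length).zip (S.decomp.map some)

mutual
  /-- The breakdown of a process. The arguments `τ` and `ρ` give the current type and the current
  indexed name `u_i` of every source name `u`: the substitutions of indexed names into the process
  are performed by updating `ρ`. Then come the index of the first propagator and the context. -/
  def Proc.breakdown :
      (Name ℕ → CTy) → NameMap → ℕ → List ℕ → Proc ℕ ℕ → Proc TBase TVar
    | τ, ρ, k, xs, .out u Vs Q =>
        let l := Val.degrees Vs
        let zs := context Q.fv
        let τ' := Function.update τ u (τ u).tail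
        let ρ' := incrName τ ρ u
        .par
          (.inp (propIn k) (unpacked xs)
            (.out (ρ u) (Val.breakdowns τ' ρ' (k + 1) Vs)
              (.out (propOut (k + l + 1)) (packed zs) .nil)))
          (Q.breakdown τ' ρ' (k + l + 1) zs)
    | τ, ρ, k, xs, .inp u ys Q =>
        let xs' := context Q.fv
        .par
          (.inp (propIn k) (unpacked xs)
            (.inp (ρ u) (ys.map TVar.src) (.out (propOut (k + 1)) (packed xs') .nil)))
          (Q.breakdown (Function.update τ u (τ u).tail) (incrName τ ρ u) (k + 1) xs')
    | τ, ρ, k, xs, .app V us =>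
        .inp (propIn k) (unpacked xs)
          (.app (V.breakdown τ ρ (k + 1) xs)
            (us.flatMap fun u => (ρ u).tuple (τ u).decomp.length))
    | τ, ρ, k, xs, .resS s ann P =>
        let S := ann.getD .done
        .resMany (sessionTuple (.idx s 1) S)
          (P.breakdown (typesSession τ s S)
            (Function.update (Function.update ρ (.sess s false) (.sess (.idx s 1) false))
              (.sess s true) (.sess (.idx s 1) true)) k xs)
    | τ, ρ, k, xs, .resA a U P =>
        .resA (.idx a 1) U.decomp
          (P.breakdown (Function.update τ (.shared a) (.chan U))
            (Function.update ρ (.shared a) (.shared (.idx a 1))) k xs)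
    | τ, ρ, k, xs, .par Q R =>
        let l := Q.degree
        let ys := context Q.fv
        let zs := context R.fv
        .par
          (.inp (propIn k) (unpacked xs)
            (.out (propOut (k + 1)) (packed ys)
              (.out (propOut (k + l + 1)) (packed zs) .nil)))
          (.par (Q.breakdown τ ρ (k + 1) ys) (R.breakdown τ ρ (k + l + 1) zs))
    | _, _, k, _, .nil => .inp (propIn k) (unpacked []) .nil
    | τ, ρ, k, xs, .bra u L P =>
        .inp (propIn k) (unpacked xs)
          (.bra (ρ u) L fun l =>
            let S := (τ u).choose l
            let xl := context (P l).fv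
            .out (ρ u)
              [.abs .lin (paramTuple (.bra u 1) (.sess S))
                (.resMany (props (k + 1) (P l).degree)
                  (.par (.out (propOut (k + 1)) (packed xl) .nil)
                    ((P l).breakdown (Function.update τ u (.sess S))
                      (Function.update ρ u (.var (.bra u 1))) (k + 1) xl)))]
              .nil)
    | τ, ρ, k, xs, .sel u l P =>
        let S := (τ u).choose l
        let i := (ρ u).base.index
        let new := TBase.sel u (i + 1)
        let ys := paramTuple (.aux 1) (.sess S.dual)
        .par
          (.inp (propIn k) (unpacked xs)
            (.out (propOut (k + 1))
              [.abs .lin ys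
                (.sel (ρ u) l
                  (.inp (ρ u) [.aux 1]
                    (.out (propOut (k + 2)) (packed xs)
                      (.app (.var (.aux 1)) (ys.map fun p => .var p.1)))))]
              .nil))
          (.resMany (sessionTuple new S)
            (.par
              (.inp (propIn (k + 1)) [.aux 2]
                (.app (.var (.aux 2)) ((new.tuple S.decomp.length).map fun b => .sess b true)))
              (P.breakdown (Function.update τ u (.sess S))
                (Function.update ρ u (.sess new false)) (k + 2) xs)))
  /-- The breakdown of a value. -/
  def Val.breakdown :
      (Name ℕ → CTy) → NameMap → ℕ → List ℕ → Val ℕ ℕ → Val TBase TVar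
    | _, _, _, _, .var y => .var (.src y)
    | τ, ρ, k, xs, .abs m ps P =>
        .abs m (ps.flatMap fun p => paramTuple (.idx p.1 1) p.2)
          (.resMany (if m = .shr then props k P.degree else [])
            (.par (.out (propOut k) (packed xs) .nil)
              (P.breakdown (typesParams τ ps) (initParams ρ ps) k xs)))
  /-- The breakdown of a tuple of values, each with its free variables as context. -/
  def Val.breakdowns :
      (Name ℕ → CTy) → NameMap → ℕ → List (Val ℕ ℕ) → List (Val TBase TVar)
    | _, _, _, [] => []
    | τ, ρ, k, V :: Vs =>
        V.breakdown τ ρ k (context V.fv) :: Val.breakdowns τ ρ (k + V.degree) Vs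
end

/-- The decomposition `𝒟(P)` of a closed process `P` that is typed under `Γ` and `Δ`. Its
propagators start at `c_k`. -/
def Proc.decomp (Γ : SEnv ℕ ℕ) (Δ : List (Name ℕ × STy)) (k : ℕ) (P : Proc ℕ ℕ) :
    Proc TBase TVar :=
  .resMany (props k P.degree)
    (.par (.out (propOut k) (packed []) .nil)
      (P.breakdown (typesEnv Γ Δ) Name.init k []))

/-! # Typability of the decomposition

The proof is an induction on the typing derivation of the source (`Typed.good`). Its content is the
invariant `Good`. Suppose that `P` is typed under `Γ`, `Λ` and `Δ`. Then the breakdown of `P`, which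
starts at the propagator `c_k`, is typed under

* the shared names of `𝒢(Γ)`, and no linear value variable: all value variables of `P` arrive along
  `c_k`, whose type `carrier` lists their decomposed types;
* the decomposed session environment `decompEnv`, in which a source name `u` occupies the tuple
  `u_i, …, u_{i+n-1}` that starts at its current indexed name `u_i`;
* the input endpoint of `c_k`, and both endpoints of the propagators `c_{k+1}, …`, one for each unit
  of the degree (`propEnv`). The types of the propagators are existentially quantified.

A communication on `u : S` uses up the first component of `𝒢(S)`, and the remaining components are
`𝒢` of the continuation type, located at `u_{i+1}`: this is `Tracks.comm`. So the prefix of the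
source becomes a process that receives the context along a propagator, performs one communication on
`u_i`, whose type is then `end`, and hands the rest of the context over to the next propagator. The
invariant `Tracks` expresses that the maps that accompany the breakdown agree with the environments
of the source and of the target.

Three points deserve care.

* *Finished sessions.* `𝒢(!⟨U⟩;end)` has a single component, while the source still has `u : end`
  after the output. The names for which this happened are collected in the set `D`, and are missing
  from `decompEnv`. They do not occur any more, which is what `Proc.Tidy` says.
* *Promotion.* A shared variable that the source uses as a linear one may be promoted far above its
  use, even above a splitting of the context. In the target it is transmitted at its shared type and
  promoted only where it is used as a value (`Tracks.promote`). Hence the arrow at which a variable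
  is transmitted is given by a separate map `E`, which may differ from its arrow in the source.
* *Freshness.* Environments have to be well formed at every node of the derivation. Every indexed
  name has at most one `Name.owner`, the source name that it stands for, and the owner does not
  depend on the index. Distinct source names therefore never clash, and the names without an owner
  are apart from the others.

A selection or a branching on `u` is encoded by exchanging an abstraction over the names of the
continuation. In a branching this abstraction binds the names `y^u_i`, so that the branch is typed
as an abstraction of its breakdown (`Good.bra`). In a selection the process continues on a fresh
session, of which the dual endpoints are passed to the abstraction received from the partner
(`Typed.selection`, `Good.sel`). -/

/-! ### Environments and typing judgements -/

theorem List.lookup_filter_fst {α β : Type} [DecidableEq α] (f : α → Bool) (l : List (α × β))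
    (k : α) : (l.filter fun p => f p.1).lookup k = if f k then l.lookup k else none := by
  induction l with
  | nil => simp
  | cons p l ih =>
    obtain ⟨a, b⟩ := p
    by_cases hk : k = a
    · subst hk
      cases hf : f k with
      | true => simp [hf]
      | false => rw [List.filter_cons_of_neg (by simp [hf]), ih, hf]; rfl
    · by_cases hf : f a = true <;> simp_all [List.lookup_cons, beq_eq_false_iff_ne.2 hk]

theorem List.mem_of_lookup_eq_some {α β : Type} [DecidableEq α] {l : List (α × β)} {k : α} {b : β}
    (h : l.lookup k = some b) : (k, b) ∈ l := by
  obtain ⟨l₁, l₂, rfl, -⟩ := List.lookup_eq_some_iff.1 h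
  simp

section General
variable {B X : Type} [DecidableEq B] [DecidableEq X] {F : TypeLang}

omit [DecidableEq B] in
theorem SEnv.lookup_eraseVals (Γ : SEnv B X) (xs : List X) (x : X) :
    (Γ.eraseVals xs).vals.lookup x = if x ∈ xs then none else Γ.vals.lookup x := by
  have := List.lookup_filter_fst (fun y => decide (y ∉ xs)) Γ.vals x
  by_cases h : x ∈ xs
  · simpa only [SEnv.eraseVals, h, not_true, decide_false, Bool.false_eq_true, if_false, if_true]
      using this
  · simpa only [SEnv.eraseVals, h, not_false_iff, decide_true, if_true, if_false] using this

theorem Typed.envOk {Γ : SEnv B X} {Λ : LEnv X} {Δ : DEnv B} {P : Proc B X}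
    (h : Typed F Γ Λ Δ P) : EnvOk F Γ Λ Δ := by
  cases h <;> assumption

theorem ValTyped.envOk {Γ : SEnv B X} {Λ : LEnv X} {Δ : DEnv B} {V : Val B X} {U : VTy}
    (h : ValTyped F Γ Λ Δ V U) : EnvOk F Γ Λ Δ := by
  cases h <;> assumption

theorem valsTyped_singleton {Γ : SEnv B X} {Λ : LEnv X} {Δ : DEnv B} {V : Val B X} {U : VTy} :
    ValsTyped F Γ Λ Δ [V] [U] ↔ ValTyped F Γ Λ Δ V U := by
  constructor
  · intro h
    cases h with
    | cons h₁ h₂ => cases h₂; simpa using h₁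
  · intro h
    simpa using ValsTyped.cons h .nil

theorem Typed.cast {Γ : SEnv B X} {Λ Λ' : LEnv X} {Δ Δ' : DEnv B} {P : Proc B X}
    (h : Typed F Γ Λ Δ P) (hΛ : Λ' = Λ) (hΔ : Δ' = Δ) : Typed F Γ Λ' Δ' P := by
  rwa [hΛ, hΔ]

theorem ValTyped.cast {Γ : SEnv B X} {Λ Λ' : LEnv X} {Δ Δ' : DEnv B} {V : Val B X} {U U' : VTy}
    (h : ValTyped F Γ Λ Δ V U) (hΛ : Λ' = Λ) (hΔ : Δ' = Δ) (hU : U' = U) :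
    ValTyped F Γ Λ' Δ' V U' := by
  rwa [hΛ, hΔ, hU]

/-- The part of `EnvOk` that concerns value variables. -/
structure ValOk (F : TypeLang) (vals : List (X × List CTy)) (Λ : LEnv X) : Prop where
  nodup : (Λ.map Prod.fst).Nodup
  disj : ∀ p ∈ Λ, vals.lookup p.1 = none
  ty_val : ∀ p ∈ vals, F.val (.hot .shr p.2)
  ty_lin : ∀ p ∈ Λ, F.val (.hot .lin p.2)

/-- The part of `EnvOk` that concerns names. -/
structure SesOk (F : TypeLang) (chans : List (Name B × VTy)) (Δ : DEnv B) : Prop where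
  nodup : (Δ.map Prod.fst).Nodup
  disj : ∀ p ∈ Δ, chans.lookup p.1 = none
  kind_chan : ∀ p ∈ chans, ∀ s bar, p.1 ≠ .sess s bar
  kind_ses : ∀ p ∈ Δ, ∀ a, p.1 ≠ .shared a
  ty_chan : ∀ p ∈ chans, F.val p.2
  ty_ses : ∀ p ∈ Δ, F.ses p.2

theorem envOk_iff {Γ : SEnv B X} {Λ : LEnv X} {Δ : DEnv B} :
    EnvOk F Γ Λ Δ ↔ ValOk F Γ.vals Λ ∧ SesOk F Γ.chans Δ :=
  ⟨fun h => ⟨⟨h.1, h.3, h.7, h.9⟩, ⟨h.2, h.4, h.5, h.6, h.8, h.10⟩⟩,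
    fun ⟨h, h'⟩ => ⟨h.1, h'.1, h.2, h'.2, h'.3, h'.4, h.3, h'.5, h.4, h'.6⟩⟩

theorem ValOk.mono {vals : List (X × List CTy)} {Λ Λ' : LEnv X} (h : ValOk F vals Λ)
    (hle : Λ' ≤ Λ) : ValOk F vals Λ' :=
  ⟨Multiset.nodup_of_le (Multiset.map_le_map hle) h.1,
    fun p hp => h.2 p (Multiset.mem_of_le hle hp),
    h.3, fun p hp => h.4 p (Multiset.mem_of_le hle hp)⟩

theorem SesOk.mono {chans : List (Name B × VTy)} {Δ Δ' : DEnv B} (h : SesOk F chans Δ)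
    (hle : Δ' ≤ Δ) : SesOk F chans Δ' :=
  ⟨Multiset.nodup_of_le (Multiset.map_le_map hle) h.1,
    fun p hp => h.2 p (Multiset.mem_of_le hle hp),
    h.3, fun p hp => h.4 p (Multiset.mem_of_le hle hp), h.5,
    fun p hp => h.6 p (Multiset.mem_of_le hle hp)⟩

theorem SesOk.left {chans : List (Name B × VTy)} {Δ Δ' : DEnv B} (h : SesOk F chans (Δ + Δ')) :
    SesOk F chans Δ := h.mono (Multiset.le_add_right _ _)

theorem SesOk.right {chans : List (Name B × VTy)} {Δ Δ' : DEnv B} (h : SesOk F chans (Δ + Δ')) :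
    SesOk F chans Δ' := h.mono (Multiset.le_add_left _ _)

theorem ValOk.right {vals : List (X × List CTy)} {Λ Λ' : LEnv X} (h : ValOk F vals (Λ + Λ')) :
    ValOk F vals Λ' := h.mono (Multiset.le_add_left _ _)

theorem EnvOk.valOk {Γ : SEnv B X} {Λ : LEnv X} {Δ : DEnv B} (h : EnvOk F Γ Λ Δ) :
    ValOk F Γ.vals Λ := (envOk_iff.1 h).1

theorem EnvOk.sesOk {Γ : SEnv B X} {Λ : LEnv X} {Δ : DEnv B} (h : EnvOk F Γ Λ Δ) :
    SesOk F Γ.chans Δ := (envOk_iff.1 h).2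

theorem EnvOk.mono {Γ : SEnv B X} {Λ Λ' : LEnv X} {Δ Δ' : DEnv B} (h : EnvOk F Γ Λ Δ)
    (hΛ : Λ' ≤ Λ) (hΔ : Δ' ≤ Δ) : EnvOk F Γ Λ' Δ' :=
  envOk_iff.2 ⟨h.valOk.mono hΛ, h.sesOk.mono hΔ⟩

/-- Changing the type of one name. -/
theorem SesOk.retype {chans : List (Name B × VTy)} {Δ : DEnv B} {u : Name B} {S S' : STy}
    (h : SesOk F chans ({(u, S)} + Δ)) (hS : F.ses S') : SesOk F chans ({(u, S')} + Δ) := by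
  obtain ⟨h1, h2, h3, h4, h5, h6⟩ := h
  simp only [Multiset.singleton_add, Multiset.map_cons, Multiset.mem_cons, forall_eq_or_imp]
    at h1 h2 h4 h6
  rw [Multiset.singleton_add]
  refine ⟨?_, ?_, h3, ?_, h5, ?_⟩
  · rwa [Multiset.map_cons]
  all_goals rw [Multiset.forall_mem_cons]
  exacts [h2, h4, ⟨hS, h6.2⟩]

theorem SesOk.add {chans : List (Name B × VTy)} {Δ Δ' : DEnv B} (h : SesOk F chans Δ)
    (h' : SesOk F chans Δ') (hd : ∀ p ∈ Δ, ∀ q ∈ Δ', p.1 ≠ q.1) : SesOk F chans (Δ + Δ') := by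
  refine ⟨?_, ?_, h.3, ?_, h.5, ?_⟩
  · rw [Multiset.map_add, Multiset.nodup_add]
    refine ⟨h.1, h'.1, ?_⟩
    rw [Multiset.disjoint_left]
    intro a ha hb
    obtain ⟨p, hp, rfl⟩ := Multiset.mem_map.1 ha
    obtain ⟨q, hq, hpq⟩ := Multiset.mem_map.1 hb
    exact hd p hp q hq hpq.symm
  all_goals
    intro p hp
    rcases Multiset.mem_add.1 hp with hp | hp
  exacts [h.2 p hp, h'.2 p hp, h.4 p hp, h'.4 p hp, h.6 p hp, h'.6 p hp]

/-- Weakening with a finished session. -/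
theorem Typed.weaken {Γ : SEnv B X} {Λ : LEnv X} {Δ : DEnv B} {P : Proc B X} (u : Name B)
    (h : Typed F Γ Λ Δ P) (hok : SesOk F Γ.chans ({(u, .done)} + Δ)) :
    Typed F Γ Λ ({(u, .done)} + Δ) P :=
  h.endW u (envOk_iff.2 ⟨h.envOk.valOk, hok⟩)

theorem Typed.send_one {Γ : SEnv B X} {Λ₁ Λ₂ : LEnv X} {Δ₁ Δ₂ Δ : DEnv B} {u : Name B}
    {P : Proc B X} {Vs : List (Val B X)} (Us : List VTy)
    (hP : Typed F Γ Λ₁ ({(u, .done)} + Δ₁) P) (hV : ValsTyped F Γ Λ₂ Δ₂ Vs Us)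
    (hΔ : Δ = {(u, .out Us .done)} + (Δ₁ + Δ₂)) (hv : ValOk F Γ.vals (Λ₂ + Λ₁))
    (hs : SesOk F Γ.chans Δ) : Typed F Γ (Λ₂ + Λ₁) Δ (.out u Vs P) := by
  subst hΔ
  rw [add_comm Λ₂ Λ₁] at hv ⊢
  exact .send Us .done hP hV (by simp) (envOk_iff.2 ⟨hv, hs⟩)

theorem Typed.rcv_one {Γ : SEnv B X} {Λ Λ' : LEnv X} {Δ : DEnv B} {u : Name B}
    {P : Proc B X} {xs : List X} (Us : List VTy) (hx : xs.Nodup) (hl : xs.length = Us.length)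
    (hP : Typed F (Γ.bindVals (xs.zip Us)) Λ' ({(u, .done)} + Δ) P)
    (hΛ : Λ' = linearVars (xs.zip Us) + Λ)
    (hv : ValOk F Γ.vals Λ) (hs : F.ses (.inp Us .done)) :
    Typed F Γ Λ ({(u, .inp Us .done)} + Δ) (.inp u xs P) := by
  subst hΛ
  exact .rcv Us .done hx hl hP (envOk_iff.2 ⟨hv, hP.envOk.sesOk.retype hs⟩)

/-- Both endpoints of each of the sessions `s : S` of a list. -/
def bothEnds (l : List (B × STy)) : DEnv B :=
  (l.flatMap fun p => [(.sess p.1 false, p.2), (.sess p.1 true, p.2.dual)] : List (Name B × STy))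

omit [DecidableEq B] in
theorem bothEnds_cons (p : B × STy) (l : List (B × STy)) :
    bothEnds (p :: l) =
      {(.sess p.1 false, p.2)} + {(.sess p.1 true, p.2.dual)} + bothEnds l := by
  simp [bothEnds]

omit [DecidableEq B] in
theorem bothEnds_eq (l : List (B × STy)) :
    bothEnds l = (l.map fun p => (.sess p.1 false, p.2) : List (Name B × STy)) +
      (l.map fun p => (.sess p.1 true, p.2.dual) : List (Name B × STy)) := by
  induction l with
  | nil => rfl
  | cons p l ih =>
    rw [bothEnds_cons, ih, List.map_cons, List.map_cons, ← Multiset.cons_coe, ← Multiset.cons_coe,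
      ← Multiset.singleton_add, ← Multiset.singleton_add]
    abel

theorem Typed.resMany {Γ : SEnv B X} {Λ : LEnv X} {Δ : DEnv B} {P : Proc B X}
    {ann : STy → Option STy} (hann : ∀ S, ann S = none ∨ ann S = some S) (l : List (B × STy))
    (h : Typed F Γ Λ (bothEnds l + Δ) P) :
    Typed F Γ Λ Δ (Proc.resMany (l.map fun p => (p.1, ann p.2)) P) := by
  induction l generalizing Δ with
  | nil => simpa [bothEnds, Proc.resMany] using h
  | cons p l ih =>
    have h' := ih (Δ := (.sess p.1 false, p.2) ::ₘ (.sess p.1 true, p.2.dual) ::ₘ Δ)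
      (h.cast rfl (by
        rw [bothEnds_cons]; simp only [← Multiset.singleton_add]; abel))
    exact .resS p.1 _ p.2 (hann _) h' (h'.envOk.mono le_rfl
      ((Multiset.le_cons_self _ _).trans (Multiset.le_cons_self _ _)))

end General

theorem STy.decomp_ne_nil (S : STy) : S.decomp ≠ [] := by
  cases S with
  | out Us S => cases S <;> simp [STy.decomp]
  | inp Us S => cases S <;> simp [STy.decomp]
  | _ => simp [STy.decomp]

theorem CTy.decomp_ne_nil (C : CTy) : C.decomp ≠ [] := by
  cases C <;> simp [CTy.decomp, STy.decomp_ne_nil]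

theorem STy.decomp_out {Us : List VTy} {S : STy} (h : S ≠ .done) :
    (STy.out Us S).decomp = .out (VTy.decomps Us) .done :: S.decomp := by
  cases S <;> simp_all [STy.decomp]

theorem STy.decomp_inp {Us : List VTy} {S : STy} (h : S ≠ .done) :
    (STy.inp Us S).decomp = .inp (VTy.decomps Us) .done :: S.decomp := by
  cases S <;> simp_all [STy.decomp]

theorem STy.Minimal.dual {c : Bool} : ∀ {S : STy}, S.Minimal c → S.dual.Minimal c
  | _, .done => .done
  | _, .out h h' => .inp h h'
  | _, .inp h h' => .out h h'
  | _, .sel h h' => .bra h fun l => (h' l).dual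
  | _, .bra h h' => .sel h fun l => (h' l).dual

mutual
  theorem STy.Std.decomp {c : Bool} : ∀ {S : STy}, S.Std c → ∀ M ∈ S.decomp, M.Minimal c
    | _, .done => by simp [STy.decomp, STy.Minimal.done]
    | _, .out (U := U) (S := S) hU hS => by
        have h := hU.decomp
        have h' : (STy.out (VTy.decomps [U]) .done).Minimal c :=
          .out (by simp [VTy.decomps]) (by simpa [VTy.decomps] using h)
        have h'' := hS.decomp
        by_cases hd : S = .done
        · subst hd; simpa [STy.decomp] using h'
        · rw [STy.decomp_out hd]
          exact List.forall_mem_cons.2 ⟨h', h''⟩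
    | _, .inp (U := U) (S := S) hU hS => by
        have h := hU.decomp
        have h' : (STy.inp (VTy.decomps [U]) .done).Minimal c :=
          .inp (by simp [VTy.decomps]) (by simpa [VTy.decomps] using h)
        have h'' := hS.decomp
        by_cases hd : S = .done
        · subst hd; simpa [STy.decomp] using h'
        · rw [STy.decomp_inp hd]
          exact List.forall_mem_cons.2 ⟨h', h''⟩
    | _, .sel (S := S) hL hS => by
        have h := fun l => (hS l).decomp
        simp only [STy.decomp, List.mem_singleton, forall_eq]
        refine .sel hL fun l => .inp (by simp) ?_
        simp only [List.mem_singleton, forall_eq]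
        refine .hot (by simp [STy.decomp_ne_nil]) ?_
        simp only [List.mem_map, forall_exists_index, and_imp, forall_apply_eq_imp_iff₂]
        exact fun M hM => .sess (h l M hM).dual
    | _, .bra (S := S) hL hS => by
        have h := fun l => (hS l).decomp
        simp only [STy.decomp, List.mem_singleton, forall_eq]
        refine .bra hL fun l => .out (by simp) ?_
        simp only [List.mem_singleton, forall_eq]
        refine .hot (by simp [STy.decomp_ne_nil]) ?_
        simp only [List.mem_map, forall_exists_index, and_imp, forall_apply_eq_imp_iff₂]
        exact fun M hM => .sess (h l M hM)
  theorem VTy.Std.decomp {c : Bool} : ∀ {U : VTy}, U.Std c → U.decomp.Minimal c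
    | _, .hot (C := C) hC => by
        have h := hC.decomp
        refine .hot ?_ ?_
        · simp [CTy.decomps, CTy.decomp_ne_nil]
        · simpa [CTy.decomps] using h
  theorem CTy.Std.decomp {c : Bool} : ∀ {C : CTy}, C.Std c → ∀ C' ∈ C.decomp, C'.Minimal c
    | _, .sess hS => by
        have h := hS.decomp
        simp only [CTy.decomp, List.mem_map, forall_exists_index, and_imp, forall_apply_eq_imp_iff₂]
        exact fun M hM => .sess (h M hM)
    | _, .chan hU => by
        have h := hU.decomp
        simp only [CTy.decomp, List.mem_singleton, forall_eq]
        exact .chan h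
end

theorem STy.Std.of_dual {c : Bool} : ∀ {S : STy}, S.Std c → S.dual.Std c
  | _, .done => .done
  | _, .out h h' => .inp h h'.of_dual
  | _, .inp h h' => .out h h'.of_dual
  | _, .sel h h' => .bra h fun l => (h' l).of_dual
  | _, .bra h h' => .sel h fun l => (h' l).of_dual

theorem VTy.Std.decomps_shr {c : Bool} {m : Arrow} {Cs : List CTy} (h : (VTy.hot m Cs).Std c)
    (m' : Arrow) : (VTy.hot m' (CTy.decomps Cs)).Minimal c := by
  have := h.decomp
  simp only [VTy.decomp] at this
  cases this with
  | hot h h' => exact .hot h h'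

/-! ### Indexed names and propagators -/

theorem TBase.shift_zero (b : TBase) : b.shift 0 = b := by
  cases b <;> simp [TBase.shift]

theorem TBase.shift_shift (b : TBase) (i j : ℕ) : (b.shift i).shift j = b.shift (j + i) := by
  cases b <;> simp [TBase.shift] <;> omega

theorem TBase.shift_injective (b : TBase) : Function.Injective b.shift := by
  intro i j h
  cases b <;> simpa [TBase.shift] using h

theorem Name.shift_zero (n : Name TBase) : n.shift 0 = n := by
  cases n <;> simp [Name.shift, TBase.shift_zero]

theorem Name.shift_shift (n : Name TBase) (i j : ℕ) : (n.shift i).shift j = n.shift (j + i) := by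
  cases n <;> simp [Name.shift, TBase.shift_shift]

theorem Name.shift_injective (n : Name TBase) : Function.Injective n.shift := by
  intro i j h
  cases n <;> exact TBase.shift_injective _ (by simpa [Name.shift] using h)

theorem TBase.tuple_succ (b : TBase) (n : ℕ) : b.tuple (n + 1) = b :: (b.shift 1).tuple n := by
  simp [TBase.tuple, List.range_succ_eq_map, TBase.shift_zero, TBase.shift_shift,
    Function.comp_def]

theorem Name.tuple_succ (u : Name TBase) (n : ℕ) : u.tuple (n + 1) = u :: (u.shift 1).tuple n := by
  simp [Name.tuple, List.range_succ_eq_map, Name.shift_zero, Name.shift_shift,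
    Function.comp_def]

theorem Name.tuple_length (u : Name TBase) (n : ℕ) : (u.tuple n).length = n := by
  simp [Name.tuple]

theorem TBase.tuple_length (b : TBase) (n : ℕ) : (b.tuple n).length = n := by
  simp [TBase.tuple]

theorem Name.tuple_nodup (u : Name TBase) (n : ℕ) : (u.tuple n).Nodup :=
  List.nodup_range.map u.shift_injective

theorem TBase.tuple_nodup (b : TBase) (n : ℕ) : (b.tuple n).Nodup :=
  List.nodup_range.map b.shift_injective

theorem Name.sess_tuple (b : TBase) (bar : Bool) (n : ℕ) :
    (Name.sess b bar).tuple n = (b.tuple n).map fun b => .sess b bar := by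
  simp [Name.tuple, TBase.tuple, Name.shift]

theorem Name.var_tuple (b : TBase) (n : ℕ) :
    (Name.var b).tuple n = (b.tuple n).map .var := by
  simp [Name.tuple, TBase.tuple, Name.shift]

/-- The source name that an indexed name stands for, if there is one. Propagators, auxiliary
parameters and the dual endpoints `v̄` of the sessions introduced for selections have no owner.
Names with different owners are different, whatever their indices. -/
def Name.owner : Name TBase → Option (Name ℕ)
  | .sess (.idx s _) bar => some (.sess s bar)
  | .sess (.sel u _) false => some u
  | .shared (.idx a _) => some (.shared a)
  | .var (.idx y _) => some (.var y)
  | .var (.bra u _) => some u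
  | _ => none

theorem Name.owner_shift (n : Name TBase) (j : ℕ) : (n.shift j).owner = n.owner := by
  rcases n with ⟨s, _ | _⟩ | a | y
  · cases s <;> rfl
  · cases s <;> rfl
  · cases a <;> rfl
  · cases y <;> rfl

theorem Name.owner_init (u : Name ℕ) : u.init.owner = some u := by
  cases u <;> rfl

theorem Name.init_injective : Function.Injective Name.init := by
  intro u v h
  have := congrArg Name.owner h
  simpa [Name.owner_init] using this

theorem Name.ne_shared_of_owner {n : Name TBase} {u : Name ℕ} (h : n.owner = some u)
    (hu : ∀ a, u ≠ .shared a) (b : TBase) : n ≠ .shared b := by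
  rintro rfl
  cases b <;> simp [Name.owner] at h
  exact hu _ h.symm

/-- The assignments `(u_i,…,u_{i+n-1}) : 𝒢(S)`, for `u = u_i` and `n = |𝒢(S)|`. -/
def entry (u : Name TBase) (S : STy) : List (Name TBase × STy) :=
  (u.tuple S.decomp.length).zip S.decomp

theorem entry_map_fst (u : Name TBase) (S : STy) :
    (entry u S).map Prod.fst = u.tuple S.decomp.length := by
  rw [entry, List.map_fst_zip]
  simp [Name.tuple_length]

theorem mem_entry {u : Name TBase} {S : STy} {q : Name TBase × STy} (h : q ∈ entry u S) :
    q.1 ∈ u.tuple S.decomp.length ∧ q.2 ∈ S.decomp := by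
  obtain ⟨a, b⟩ := q
  exact ⟨(List.of_mem_zip h).1, (List.of_mem_zip h).2⟩

theorem owner_of_mem_entry {u : Name TBase} {S : STy} {q : Name TBase × STy} (h : q ∈ entry u S) :
    q.1.owner = u.owner := by
  obtain ⟨j, -, hj⟩ := List.mem_map.1 (mem_entry h).1
  rw [← hj, Name.owner_shift]

theorem entry_of_decomp {u : Name TBase} {S M : STy} (h : S.decomp = [M]) :
    entry u S = [(u, M)] := by
  simp [entry, h, Name.tuple, Name.shift_zero]

theorem entry_of_decomp_cons {u : Name TBase} {S S' M : STy} (h : S.decomp = M :: S'.decomp) :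
    entry u S = (u, M) :: entry (u.shift 1) S' := by
  simp [entry, h, Name.tuple_succ]

theorem entry_sess (b : TBase) (bar : Bool) (S : STy) :
    entry (.sess b bar) S =
      ((b.tuple S.decomp.length).zip S.decomp).map fun p => (.sess p.1 bar, p.2) := by
  rw [entry, Name.sess_tuple, List.zip_map_left]
  rfl

theorem entry_sess_dual (b : TBase) (S : STy) :
    entry (.sess b true) S.dual =
      ((b.tuple S.decomp.length).zip S.decomp).map fun p => (.sess p.1 true, p.2.dual) := by
  rw [entry, STy.decomp_dual, Name.sess_tuple, List.zip_map]
  simp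

/-- The linear environment `𝒢(Δ)` with the current indexed names of `ρ`, where the names in `D`,
which are no longer used, are left out. -/
def decompEnv (ρ : NameMap) (D : Finset (Name ℕ)) (Δ : DEnv ℕ) : DEnv TBase :=
  (Δ.filter fun p => p.1 ∉ D).bind fun p => (entry (ρ p.1) p.2 : Multiset (Name TBase × STy))

section
variable {ρ ρ' : NameMap} {D D' : Finset (Name ℕ)}

theorem decompEnv_zero : decompEnv ρ D 0 = 0 := rfl

theorem decompEnv_add (Δ Δ' : DEnv ℕ) :
    decompEnv ρ D (Δ + Δ') = decompEnv ρ D Δ + decompEnv ρ D Δ' := by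
  simp [decompEnv, Multiset.filter_add, Multiset.add_bind]

theorem decompEnv_of_mem {u : Name ℕ} (S : STy) (h : u ∈ D) : decompEnv ρ D {(u, S)} = 0 := by
  simp [decompEnv, Multiset.filter_singleton, h]

theorem decompEnv_of_notMem {u : Name ℕ} (S : STy) (h : u ∉ D) :
    decompEnv ρ D {(u, S)} = entry (ρ u) S := by
  simp [decompEnv, Multiset.filter_singleton, h]

theorem decompEnv_congr {Δ : DEnv ℕ} (hρ : ∀ p ∈ Δ, ρ p.1 = ρ' p.1)
    (hD : ∀ p ∈ Δ, p.1 ∈ D ↔ p.1 ∈ D') : decompEnv ρ D Δ = decompEnv ρ' D' Δ := by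
  unfold decompEnv
  rw [Multiset.filter_congr (q := fun p => p.1 ∉ D') fun p hp => not_congr (hD p hp)]
  exact Multiset.bind_congr fun p hp => by rw [hρ p (Multiset.mem_filter.1 hp).1]

theorem mem_decompEnv {Δ : DEnv ℕ} {q : Name TBase × STy} :
    q ∈ decompEnv ρ D Δ ↔ ∃ p ∈ Δ, p.1 ∉ D ∧ q ∈ entry (ρ p.1) p.2 := by
  simp only [decompEnv, Multiset.mem_bind, Multiset.mem_filter, Multiset.mem_coe, and_assoc]

theorem nodup_decompEnv {Δ : DEnv ℕ} (h : (Δ.map Prod.fst).Nodup)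
    (ho : ∀ p ∈ Δ, p.1 ∉ D → (ρ p.1).owner = some p.1) :
    ((decompEnv ρ D Δ).map Prod.fst).Nodup := by
  induction Δ using Multiset.induction with
  | empty => simp [decompEnv_zero]
  | cons p Δ ih =>
    rw [Multiset.map_cons, Multiset.nodup_cons] at h
    rw [Multiset.forall_mem_cons] at ho
    have ih := ih h.2 ho.2
    rw [← Multiset.singleton_add, decompEnv_add]
    by_cases hp : p.1 ∈ D
    · rwa [decompEnv_of_mem _ hp, zero_add]
    · rw [decompEnv_of_notMem _ hp, Multiset.map_add, Multiset.nodup_add]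
      refine ⟨?_, ih, ?_⟩
      · rw [Multiset.map_coe, entry_map_fst]
        exact Name.tuple_nodup _ _
      · rw [Multiset.disjoint_left]
        intro a ha hb
        obtain ⟨q, hq, rfl⟩ := Multiset.mem_map.1 ha
        obtain ⟨q', hq', he⟩ := Multiset.mem_map.1 hb
        obtain ⟨p', hp', hD', hq'⟩ := mem_decompEnv.1 hq'
        have h1 := owner_of_mem_entry hq
        have h2 := owner_of_mem_entry hq'
        rw [ho.2 p' hp' hD'] at h2
        rw [ho.1 hp, ← he, h2] at h1
        exact h.1 (Multiset.mem_map.2 ⟨p', hp', by simpa using h1⟩)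

end

/-- Both endpoints of the propagators `c_k, c_{k+1}, …`, typed by `Ms`. -/
def propEnv (k : ℕ) (Ms : List STy) : DEnv TBase :=
  bothEnds (((TBase.prop k).tuple Ms.length).zip Ms)

theorem propEnv_nil (k : ℕ) : propEnv k [] = 0 := rfl

theorem propEnv_cons (k : ℕ) (M : STy) (Ms : List STy) :
    propEnv k (M :: Ms) = {(propIn k, M)} + {(propOut k, M.dual)} + propEnv (k + 1) Ms := by
  rw [propEnv, List.length_cons, TBase.tuple_succ, List.zip_cons_cons, bothEnds_cons]
  rfl

theorem propEnv_append (k : ℕ) (Ms Ms' : List STy) :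
    propEnv k (Ms ++ Ms') = propEnv k Ms + propEnv (k + Ms.length) Ms' := by
  induction Ms generalizing k with
  | nil => simp [propEnv_nil]
  | cons M Ms ih =>
    rw [List.cons_append, propEnv_cons, propEnv_cons, ih, List.length_cons,
      show k + (Ms.length + 1) = k + 1 + Ms.length by omega]
    abel

theorem mem_propEnv {k : ℕ} {Ms : List STy} {q : Name TBase × STy} (h : q ∈ propEnv k Ms) :
    (∃ j bar, k ≤ j ∧ q.1 = .sess (.prop j) bar) ∧ ∃ M ∈ Ms, q.2 = M ∨ q.2 = M.dual := by
  induction Ms generalizing k with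
  | nil => simp [propEnv_nil] at h
  | cons M Ms ih =>
    rw [propEnv_cons, Multiset.mem_add, Multiset.mem_add, Multiset.mem_singleton,
      Multiset.mem_singleton] at h
    rcases h with (rfl | rfl) | h
    · exact ⟨⟨k, false, le_rfl, rfl⟩, M, by simp, .inl rfl⟩
    · exact ⟨⟨k, true, le_rfl, rfl⟩, M, by simp, .inr rfl⟩
    · obtain ⟨⟨j, bar, hj, he⟩, N, hN, he'⟩ := ih h
      exact ⟨⟨j, bar, by omega, he⟩, N, by simp [hN], he'⟩

theorem propEnv_names_nodup (k : ℕ) (Ms : List STy) : ((propEnv k Ms).map Prod.fst).Nodup := by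
  induction Ms generalizing k with
  | nil => simp [propEnv_nil]
  | cons M Ms ih =>
    have hk : ∀ bar, Name.sess (.prop k) bar ∉ (propEnv (k + 1) Ms).map Prod.fst := by
      intro bar h
      obtain ⟨q, hq, he⟩ := Multiset.mem_map.1 h
      obtain ⟨⟨j, bar', hj, he'⟩, -⟩ := mem_propEnv hq
      rw [he] at he'
      simp only [Name.sess.injEq, TBase.prop.injEq] at he'
      omega
    rw [propEnv_cons, add_assoc, Multiset.singleton_add, Multiset.singleton_add, Multiset.map_cons,
      Multiset.map_cons, Multiset.nodup_cons, Multiset.nodup_cons, Multiset.mem_cons]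
    refine ⟨?_, hk true, ih _⟩
    rintro (h | h)
    · simp [propIn, propOut] at h
    · exact hk false h

/-! ### Value variables carried by propagators -/

section
variable {B X : Type} [DecidableEq X]

theorem lookup_sharedVars_of_notMem {L : List (X × VTy)} {x : X} (h : x ∉ L.map Prod.fst) :
    (sharedVars L).lookup x = none := by
  rw [List.lookup_eq_none_iff]
  rintro ⟨y, Cs⟩ hp
  obtain ⟨⟨z, ⟨m, Ds⟩⟩, hz, he⟩ := List.mem_filterMap.1 hp
  cases m <;> simp at he
  obtain ⟨rfl, rfl⟩ := he
  simp only [bne_iff_ne, ne_eq]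
  rintro rfl
  exact h (List.mem_map.2 ⟨_, hz, rfl⟩)

theorem lookup_sharedVars_of_mem {L : List (X × VTy)} {x : X} {m : Arrow} {Cs : List CTy}
    (hL : (L.map Prod.fst).Nodup) (h : (x, .hot m Cs) ∈ L) :
    (sharedVars L).lookup x = if m = .shr then some Cs else none := by
  induction L with
  | nil => simp at h
  | cons p L ih =>
    rw [List.map_cons, List.nodup_cons] at hL
    obtain ⟨y, ⟨m', Ds⟩⟩ := p
    rcases List.mem_cons.1 h with h | h'
    · simp only [Prod.mk.injEq, VTy.hot.injEq] at h
      obtain ⟨rfl, rfl, rfl⟩ := h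
      have := lookup_sharedVars_of_notMem hL.1
      cases m
      · simpa [sharedVars] using this
      · simp [sharedVars]
    · have hne : x ≠ y := by
        rintro rfl
        exact hL.1 (List.mem_map.2 ⟨_, h', rfl⟩)
      have ih := ih hL.2 h'
      cases m'
      · exact ih
      · rw [← ih]
        simp [sharedVars, List.lookup_cons, beq_eq_false_iff_ne.2 hne]

theorem SEnv.lookup_bindVals (Γ : SEnv B X) (L : List (X × VTy)) (x : X) :
    (Γ.bindVals L).vals.lookup x =
      ((sharedVars L).lookup x).or (if x ∈ L.map Prod.fst then none else Γ.vals.lookup x) := by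
  rw [SEnv.bindVals, List.lookup_append, SEnv.lookup_eraseVals]

theorem SEnv.lookup_bindVals_of_notMem (Γ : SEnv B X) {L : List (X × VTy)} {x : X}
    (h : x ∉ L.map Prod.fst) : (Γ.bindVals L).vals.lookup x = Γ.vals.lookup x := by
  rw [SEnv.lookup_bindVals, lookup_sharedVars_of_notMem h, if_neg h]
  rfl

theorem SEnv.lookup_bindVals_of_mem (Γ : SEnv B X) {L : List (X × VTy)} {x : X} {m : Arrow}
    {Cs : List CTy} (hL : (L.map Prod.fst).Nodup) (h : (x, .hot m Cs) ∈ L) :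
    (Γ.bindVals L).vals.lookup x = if m = .shr then some Cs else none := by
  rw [SEnv.lookup_bindVals, lookup_sharedVars_of_mem hL h, if_pos (List.mem_map.2 ⟨_, h, rfl⟩)]
  simp

theorem SEnv.mem_bindVals {Γ : SEnv B X} {L : List (X × VTy)} {p : X × List CTy}
    (h : p ∈ (Γ.bindVals L).vals) : (p.1, .hot .shr p.2) ∈ L ∨ p ∈ Γ.vals := by
  rcases List.mem_append.1 h with h | h
  · left
    obtain ⟨⟨z, ⟨m, Ds⟩⟩, hz, he⟩ := List.mem_filterMap.1 h
    cases m <;> simp at he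
    rwa [← he]
  · right
    exact List.mem_of_mem_filter h

end

/-- The type of the dummy value. -/
def dummyTy : VTy := .hot .shr [.sess .done]

/-- The assignments of decomposed types to the variables that are received along a propagator with
context `s`. The map `E` gives the types in the source, with the arrow at which they are
transmitted. -/
def carried (E : ℕ → VTy) (s : Finset ℕ) : List (TVar × VTy) :=
  if context s = [] then [(.aux 0, dummyTy)]
  else (context s).map fun x => (.src x, (E x).decomp)

/-- The type of the input endpoint of a propagator with context `s`. -/
def carrier (E : ℕ → VTy) (s : Finset ℕ) : STy := .inp ((carried E s).map Prod.snd) .done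

/-- The linear assignment that `E` makes to a value variable, if it is linear. -/
def linOne (E : ℕ → VTy) (x : ℕ) : LEnv TVar :=
  match E x with
  | .hot .lin Cs => {(.src x, CTy.decomps Cs)}
  | .hot .shr _ => 0

/-- The linear assignments among those of `E` to the variables in `s`. -/
def linPart (E : ℕ → VTy) (s : Finset ℕ) : LEnv TVar := ∑ x ∈ s, linOne E x

theorem mem_context {s : Finset ℕ} {x : ℕ} : x ∈ context s ↔ x ∈ s := by
  simp [context]

theorem context_nodup (s : Finset ℕ) : (context s).Nodup := Finset.sort_nodup _ _

theorem context_eq_nil {s : Finset ℕ} : context s = [] ↔ s = ∅ := by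
  rw [List.eq_nil_iff_forall_not_mem, Finset.eq_empty_iff_forall_notMem]
  simp [mem_context]

theorem linOne_lin {E : ℕ → VTy} {x : ℕ} {Cs : List CTy} (h : E x = .hot .lin Cs) :
    linOne E x = {(.src x, CTy.decomps Cs)} := by
  simp [linOne, h]

theorem linOne_shr {E : ℕ → VTy} {x : ℕ} {Cs : List CTy} (h : E x = .hot .shr Cs) :
    linOne E x = 0 := by
  simp [linOne, h]

theorem linPart_congr {E E' : ℕ → VTy} {s : Finset ℕ} (h : ∀ x ∈ s, E x = E' x) :
    linPart E s = linPart E' s :=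
  Finset.sum_congr rfl fun x hx => by rw [linOne, linOne, h x hx]

theorem linPart_eq_zero {E : ℕ → VTy} {s : Finset ℕ} (h : ∀ x ∈ s, ∃ Cs, E x = .hot .shr Cs) :
    linPart E s = 0 :=
  Finset.sum_eq_zero fun x hx => by
    obtain ⟨Cs, hC⟩ := h x hx
    exact linOne_shr hC

theorem linPart_subset {E : ℕ → VTy} {s t : Finset ℕ} (hst : s ⊆ t)
    (h : ∀ x ∈ t, ∀ Cs, E x = .hot .lin Cs → x ∈ s) : linPart E s = linPart E t :=
  Finset.sum_subset hst fun x hx hxs => by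
    rcases hE : E x with ⟨m, Cs⟩
    cases m
    · exact (hxs (h x hx Cs hE)).elim
    · exact linOne_shr hE

theorem linPart_union {E : ℕ → VTy} {s t : Finset ℕ}
    (h : ∀ x ∈ s, x ∈ t → ∃ Cs, E x = .hot .shr Cs) :
    linPart E (s ∪ t) = linPart E s + linPart E t := by
  have h0 : linPart E (s ∩ t) = 0 :=
    linPart_eq_zero fun x hx => h x (Finset.mem_inter.1 hx).1 (Finset.mem_inter.1 hx).2
  have := Finset.sum_union_inter (s₁ := s) (s₂ := t) (f := linOne E)
  rw [← linPart, ← linPart, h0, add_zero] at this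
  exact this

theorem mem_linPart {E : ℕ → VTy} {s : Finset ℕ} {p : TVar × List CTy} (h : p ∈ linPart E s) :
    ∃ x ∈ s, ∃ Cs, E x = .hot .lin Cs ∧ p = (.src x, CTy.decomps Cs) := by
  obtain ⟨x, hx, hp⟩ := Multiset.mem_sum.1 h
  refine ⟨x, hx, ?_⟩
  rcases hE : E x with ⟨m, Cs⟩
  cases m
  · rw [linOne_lin hE, Multiset.mem_singleton] at hp
    exact ⟨Cs, rfl, hp⟩
  · rw [linOne_shr hE] at hp
    simp at hp

theorem nodup_linPart (E : ℕ → VTy) (s : Finset ℕ) : ((linPart E s).map Prod.fst).Nodup := by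
  induction s using Finset.induction_on with
  | empty => simp [linPart]
  | insert x s hx ih =>
    rw [linPart, Finset.sum_insert hx, ← linPart]
    rcases hE : E x with ⟨m, Cs⟩
    cases m
    · rw [linOne_lin hE, Multiset.singleton_add, Multiset.map_cons, Multiset.nodup_cons]
      refine ⟨fun h => ?_, ih⟩
      obtain ⟨q, hq, he⟩ := Multiset.mem_map.1 h
      obtain ⟨y, hy, Ds, -, rfl⟩ := mem_linPart hq
      simp only [TVar.src.injEq] at he
      exact hx (he ▸ hy)
    · rwa [linOne_shr hE, zero_add]

theorem carried_map_fst (E : ℕ → VTy) (s : Finset ℕ) :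
    (carried E s).map Prod.fst = unpacked (context s) := by
  unfold carried unpacked
  split_ifs <;> simp

theorem unpacked_nodup (s : Finset ℕ) : (unpacked (context s)).Nodup := by
  unfold unpacked
  split_ifs
  · simp
  · exact (context_nodup s).map fun x y h => by simpa using h

theorem unpacked_zip (E : ℕ → VTy) (s : Finset ℕ) :
    (unpacked (context s)).zip ((carried E s).map Prod.snd) = carried E s := by
  rw [← carried_map_fst E s]
  exact (List.zip_of_prod rfl rfl).symm

theorem linearVars_map (E : ℕ → VTy) (xs : List ℕ) :
    (linearVars (xs.map fun x => (TVar.src x, (E x).decomp)) : LEnv TVar) =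
      (xs.map (linOne E)).sum := by
  induction xs with
  | nil => rfl
  | cons x xs ih =>
    rw [List.map_cons, List.map_cons, List.sum_cons, ← ih]
    rcases hE : E x with ⟨m, Cs⟩
    cases m
    · rw [linOne_lin hE]
      simp [linearVars, VTy.decomp]
    · rw [linOne_shr hE]
      simp [linearVars, VTy.decomp]

theorem list_sum_context (E : ℕ → VTy) (s : Finset ℕ) :
    ((context s).map (linOne E)).sum = linPart E s := by
  rw [linPart, ← List.sum_toFinset _ (context_nodup s), context, Finset.sort_toFinset]

theorem linearVars_carried (E : ℕ → VTy) (s : Finset ℕ) :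
    (linearVars (carried E s) : LEnv TVar) = linPart E s := by
  unfold carried
  split_ifs with h
  · rw [context_eq_nil] at h
    subst h
    rfl
  · rw [linearVars_map, list_sum_context]

theorem carried_ne_nil (E : ℕ → VTy) (s : Finset ℕ) : carried E s ≠ [] := by
  unfold carried
  split_ifs with h <;> simp_all

theorem dummyTy_minimal (c : Bool) : dummyTy.Minimal c :=
  .hot (by simp) (by simpa using .sess .done)

theorem carrier_minimal {c : Bool} {E : ℕ → VTy} {s : Finset ℕ} (h : ∀ x ∈ s, (E x).Std c) :
    (carrier E s).Minimal c := by
  refine .inp (by simp [carried_ne_nil]) ?_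
  intro U hU
  obtain ⟨⟨y, U'⟩, hy, rfl⟩ := List.mem_map.1 hU
  unfold carried at hy
  split_ifs at hy with hs
  · simp only [List.mem_singleton, Prod.mk.injEq] at hy
    exact hy.2 ▸ dummyTy_minimal c
  · obtain ⟨x, hx, he⟩ := List.mem_map.1 hy
    simp only [Prod.mk.injEq] at he
    exact he.2 ▸ (h x (mem_context.1 hx)).decomp

/-- The shared environment `vals` provides the shared ones of the variables in `s`, at the types
given by `E`, and leaves room for the linear ones. -/
structure ValsFor (c : Bool) (E : ℕ → VTy) (s : Finset ℕ) (vals : List (TVar × List CTy)) :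
    Prop where
  std : ∀ x ∈ s, (E x).Std c
  shr : ∀ x ∈ s, ∀ Cs, E x = .hot .shr Cs → vals.lookup (.src x) = some (CTy.decomps Cs)
  lin : ∀ x ∈ s, ∀ Cs, E x = .hot .lin Cs → vals.lookup (.src x) = none
  ty : ∀ p ∈ vals, (VTy.hot .shr p.2).Minimal c

theorem ValsFor.mono {c : Bool} {E : ℕ → VTy} {s t : Finset ℕ} {vals : List (TVar × List CTy)}
    (h : ValsFor c E t vals) (hst : s ⊆ t) : ValsFor c E s vals :=
  ⟨fun x hx => h.1 x (hst hx), fun x hx => h.2 x (hst hx), fun x hx => h.3 x (hst hx), h.4⟩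

theorem ValsFor.valOk {c : Bool} {E : ℕ → VTy} {s : Finset ℕ} {vals : List (TVar × List CTy)}
    (h : ValsFor c E s vals) : ValOk (.minimal c) vals (linPart E s) where
  nodup := nodup_linPart E s
  disj p hp := by
    obtain ⟨x, hx, Cs, hE, rfl⟩ := mem_linPart hp
    exact h.lin x hx Cs hE
  ty_val := h.ty
  ty_lin p hp := by
    obtain ⟨x, hx, Cs, hE, rfl⟩ := mem_linPart hp
    exact (hE ▸ h.std x hx).decomps_shr .lin

theorem valOk_zero {F : TypeLang} {X : Type} [DecidableEq X] {vals : List (X × List CTy)}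
    (h : ∀ p ∈ vals, F.val (.hot .shr p.2)) : ValOk F vals 0 :=
  ⟨by simp, by simp, h, by simp⟩

/-- The environment under the input of a propagator. -/
theorem valsFor_bindVals {c : Bool} {E : ℕ → VTy} {s : Finset ℕ} {Γ : SEnv TBase TVar}
    (hE : ∀ x ∈ s, (E x).Std c) (hΓ : ∀ p ∈ Γ.vals, (VTy.hot .shr p.2).Minimal c) :
    ValsFor c E s (Γ.bindVals (carried E s)).vals := by
  have hmem : ∀ x ∈ s, (TVar.src x, (E x).decomp) ∈ carried E s := by
    intro x hx
    rw [carried, if_neg (by rw [context_eq_nil]; rintro rfl; simp at hx)]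
    exact List.mem_map.2 ⟨x, mem_context.2 hx, rfl⟩
  have hnd : ((carried E s).map Prod.fst).Nodup := by
    rw [carried_map_fst]; exact unpacked_nodup s
  refine ⟨hE, ?_, ?_, ?_⟩
  · intro x hx Cs h
    have := hmem x hx
    rw [h, VTy.decomp] at this
    rw [SEnv.lookup_bindVals_of_mem _ hnd this]; rfl
  · intro x hx Cs h
    have := hmem x hx
    rw [h, VTy.decomp] at this
    rw [SEnv.lookup_bindVals_of_mem _ hnd this]; rfl
  · intro p hp
    rcases SEnv.mem_bindVals hp with h | h
    · have hc := carrier_minimal hE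
      cases hc with
      | inp _ hc => exact hc _ (List.mem_map.2 ⟨_, h, rfl⟩)
    · exact hΓ p h

/-! ### Communication along propagators -/

section
variable {c : Bool} {E : ℕ → VTy} {s : Finset ℕ} {Γ : SEnv TBase TVar}

theorem dummy_typed (hv : ∀ p ∈ Γ.vals, (VTy.hot .shr p.2).Minimal c)
    (hs : SesOk (.minimal c) Γ.chans 0) : ValTyped (.minimal c) Γ 0 0 dummy dummyTy := by
  have hv' : ValOk (.minimal c) Γ.vals 0 := valOk_zero hv
  have hs' : SesOk (.minimal c) (Γ.bindParams [(.aux 1, .sess .done)]).chans 0 :=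
    ⟨by simp, by simp, fun p hp => hs.3 p (List.mem_of_mem_filter hp), by simp,
      fun p hp => hs.5 p (List.mem_of_mem_filter hp), by simp⟩
  refine .absShr [(.aux 1, .sess .done)] (by simp) ?_ (envOk_iff.2 ⟨hv', hs⟩) (dummyTy_minimal c)
  refine Typed.cast (Δ := {(.var (.aux 1), .done)} + 0) (Typed.weaken _ (.nil ?_) ?_) rfl
    (by simp [sessionParams])
  · exact envOk_iff.2 ⟨hv', hs'⟩
  refine ⟨by simp, ?_, hs'.3, by simp, hs'.5, ?_⟩
  · simp only [add_zero, Multiset.mem_singleton, forall_eq]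
    have := List.lookup_filter_fst (fun n => decide (n ∉ [Name.var (TBase.aux 1)])) Γ.chans
      (.var (.aux 1))
    simpa [SEnv.bindParams, sharedParams] using this
  · simp only [add_zero, Multiset.mem_singleton, forall_eq]
    exact STy.Minimal.done

theorem vars_typed (hv : ValsFor c E s Γ.vals) (hs : SesOk (.minimal c) Γ.chans 0)
    (xs : List ℕ) (hxs : ∀ x ∈ xs, x ∈ s) :
    ValsTyped (.minimal c) Γ (xs.map (linOne E)).sum 0 (xs.map fun x => .var (.src x))
      (xs.map fun x => (E x).decomp) := by
  induction xs with
  | nil => exact .nil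
  | cons x xs ih =>
    rw [List.forall_mem_cons] at hxs
    rw [List.map_cons, List.map_cons, List.map_cons, List.sum_cons, ← zero_add (0 : DEnv TBase)]
    refine .cons ?_ (ih hxs.2)
    have h1 := (hv.mono (Finset.singleton_subset_iff.2 hxs.1)).valOk
    rw [linPart, Finset.sum_singleton] at h1
    rcases hE : E x with ⟨m, Cs⟩
    cases m
    · rw [linOne_lin hE] at h1 ⊢
      exact .linVar _ _ (envOk_iff.2 ⟨h1, hs⟩)
    · rw [linOne_shr hE] at h1 ⊢
      exact .shVar _ _ (hv.shr x hxs.1 Cs hE) (envOk_iff.2 ⟨h1, hs⟩)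

theorem packed_typed (hv : ValsFor c E s Γ.vals) (hs : SesOk (.minimal c) Γ.chans 0) :
    ValsTyped (.minimal c) Γ (linPart E s) 0 (packed (context s))
      ((carried E s).map Prod.snd) := by
  unfold packed carried
  split_ifs with h
  · rw [context_eq_nil] at h
    subst h
    exact valsTyped_singleton.2 (dummy_typed hv.ty hs)
  · rw [← list_sum_context, List.map_map]
    exact vars_typed hv hs _ fun x hx => mem_context.1 hx

/-- Sending a context along a propagator. -/
theorem Typed.send_context {k : ℕ} {Λ : LEnv TVar} {Δ Δ' : DEnv TBase} {Q : Proc TBase TVar}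
    (hv : ValsFor c E s Γ.vals) (hQ : Typed (.minimal c) Γ Λ Δ Q)
    (hΔ : Δ' = {(propOut k, (carrier E s).dual)} + Δ)
    (hΛ : ValOk (.minimal c) Γ.vals (linPart E s + Λ))
    (hs : SesOk (.minimal c) Γ.chans Δ') :
    Typed (.minimal c) Γ (linPart E s + Λ) Δ' (.out (propOut k) (packed (context s)) Q) := by
  subst hΔ
  refine Typed.send_one (Δ₁ := Δ) (Δ₂ := 0) _ (hQ.weaken _ (hs.retype .done))
    (packed_typed hv (hs.mono (Multiset.zero_le _))) (by simp [carrier, STy.dual]) hΛ hs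

theorem Typed.send_context_nil {k : ℕ} (hv : ValsFor c E s Γ.vals)
    (hs : SesOk (.minimal c) Γ.chans {(propOut k, (carrier E s).dual)}) :
    Typed (.minimal c) Γ (linPart E s) {(propOut k, (carrier E s).dual)}
      (.out (propOut k) (packed (context s)) .nil) := by
  have := Typed.send_context (k := k) hv
    (.nil (envOk_iff.2 ⟨valOk_zero hv.ty, hs.mono (Multiset.zero_le _)⟩))
    (add_zero _).symm (by simpa using hv.valOk) hs
  simpa using this

/-- Receiving a context along a propagator. -/
theorem Typed.rcv_context {k : ℕ} {Δ Δ' : DEnv TBase} {Q : Proc TBase TVar}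
    (hE : ∀ x ∈ s, (E x).Std c) (hv : ∀ p ∈ Γ.vals, (VTy.hot .shr p.2).Minimal c)
    (hQ : Typed (.minimal c) (Γ.bindVals (carried E s)) (linPart E s) Δ Q)
    (hΔ : Δ' = {(propIn k, carrier E s)} + Δ)
    (hs : SesOk (.minimal c) Γ.chans Δ') :
    Typed (.minimal c) Γ 0 Δ' (.inp (propIn k) (unpacked (context s)) Q) := by
  subst hΔ
  have hl : (unpacked (context s)).length = ((carried E s).map Prod.snd).length := by
    rw [← carried_map_fst E s]; simp
  refine Typed.rcv_one _ (unpacked_nodup s) hl ?_ rfl (valOk_zero hv) (carrier_minimal hE)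
  rw [unpacked_zip, linearVars_carried, add_zero]
  exact hQ.weaken _ (hs.retype .done)

end

theorem STy.Std.out_inv {c : Bool} {Us : List VTy} {S : STy} (h : (STy.out Us S).Std c) :
    ∃ U, Us = [U] ∧ U.Std c ∧ S.Std c := by
  cases h with
  | out hU hS => exact ⟨_, rfl, hU, hS⟩

theorem STy.Std.inp_inv {c : Bool} {Us : List VTy} {S : STy} (h : (STy.inp Us S).Std c) :
    ∃ U, Us = [U] ∧ U.Std c ∧ S.Std c := by
  cases h with
  | inp hU hS => exact ⟨_, rfl, hU, hS⟩

theorem VTy.Std.hot_inv {c : Bool} {m : Arrow} {Cs : List CTy} (h : (VTy.hot m Cs).Std c) :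
    ∃ C, Cs = [C] ∧ C.Std c := by
  cases h with
  | hot hC => exact ⟨_, rfl, hC⟩

/-! ### Free value variables of typed processes -/

theorem ne_of_valOk_bindVals {B X : Type} [DecidableEq B] [DecidableEq X] {F : TypeLang}
    {Γ : SEnv B X} {Λ : LEnv X} {y : X} {U : VTy}
    (h : ValOk F (Γ.bindVals [(y, U)]).vals (linearVars [(y, U)] + Λ)) : ∀ p ∈ Λ, p.1 ≠ y := by
  rintro p hp rfl
  rcases U with ⟨m, Cs⟩
  cases m
  · have := h.nodup
    rw [Multiset.map_add] at this
    have := (Multiset.nodup_cons.1 (show (p.1 ::ₘ Λ.map Prod.fst).Nodup by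
      simpa [linearVars] using this)).1
    exact this (Multiset.mem_map.2 ⟨p, hp, rfl⟩)
  · have h1 := h.disj p (Multiset.mem_add.2 (.inr hp))
    rw [SEnv.lookup_bindVals_of_mem (m := .shr) (Cs := Cs) _ (by simp) (by simp)] at h1
    simp at h1

section
variable {B X : Type} [DecidableEq B] [DecidableEq X]

/-- All linear variables occur in `s`, and the variables in `s` are declared. -/
def VarsOk (Γ : SEnv B X) (Λ : LEnv X) (s : Finset X) : Prop :=
  (∀ p ∈ Λ, p.1 ∈ s) ∧
    ∀ x ∈ s, (∃ Cs, (x, Cs) ∈ Λ) ∨ ∃ Cs, Γ.vals.lookup x = some Cs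

omit [DecidableEq B] in
theorem VarsOk.add {Γ : SEnv B X} {Λ Λ' : LEnv X} {s s' : Finset X} (h : VarsOk Γ Λ s)
    (h' : VarsOk Γ Λ' s') : VarsOk Γ (Λ + Λ') (s ∪ s') := by
  refine ⟨fun p hp => ?_, fun x hx => ?_⟩
  · rcases Multiset.mem_add.1 hp with hp | hp
    · exact Finset.mem_union_left _ (h.1 p hp)
    · exact Finset.mem_union_right _ (h'.1 p hp)
  · rcases Finset.mem_union.1 hx with hx | hx
    · exact (h.2 x hx).imp_left fun ⟨Cs, hC⟩ => ⟨Cs, Multiset.mem_add.2 (.inl hC)⟩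
    · exact (h'.2 x hx).imp_left fun ⟨Cs, hC⟩ => ⟨Cs, Multiset.mem_add.2 (.inr hC)⟩

theorem VarsOk.of_bindVals {F : TypeLang} {Γ : SEnv B X} {Λ : LEnv X} {s : Finset X} {y : X}
    {U : VTy} (h : VarsOk (Γ.bindVals [(y, U)]) (linearVars [(y, U)] + Λ) s)
    (hv : ValOk F (Γ.bindVals [(y, U)]).vals (linearVars [(y, U)] + Λ)) :
    VarsOk Γ Λ (s \ [y].toFinset) := by
  refine ⟨fun p hp => ?_, fun x hx => ?_⟩
  · have h1 := h.1 p (Multiset.mem_add.2 (.inr hp))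
    simpa [h1] using ne_of_valOk_bindVals hv p hp
  · simp only [List.toFinset_cons, List.toFinset_nil, insert_empty_eq, Finset.mem_sdiff,
      Finset.mem_singleton] at hx
    rcases h.2 x hx.1 with ⟨Cs, hC⟩ | ⟨Cs, hC⟩
    · rcases Multiset.mem_add.1 hC with hC | hC
      · rcases U with ⟨m, Ds⟩
        cases m <;> simp [linearVars] at hC
        exact (hx.2 hC.1).elim
      · exact .inl ⟨Cs, hC⟩
    · rw [SEnv.lookup_bindVals_of_notMem _ (by simpa using hx.2)] at hC
      exact .inr ⟨Cs, hC⟩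

theorem Typed.varsOk {c : Bool} {Γ : SEnv B X} {Λ : LEnv X} {Δ : DEnv B} {P : Proc B X}
    (h : Typed (.std c) Γ Λ Δ P) : VarsOk Γ Λ P.fv := by
  refine Typed.rec (F := .std c)
    (motive_1 := fun Γ Λ _ P _ => VarsOk Γ Λ P.fv)
    (motive_2 := fun Γ Λ _ V _ _ => VarsOk Γ Λ V.fv)
    (motive_3 := fun Γ Λ _ Vs _ _ => VarsOk Γ Λ (Val.fvs Vs))
    ?_ ?_ ?_ ?_ ?_ ?_ ?_ ?_ ?_ ?_ ?_ ?_ ?_ ?_ ?_ ?_ ?_ ?_ ?_ h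
  case refine_1 => intro Γ _; simp [VarsOk, Proc.fv]
  case refine_2 => intro Γ Λ Δ P u _ _ ih; exact ih
  case refine_3 =>
    intro Γ Λ Δ P x Cs hx _ _ ih
    refine ⟨fun p hp => ih.1 p (Multiset.mem_cons_of_mem hp), fun y hy => ?_⟩
    rcases ih.2 y hy with ⟨Ds, hD⟩ | ⟨Ds, hD⟩
    · rcases Multiset.mem_cons.1 hD with h | h
      · simp only [Prod.mk.injEq] at h
        exact .inr ⟨Cs, h.1 ▸ hx⟩
      · exact .inl ⟨Ds, h⟩
    · rw [SEnv.lookup_eraseVals] at hD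
      split_ifs at hD
      exact .inr ⟨Ds, hD⟩
  case refine_4 => intro Γ Λ Δ₁ Δ₂ V us m Cs _ _ _ ih; exact ih
  case refine_5 =>
    intro Γ Λ₁ Λ₂ Δ₁ Δ₂ Δ u P Vs Us S _ _ _ _ ih ih'
    rw [Proc.fv, Finset.union_comm]
    exact ih.add ih'
  case refine_6 =>
    intro Γ Λ Δ u xs P Us S _ hl hP hok ih
    obtain ⟨U, rfl, -, -⟩ := STy.Std.inp_inv (hok.ty_ses _ (Multiset.mem_cons_self _ _))
    obtain ⟨y, rfl⟩ := List.length_eq_one_iff.1 hl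
    exact ih.of_bindVals hP.envOk.valOk
  case refine_7 =>
    intro Γ Λ Δ₁ Δ₂ u P V U _ _ _ _ ih ih'
    have := ih.add ih'
    rw [add_zero] at this
    simpa [Proc.fv, Val.fvs, Finset.union_comm] using this
  case refine_8 =>
    intro Γ Λ Δ u x P U _ hP _ ih
    exact ih.of_bindVals hP.envOk.valOk
  case refine_9 => intro Γ Λ Δ u P L S l _ _ ih; exact ih
  case refine_10 =>
    intro Γ Λ Δ u L P S _ hok ih
    have hL : L.Nonempty := by
      have := hok.ty_ses _ (Multiset.mem_cons_self _ _)
      cases this with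
      | bra hL _ => exact hL
    obtain ⟨l, hl⟩ := hL
    simp only [Proc.fv]
    refine ⟨fun p hp => ?_, fun x hx => ?_⟩
    · exact Finset.mem_biUnion.2 ⟨⟨l, hl⟩, Finset.mem_univ _, (ih ⟨l, hl⟩).1 p hp⟩
    · obtain ⟨l, -, hl⟩ := Finset.mem_biUnion.1 hx
      exact (ih l).2 x hl
  case refine_11 => intro Γ Λ₁ Λ₂ Δ₁ Δ₂ P Q _ _ _ ih ih'; exact ih.add ih'
  case refine_12 => intro Γ Λ Δ P s ann S _ _ _ ih; exact ih
  case refine_13 => intro Γ Λ Δ P a U _ _ ih; exact ih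
  case refine_14 =>
    intro Γ x Cs hx _
    simp [VarsOk, Val.fv, hx]
  case refine_15 => intro Γ x Cs _; simp [VarsOk, Val.fv]
  case refine_16 => intro Γ Λ Δ P ps _ _ _ _ ih; exact ih
  case refine_17 => intro Γ P ps _ _ _ _ ih; exact ih
  case refine_18 => intro Γ; simp [VarsOk, Val.fvs]
  case refine_19 => intro Γ Λ₁ Λ₂ Δ₁ Δ₂ V Vs U Us _ _ ih ih'; exact ih.add ih'

theorem ValTyped.varsOk {c : Bool} {Γ : SEnv B X} {Λ : LEnv X} {Δ : DEnv B} {V : Val B X} {U : VTy}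
    (h : ValTyped (.std c) Γ Λ Δ V U) : VarsOk Γ Λ V.fv := by
  cases h with
  | shVar x Cs hx _ => simp [VarsOk, Val.fv, hx]
  | linVar x Cs _ => simp [VarsOk, Val.fv]
  | absLin ps _ h _ _ => exact h.varsOk
  | absShr ps _ h _ _ => exact h.varsOk

end

/-! ### The bookkeeping of the breakdown -/

theorem lookup_eq_none_of_forall_ne {α β : Type} [DecidableEq α] {l : List (α × β)} {k : α}
    (h : ∀ p ∈ l, p.1 ≠ k) : l.lookup k = none := by
  rw [List.lookup_eq_none_iff]
  intro p hp
  simpa using (h p hp).symm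

/-- The maps `τ`, `ρ` and `E` that accompany the breakdown agree with the environments `Γ`, `Λ`,
`Δ` of the source, and with the shared names `C` of the target. A linear variable may be
transmitted at a shared type, because it may stem from the promotion of a shared one, which has to
be postponed until its value is used. The names in `D` are no longer used. -/
structure Tracks (c : Bool) (τ : Name ℕ → CTy) (ρ : NameMap) (E : ℕ → VTy) (D : Finset (Name ℕ))
    (Γ : SEnv ℕ ℕ) (Λ : LEnv ℕ) (Δ : DEnv ℕ) (C : List (Name TBase × VTy)) : Prop where
  ses_ty : ∀ p ∈ Δ, τ p.1 = .sess p.2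
  chan_ty : ∀ u U, Γ.chans.lookup u = some U → τ u = .chan U
  owner : ∀ p ∈ Δ, (ρ p.1).owner = some p.1
  chan_name : ∀ u U, Γ.chans.lookup u = some U → ρ u = u.init
  chan_lookup : ∀ u U, Γ.chans.lookup u = some U → C.lookup u.init = some U.decomp
  lin_mode : ∀ p ∈ Λ, ∃ m, E p.1 = .hot m p.2
  shr_mode : ∀ x Cs, Γ.vals.lookup x = some Cs → E x = .hot .shr Cs
  kind_chan : ∀ p ∈ C, ∀ s bar, p.1 ≠ .sess s bar
  ty_chan : ∀ p ∈ C, p.2.Minimal c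
  disj : ∀ q ∈ decompEnv ρ D Δ, C.lookup q.1 = none

section
variable {c : Bool} {τ : Name ℕ → CTy} {ρ : NameMap} {E : ℕ → VTy} {D : Finset (Name ℕ)}
  {Γ : SEnv ℕ ℕ} {Λ : LEnv ℕ} {Δ : DEnv ℕ} {C : List (Name TBase × VTy)}

theorem decompEnv_mono {Δ' : DEnv ℕ} (h : Δ' ≤ Δ) : decompEnv ρ D Δ' ≤ decompEnv ρ D Δ := by
  obtain ⟨Δ'', rfl⟩ := Multiset.le_iff_exists_add.1 h
  rw [decompEnv_add]
  exact Multiset.le_add_right _ _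

theorem Tracks.mono (h : Tracks c τ ρ E D Γ Λ Δ C) {Λ' : LEnv ℕ} {Δ' : DEnv ℕ} (hΛ : Λ' ≤ Λ)
    (hΔ : Δ' ≤ Δ) : Tracks c τ ρ E D Γ Λ' Δ' C where
  ses_ty p hp := h.ses_ty p (Multiset.mem_of_le hΔ hp)
  chan_ty := h.chan_ty
  owner p hp := h.owner p (Multiset.mem_of_le hΔ hp)
  chan_name := h.chan_name
  chan_lookup := h.chan_lookup
  lin_mode p hp := h.lin_mode p (Multiset.mem_of_le hΛ hp)
  shr_mode := h.shr_mode
  kind_chan := h.kind_chan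
  ty_chan := h.ty_chan
  disj q hq := h.disj q (Multiset.mem_of_le (decompEnv_mono hΔ) hq)

/-- The linear environment of the decomposition is well formed. -/
theorem Tracks.sesOk (h : Tracks c τ ρ E D Γ Λ Δ C) (hok : EnvOk (.std c) Γ Λ Δ) {k : ℕ}
    {Ms : List STy} (hMs : ∀ M ∈ Ms, M.Minimal c) :
    SesOk (.minimal c) C (decompEnv ρ D Δ + propEnv k Ms) := by
  refine .add ⟨nodup_decompEnv hok.nodup_ses fun p hp _ => h.owner p hp, h.disj, h.kind_chan, ?_,
    h.ty_chan, ?_⟩ ⟨propEnv_names_nodup _ _, ?_, h.kind_chan, ?_, h.ty_chan, ?_⟩ ?_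
  · intro q hq
    obtain ⟨p, hp, -, hq⟩ := mem_decompEnv.1 hq
    exact Name.ne_shared_of_owner ((owner_of_mem_entry hq).trans (h.owner p hp))
      (hok.kind_ses p hp)
  · intro q hq
    obtain ⟨p, hp, -, hq⟩ := mem_decompEnv.1 hq
    exact (show p.2.Std c from hok.ty_ses p hp).decomp _ (mem_entry hq).2
  · intro q hq
    obtain ⟨⟨j, bar, -, he⟩, -⟩ := mem_propEnv hq
    exact lookup_eq_none_of_forall_ne fun p hp => he ▸ h.kind_chan p hp _ _
  · intro q hq a
    obtain ⟨⟨j, bar, -, he⟩, -⟩ := mem_propEnv hq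
    simp [he]
  · intro q hq
    obtain ⟨-, M, hM, he | he⟩ := mem_propEnv hq
    · exact he ▸ hMs M hM
    · exact he ▸ (hMs M hM).dual
  · intro q hq q' hq' he
    obtain ⟨p, hp, -, hq⟩ := mem_decompEnv.1 hq
    obtain ⟨⟨j, bar, -, he'⟩, -⟩ := mem_propEnv hq'
    have := (owner_of_mem_entry hq).trans (h.owner p hp)
    rw [he, he'] at this
    cases bar <;> simp [Name.owner] at this

theorem Tracks.std (h : Tracks c τ ρ E D Γ Λ Δ C) (hok : EnvOk (.std c) Γ Λ Δ) {s : Finset ℕ}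
    (hs : VarsOk Γ Λ s) : ∀ x ∈ s, (E x).Std c := by
  intro x hx
  rcases hs.2 x hx with ⟨Cs, hC⟩ | ⟨Cs, hC⟩
  · obtain ⟨m, hm⟩ := h.lin_mode _ hC
    obtain ⟨C', hC', hstd⟩ := VTy.Std.hot_inv (hok.ty_lin _ hC)
    simp only at hm hC'
    rw [hm, hC']
    exact .hot hstd
  · rw [h.shr_mode x Cs hC]
    exact hok.ty_val _ (List.mem_of_lookup_eq_some hC)

/-- A variable that is transmitted at a linear type is linear in the source. -/
theorem Tracks.mem_of_lin (h : Tracks c τ ρ E D Γ Λ Δ C) {s : Finset ℕ}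
    (hs : VarsOk Γ Λ s) {x : ℕ} (hx : x ∈ s) {Cs : List CTy} (hE : E x = .hot .lin Cs) :
    ∃ Ds, (x, Ds) ∈ Λ := by
  rcases hs.2 x hx with hC | ⟨Ds, hD⟩
  · exact hC
  · simp [h.shr_mode x Ds hD] at hE

/-- A linear variable does not occur in another part of the process. -/
theorem VarsOk.notMem {Λ' : LEnv ℕ} {s' : Finset ℕ} (hs' : VarsOk Γ Λ' s')
    (hok : ValOk (.std c) Γ.vals (Λ + Λ')) {x : ℕ} {Cs : List CTy} (hx : (x, Cs) ∈ Λ) :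
    x ∉ s' := by
  intro hx'
  rcases hs'.2 x hx' with ⟨Ds, hD⟩ | ⟨Ds, hD⟩
  · have := hok.nodup
    rw [Multiset.map_add, Multiset.nodup_add] at this
    exact Multiset.disjoint_left.1 this.2.2 (Multiset.mem_map.2 ⟨_, hx, rfl⟩)
      (Multiset.mem_map.2 ⟨_, hD, rfl⟩)
  · have := hok.disj _ (Multiset.mem_add.2 (.inl hx))
    simp_all

/-- The linear variables of two parallel parts are disjoint. -/
theorem Tracks.linPart_union {Λ' : LEnv ℕ} (h : Tracks c τ ρ E D Γ (Λ + Λ') Δ C)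
    (hok : ValOk (.std c) Γ.vals (Λ + Λ')) {s s' : Finset ℕ}
    (hs : VarsOk Γ Λ s) (hs' : VarsOk Γ Λ' s') :
    linPart E (s ∪ s') = linPart E s + linPart E s' := by
  refine _root_.linPart_union fun x hx hx' => ?_
  rcases hE : E x with ⟨m, Cs⟩
  cases m
  · obtain ⟨Ds, hD⟩ := (h.mono (Multiset.le_add_right Λ Λ') le_rfl).mem_of_lin hs hx hE
    exact (hs'.notMem hok hD hx').elim
  · exact ⟨Cs, rfl⟩

theorem Tracks.eraseVals (h : Tracks c τ ρ E D Γ Λ Δ C) {x : ℕ} {Cs : List CTy}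
    (hx : Γ.vals.lookup x = some Cs) :
    Tracks c τ ρ E D (Γ.eraseVals [x]) ((x, Cs) ::ₘ Λ) Δ C where
  ses_ty := h.ses_ty
  chan_ty := h.chan_ty
  owner := h.owner
  chan_name := h.chan_name
  chan_lookup := h.chan_lookup
  lin_mode := Multiset.forall_mem_cons.2 ⟨⟨_, h.shr_mode x Cs hx⟩, h.lin_mode⟩
  shr_mode y Ds hy := by
    rw [SEnv.lookup_eraseVals] at hy
    split_ifs at hy
    exact h.shr_mode y Ds hy
  kind_chan := h.kind_chan
  ty_chan := h.ty_chan
  disj := h.disj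

theorem Tracks.bindVals (h : Tracks c τ ρ E D Γ Λ Δ C) {y : ℕ} {U : VTy}
    (hy : ∀ p ∈ Λ, p.1 ≠ y) :
    Tracks c τ ρ (Function.update E y U) D (Γ.bindVals [(y, U)]) (linearVars [(y, U)] + Λ) Δ C where
  ses_ty := h.ses_ty
  chan_ty := h.chan_ty
  owner := h.owner
  chan_name := h.chan_name
  chan_lookup := h.chan_lookup
  lin_mode p hp := by
    rcases Multiset.mem_add.1 hp with hp | hp
    · rcases U with ⟨m, Cs⟩
      cases m <;> simp [linearVars] at hp
      subst hp
      exact ⟨.lin, by simp⟩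
    · rw [Function.update_of_ne (hy p hp)]
      exact h.lin_mode p hp
  shr_mode x Ds hx := by
    by_cases hxy : x = y
    · subst hxy
      rcases U with ⟨m, Cs⟩
      rw [SEnv.lookup_bindVals_of_mem (m := m) (Cs := Cs) _ (by simp) (by simp)] at hx
      cases m <;> simp at hx
      simp [hx]
    · rw [SEnv.lookup_bindVals_of_notMem _ (by simpa using hxy)] at hx
      rw [Function.update_of_ne hxy]
      exact h.shr_mode x Ds hx
  kind_chan := h.kind_chan
  ty_chan := h.ty_chan
  disj := h.disj

theorem decompEnv_update {D' : Finset (Name ℕ)} {u : Name ℕ} (n : Name TBase)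
    (hu : ∀ p ∈ Δ, p.1 ≠ u) (hD : ∀ v ≠ u, v ∈ D' ↔ v ∈ D) :
    decompEnv (Function.update ρ u n) D' Δ = decompEnv ρ D Δ :=
  decompEnv_congr (fun p hp => Function.update_of_ne (hu p hp) _ _) fun p hp => hD _ (hu p hp)

/-- A name `u` gets the session type `T` and the indexed name `n`. -/
theorem Tracks.bindSes (h : Tracks c τ ρ E D Γ Λ Δ C) {u : Name ℕ} {n : Name TBase} {T : STy}
    {D' : Finset (Name ℕ)} {Γ' : SEnv ℕ ℕ} {C' : List (Name TBase × VTy)}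
    (hu : ∀ p ∈ Δ, p.1 ≠ u)
    (hΓ : ∀ v U, Γ'.chans.lookup v = some U → v ≠ u ∧ Γ.chans.lookup v = some U)
    (hvals : Γ'.vals = Γ.vals) (hn : n.owner = some u) (hD : ∀ v ≠ u, v ∈ D' ↔ v ∈ D)
    (hmem : ∀ p ∈ C', p ∈ C)
    (hC : ∀ v ≠ u, ∀ U, C.lookup v.init = some U → C'.lookup v.init = some U)
    (hCn : u ∉ D' → ∀ q ∈ entry n T, C'.lookup q.1 = none) :
    Tracks c (Function.update τ u (.sess T)) (Function.update ρ u n) E D' Γ' Λ ({(u, T)} + Δ) C'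
    where
  ses_ty p hp := by
    rcases Multiset.mem_add.1 hp with hp | hp
    · rw [Multiset.mem_singleton.1 hp, Function.update_self]
    · rw [Function.update_of_ne (hu p hp)]
      exact h.ses_ty p hp
  chan_ty v U hv := by
    rw [Function.update_of_ne (hΓ v U hv).1]
    exact h.chan_ty v U (hΓ v U hv).2
  owner p hp := by
    rcases Multiset.mem_add.1 hp with hp | hp
    · rw [Multiset.mem_singleton.1 hp, Function.update_self, hn]
    · rw [Function.update_of_ne (hu p hp)]
      exact h.owner p hp
  chan_name v U hv := by
    rw [Function.update_of_ne (hΓ v U hv).1]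
    exact h.chan_name v U (hΓ v U hv).2
  chan_lookup v U hv := hC v (hΓ v U hv).1 _ (h.chan_lookup v U (hΓ v U hv).2)
  lin_mode := h.lin_mode
  shr_mode := hvals ▸ h.shr_mode
  kind_chan p hp := h.kind_chan p (hmem p hp)
  ty_chan p hp := h.ty_chan p (hmem p hp)
  disj q hq := by
    rw [decompEnv_add, decompEnv_update n hu hD] at hq
    rcases Multiset.mem_add.1 hq with hq | hq
    · obtain ⟨p, hp, hp', hq⟩ := mem_decompEnv.1 hq
      rw [Multiset.mem_singleton] at hp
      subst hp
      rw [Function.update_self] at hq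
      exact hCn hp' q hq
    · have := h.disj q hq
      rw [List.lookup_eq_none_iff] at this ⊢
      exact fun p hp => this p (hmem p hp)

/-- A name `u` gets the shared type `⟨U⟩`. -/
theorem Tracks.bindChan (h : Tracks c τ ρ E D Γ Λ Δ C) {u : Name ℕ} {U : VTy}
    {D' : Finset (Name ℕ)} {Γ' : SEnv ℕ ℕ} {C' : List (Name TBase × VTy)}
    (hu : ∀ p ∈ Δ, p.1 ≠ u) (hus : ∀ s bar, u.init ≠ .sess s bar) (hU : U.Std c)
    (hΓ : ∀ v W, Γ'.chans.lookup v = some W →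
      (v = u ∧ W = U) ∨ (v ≠ u ∧ Γ.chans.lookup v = some W))
    (hvals : Γ'.vals = Γ.vals) (hD : ∀ v ≠ u, v ∈ D' ↔ v ∈ D)
    (hmem : ∀ p ∈ C', p = (u.init, U.decomp) ∨ p ∈ C)
    (hC : ∀ v ≠ u, ∀ W, C.lookup v.init = some W → C'.lookup v.init = some W)
    (hCu : C'.lookup u.init = some U.decomp) :
    Tracks c (Function.update τ u (.chan U)) (Function.update ρ u u.init) E D' Γ' Λ Δ C'
    where
  ses_ty p hp := by
    rw [Function.update_of_ne (hu p hp)]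
    exact h.ses_ty p hp
  chan_ty v W hv := by
    rcases hΓ v W hv with ⟨rfl, rfl⟩ | ⟨hv, hv'⟩
    · rw [Function.update_self]
    · rw [Function.update_of_ne hv]
      exact h.chan_ty v W hv'
  owner p hp := by
    rw [Function.update_of_ne (hu p hp)]
    exact h.owner p hp
  chan_name v W hv := by
    rcases hΓ v W hv with ⟨rfl, rfl⟩ | ⟨hv, hv'⟩
    · rw [Function.update_self]
    · rw [Function.update_of_ne hv]
      exact h.chan_name v W hv'
  chan_lookup v W hv := by
    rcases hΓ v W hv with ⟨rfl, rfl⟩ | ⟨hv, hv'⟩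
    · exact hCu
    · exact hC v hv _ (h.chan_lookup v W hv')
  lin_mode := h.lin_mode
  shr_mode := hvals ▸ h.shr_mode
  kind_chan p hp := by
    rcases hmem p hp with rfl | hp
    · exact hus
    · exact h.kind_chan p hp
  ty_chan p hp := by
    rcases hmem p hp with rfl | hp
    · exact hU.decomp
    · exact h.ty_chan p hp
  disj q hq := by
    rw [decompEnv_update _ hu hD] at hq
    have := h.disj q hq
    rw [List.lookup_eq_none_iff] at this ⊢
    intro p hp
    rcases hmem p hp with rfl | hp
    · obtain ⟨p, hp, -, hq⟩ := mem_decompEnv.1 hq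
      have ho := (owner_of_mem_entry hq).trans (h.owner p hp)
      simp only [bne_iff_ne, ne_eq]
      intro he
      rw [he, Name.owner_init, Option.some.injEq] at ho
      exact hu p hp ho.symm
    · exact this p hp

theorem ne_of_envOk {F : TypeLang} {B X : Type} [DecidableEq B] [DecidableEq X] {Γ : SEnv B X}
    {Λ : LEnv X} {Δ : DEnv B} {u : Name B} {S : STy}
    (hok : EnvOk F Γ Λ ({(u, S)} + Δ)) : ∀ p ∈ Δ, p.1 ≠ u := by
  rintro p hp rfl
  have := hok.nodup_ses
  rw [Multiset.singleton_add, Multiset.map_cons, Multiset.nodup_cons] at this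
  exact this.1 (Multiset.mem_map.2 ⟨p, hp, rfl⟩)

theorem ne_of_lookup_chans {F : TypeLang} {B X : Type} [DecidableEq B] [DecidableEq X]
    {Γ : SEnv B X} {Λ : LEnv X} {Δ : DEnv B} {u v : Name B} {S : STy} {U : VTy}
    (hok : EnvOk F Γ Λ ({(u, S)} + Δ)) (hv : Γ.chans.lookup v = some U) : v ≠ u := by
  rintro rfl
  have := hok.disj_ses (v, S) (by simp)
  simp_all

/-- A communication on the session `u`. If it was the last one, then `u` joins the names that are no
longer used. -/
theorem Tracks.comm {u : Name ℕ} {S T M : STy}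
    (h : Tracks c τ ρ E D Γ Λ ({(u, T)} + Δ) C) (hok : EnvOk (.std c) Γ Λ ({(u, T)} + Δ))
    (hu : u ∉ D) (htail : (CTy.sess T).tail = .sess S)
    (hT : (S = .done ∧ T.decomp = [M]) ∨ (S ≠ .done ∧ T.decomp = M :: S.decomp)) :
    ∃ D', (∀ v ∈ D', v ∈ D ∨ (v = u ∧ (τ u).tail = .sess .done)) ∧
      Tracks c (Function.update τ u (τ u).tail) (incrName τ ρ u) E D' Γ Λ ({(u, S)} + Δ) C ∧
      decompEnv ρ D ({(u, T)} + Δ) =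
        {(ρ u, M)} + decompEnv (incrName τ ρ u) D' ({(u, S)} + Δ) := by
  have hτ : τ u = .sess T := h.ses_ty (u, T) (by simp)
  have hne := ne_of_envOk hok
  have hn : ((ρ u).shift 1).owner = some u := by
    rw [Name.owner_shift]; exact h.owner (u, T) (by simp)
  rw [hτ, htail, show incrName τ ρ u = Function.update ρ u ((ρ u).shift 1) by simp [incrName, hτ]]
  have h' := h.mono le_rfl (Multiset.le_add_left Δ {(u, T)})
  have key : ∀ D' : Finset (Name ℕ), (∀ v ≠ u, v ∈ D' ↔ v ∈ D) →
      (u ∉ D' → ∀ q ∈ entry ((ρ u).shift 1) S, C.lookup q.1 = none) →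
      Tracks c (Function.update τ u (.sess S)) (Function.update ρ u ((ρ u).shift 1)) E D' Γ Λ
        ({(u, S)} + Δ) C := fun D' hD' hC =>
    h'.bindSes hne (fun v U hv => ⟨ne_of_lookup_chans hok hv, hv⟩) rfl hn hD' (fun _ h => h)
      (fun _ _ _ h => h) hC
  rcases hT with ⟨rfl, hT⟩ | ⟨hS, hT⟩
  -- `𝒢(T)` has a single component, so there is no name left for the remaining `end`
  · have hD' : ∀ v ≠ u, v ∈ insert u D ↔ v ∈ D := fun v hv => by simp [hv]
    refine ⟨insert u D, ?_, key _ hD' (by simp), ?_⟩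
    · intro v hv
      rcases Finset.mem_insert.1 hv with rfl | hv
      · exact .inr ⟨rfl, rfl⟩
      · exact .inl hv
    · rw [decompEnv_add, decompEnv_add, decompEnv_update _ hne hD',
        decompEnv_of_mem _ (Finset.mem_insert_self u D), decompEnv_of_notMem _ hu,
        entry_of_decomp hT, zero_add, Multiset.coe_singleton]
  · refine ⟨D, fun v hv => .inl hv, key D (fun _ _ => .rfl) fun _ q hq => ?_, ?_⟩
    · refine h.disj q (mem_decompEnv.2 ⟨(u, T), by simp, hu, ?_⟩)
      rw [entry_of_decomp_cons hT]
      exact List.mem_cons_of_mem _ hq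
    · rw [decompEnv_add, decompEnv_add, decompEnv_update _ hne fun _ _ => .rfl,
        decompEnv_of_notMem _ hu, decompEnv_of_notMem _ hu, entry_of_decomp_cons hT,
        Function.update_self, ← Multiset.cons_coe, ← Multiset.singleton_add, add_assoc]

theorem Tracks.lookup_sess (h : Tracks c τ ρ E D Γ Λ Δ C) (b : TBase) (bar : Bool) :
    C.lookup (.sess b bar) = none :=
  lookup_eq_none_of_forall_ne fun p hp => h.kind_chan p hp b bar

theorem Tracks.lookup_entry_sess (h : Tracks c τ ρ E D Γ Λ Δ C) {b : TBase} {bar : Bool} {T : STy}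
    {q : Name TBase × STy} (hq : q ∈ entry (.sess b bar) T) : C.lookup q.1 = none := by
  rw [entry_sess] at hq
  obtain ⟨p, -, rfl⟩ := List.mem_map.1 hq
  exact h.lookup_sess _ _

/-- The session `u` continues on a fresh session after a selection. -/
theorem Tracks.sel {u : Name ℕ} {T T' : STy} (h : Tracks c τ ρ E D Γ Λ ({(u, T)} + Δ) C)
    (hok : EnvOk (.std c) Γ Λ ({(u, T)} + Δ)) (hu : u ∉ D) (i : ℕ) :
    Tracks c (Function.update τ u (.sess T')) (Function.update ρ u (.sess (.sel u i) false)) E D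
        Γ Λ ({(u, T')} + Δ) C ∧
      decompEnv (Function.update ρ u (.sess (.sel u i) false)) D ({(u, T')} + Δ) =
        entry (.sess (.sel u i) false) T' + decompEnv ρ D Δ := by
  have hne := ne_of_envOk hok
  refine ⟨(h.mono le_rfl (Multiset.le_add_left Δ {(u, T)})).bindSes hne
    (fun v U hv => ⟨ne_of_lookup_chans hok hv, hv⟩) rfl rfl (fun _ _ => .rfl) (fun _ h => h)
      (fun _ _ _ h => h) fun _ q hq => h.lookup_entry_sess hq, ?_⟩
  rw [decompEnv_add, decompEnv_update _ hne fun _ _ => .rfl, decompEnv_of_notMem _ hu,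
    Function.update_self]

theorem Tracks.resS {s : ℕ} {S : STy} (h : Tracks c τ ρ E D Γ Λ Δ C)
    (hok : EnvOk (.std c) Γ Λ ({(.sess s true, S.dual)} + ({(.sess s false, S)} + Δ))) :
    ∃ D', (∀ v ∈ D', v ∈ D ∧ v ≠ .sess s true ∧ v ≠ .sess s false) ∧
      Tracks c (typesSession τ s S)
        (Function.update (Function.update ρ (.sess s false) (.sess (.idx s 1) false))
          (.sess s true) (.sess (.idx s 1) true)) E D' Γ Λ
        ({(.sess s true, S.dual)} + ({(.sess s false, S)} + Δ)) C ∧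
      decompEnv (Function.update (Function.update ρ (.sess s false) (.sess (.idx s 1) false))
          (.sess s true) (.sess (.idx s 1) true)) D'
          ({(.sess s true, S.dual)} + ({(.sess s false, S)} + Δ)) =
        bothEnds (((TBase.idx s 1).tuple S.decomp.length).zip S.decomp) + decompEnv ρ D Δ := by
  have hok' := hok.mono le_rfl (Multiset.le_add_left _ _)
  have hne' := ne_of_envOk hok
  have hne := ne_of_envOk hok'
  have hD : ∀ v ≠ Name.sess s false, v ∈ D.erase (.sess s false) ↔ v ∈ D := fun v hv => by simp [hv]
  have hD' : ∀ v ≠ Name.sess s true, v ∈ (D.erase (.sess s false)).erase (.sess s true) ↔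
    v ∈ D.erase (.sess s false) := fun v hv => by simp [hv]
  have h1 := h.bindSes (T := S) (n := .sess (.idx s 1) false) hne
    (fun v U hv => ⟨ne_of_lookup_chans hok' hv, hv⟩) rfl rfl hD (fun _ h => h) (fun _ _ _ h => h)
    fun _ q hq => h.lookup_entry_sess hq
  refine ⟨(D.erase (.sess s false)).erase (.sess s true), ?_, h1.bindSes hne'
    (fun v U hv => ⟨ne_of_lookup_chans hok hv, hv⟩) rfl rfl hD' (fun _ h => h) (fun _ _ _ h => h)
    fun _ q hq => h.lookup_entry_sess hq, ?_⟩
  · intro v hv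
    simp only [Finset.mem_erase] at hv
    exact ⟨hv.2.2, hv.1, hv.2.1⟩
  · rw [decompEnv_add, decompEnv_update _ hne' hD', decompEnv_add, decompEnv_update _ hne hD,
      decompEnv_of_notMem _ (by simp), decompEnv_of_notMem _ (by simp), Function.update_self,
      Function.update_self, entry_sess_dual, entry_sess, bothEnds_eq]
    abel

theorem Tracks.resA {a : ℕ} {U : VTy} (h : Tracks c τ ρ E D Γ Λ Δ C) (hU : U.Std c)
    (hok : EnvOk (.std c) (Γ.bindShared a U) Λ Δ) :
    Tracks c (Function.update τ (.shared a) (.chan U))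
        (Function.update ρ (.shared a) (.shared (.idx a 1))) E (D.erase (.shared a))
        (Γ.bindShared a U) Λ Δ ((.shared (.idx a 1), U.decomp) :: C) ∧
      decompEnv (Function.update ρ (.shared a) (.shared (.idx a 1))) (D.erase (.shared a)) Δ =
        decompEnv ρ D Δ := by
  have hne : ∀ p ∈ Δ, p.1 ≠ .shared a := fun p hp => hok.kind_ses p hp a
  have hD : ∀ v ≠ Name.shared a, v ∈ D.erase (.shared a) ↔ v ∈ D := fun v hv => by simp [hv]
  refine ⟨h.bindChan (u := .shared a) hne (by simp [Name.init]) hU ?_ rfl hD ?_ ?_ ?_,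
    decompEnv_update _ hne hD⟩
  · intro v W hv
    by_cases hva : v = .shared a
    · subst hva
      simp only [SEnv.bindShared, List.lookup_cons_self, Option.some.injEq] at hv
      exact .inl ⟨rfl, hv.symm⟩
    · simp only [SEnv.bindShared, List.lookup_cons, beq_eq_false_iff_ne.2 hva] at hv
      exact .inr ⟨hva, hv⟩
  · intro p hp
    simpa [Name.init] using hp
  · intro v hv W hW
    have : v.init ≠ .shared (.idx a 1) := fun he => hv (Name.init_injective he)
    rwa [List.lookup_cons, beq_eq_false_iff_ne.2 this]
  · simp [Name.init]

theorem SEnv.lookup_bindParams {B X : Type} [DecidableEq B] (Γ : SEnv B X) (ps : List (B × CTy))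
    (v : Name B) : (Γ.bindParams ps).chans.lookup v =
      ((sharedParams ps).lookup v).or
        (if v ∈ ps.map (fun q => Name.var q.1) then none else Γ.chans.lookup v) := by
  have := List.lookup_filter_fst (fun n => decide (n ∉ ps.map fun q => Name.var q.1)) Γ.chans v
  rw [SEnv.bindParams, List.lookup_append, this]
  by_cases h : v ∈ ps.map fun q => Name.var q.1
  · rw [if_pos h, if_neg (by simpa using h)]
  · rw [if_neg h, if_pos (by simpa using h)]

theorem sessionParams_paramTuple (b : TBase) (S : STy) :
    sessionParams (paramTuple b (.sess S)) = entry (.var b) S := by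
  rw [paramTuple, entry, CTy.decomp, List.length_map, Name.var_tuple, List.zip_map_left,
    List.zip_map_right, sessionParams, List.filterMap_map, ← List.filterMap_eq_map]
  rfl

theorem sharedParams_paramTuple (b : TBase) (S : STy) :
    sharedParams (paramTuple b (.sess S)) = [] := by
  rw [sharedParams, List.filterMap_eq_nil_iff]
  rintro ⟨a, C⟩ hp
  have := (List.of_mem_zip hp).2
  obtain ⟨M, -, rfl⟩ := List.mem_map.1 this
  rfl

theorem paramTuple_chan (b : TBase) (U : VTy) :
    paramTuple b (.chan U) = [(b, .chan U.decomp)] := by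
  simp [paramTuple, CTy.decomp, TBase.tuple, TBase.shift_zero]

theorem paramTuple_map_fst (b : TBase) (C : CTy) :
    (paramTuple b C).map Prod.fst = b.tuple C.decomp.length := by
  rw [paramTuple, List.map_fst_zip]
  simp [TBase.tuple_length]

theorem paramTuple_map_snd (b : TBase) (C : CTy) : (paramTuple b C).map Prod.snd = C.decomp := by
  rw [paramTuple, List.map_snd_zip]
  simp [TBase.tuple_length]

/-- The parameters `b_1, …, b_n` replace the session `u`, inside of an abstraction. -/
theorem Tracks.bindSessionParam {Γt : SEnv TBase TVar} (h : Tracks c τ ρ E D Γ Λ Δ Γt.chans)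
    {u : Name ℕ} {b : TBase} {T : STy} {D' : Finset (Name ℕ)} {Γ' : SEnv ℕ ℕ}
    (hu : ∀ p ∈ Δ, p.1 ≠ u)
    (hΓ : ∀ v U, Γ'.chans.lookup v = some U → v ≠ u ∧ Γ.chans.lookup v = some U)
    (hvals : Γ'.vals = Γ.vals) (hb : (Name.var b).owner = some u) (hD : ∀ v ≠ u, v ∈ D' ↔ v ∈ D)
    (huD : u ∉ D') :
    Tracks c (Function.update τ u (.sess T)) (Function.update ρ u (.var b)) E D' Γ' Λ
        ({(u, T)} + Δ) (Γt.bindParams (paramTuple b (.sess T))).chans ∧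
      decompEnv (Function.update ρ u (.var b)) D' ({(u, T)} + Δ) =
        sessionParams (paramTuple b (.sess T)) + decompEnv ρ D Δ := by
  have hsh : (Γt.bindParams (paramTuple b (.sess T))).chans =
      Γt.chans.filter fun p => p.1 ∉ (paramTuple b (.sess T)).map fun q => Name.var q.1 := by
    rw [SEnv.bindParams, sharedParams_paramTuple]; rfl
  have hnames : (paramTuple b (.sess T)).map (fun q => Name.var q.1) =
      (Name.var b).tuple T.decomp.length := by
    rw [Name.var_tuple, show T.decomp.length = (CTy.sess T).decomp.length by simp [CTy.decomp],
      ← paramTuple_map_fst, List.map_map]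
    rfl
  refine ⟨h.bindSes hu hΓ hvals hb hD ?_ ?_ ?_, ?_⟩
  · rw [hsh]
    exact fun p hp => List.mem_of_mem_filter hp
  · intro v hv U hU
    rw [SEnv.lookup_bindParams, sharedParams_paramTuple, hnames, if_neg]
    · simpa using hU
    · intro hmem
      obtain ⟨j, -, hj⟩ := List.mem_map.1 hmem
      have := congrArg Name.owner hj
      rw [Name.owner_shift, hb, Name.owner_init, Option.some.injEq] at this
      exact hv this.symm
  · intro _ q hq
    rw [SEnv.lookup_bindParams, sharedParams_paramTuple, hnames, if_pos (mem_entry hq).1]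
    rfl
  · rw [decompEnv_add, decompEnv_update _ hu hD, decompEnv_of_notMem _ huD, Function.update_self,
      sessionParams_paramTuple]

/-- Entering the body of an abstraction. -/
theorem Tracks.bindParam {Γt : SEnv TBase TVar} (h : Tracks c τ ρ E D Γ Λ Δ Γt.chans)
    {y : ℕ} {C₀ : CTy} (hC : C₀.Std c)
    (hok : EnvOk (.std c) (Γ.bindParams [(y, C₀)]) Λ (sessionParams [(y, C₀)] + Δ)) :
    Tracks c (Function.update τ (.var y) C₀) (Function.update ρ (.var y) (.var (.idx y 1))) E
        (D.erase (.var y)) (Γ.bindParams [(y, C₀)]) Λ (sessionParams [(y, C₀)] + Δ)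
        (Γt.bindParams (paramTuple (.idx y 1) C₀)).chans ∧
      decompEnv (Function.update ρ (.var y) (.var (.idx y 1))) (D.erase (.var y))
          (sessionParams [(y, C₀)] + Δ) =
        sessionParams (paramTuple (.idx y 1) C₀) + decompEnv ρ D Δ := by
  have hD : ∀ v ≠ Name.var y, v ∈ D.erase (.var y) ↔ v ∈ D := fun v hv => by simp [hv]
  cases C₀ with
  | sess T =>
    have hs : (sessionParams [(y, CTy.sess T)] : DEnv ℕ) = {(.var y, T)} := rfl
    rw [hs] at hok ⊢
    refine h.bindSessionParam (ne_of_envOk hok) ?_ rfl rfl hD (by simp)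
    intro v U hv
    rw [SEnv.lookup_bindParams] at hv
    by_cases hvy : v = .var y <;> simp_all [sharedParams]
  | chan U =>
    have hs : (sessionParams [(y, CTy.chan U)] : DEnv ℕ) = 0 := rfl
    have hs' : (sessionParams (paramTuple (.idx y 1) (.chan U)) : DEnv TBase) = 0 := by
      rw [paramTuple_chan]; rfl
    rw [hs, zero_add] at hok ⊢
    rw [hs', zero_add]
    have hne : ∀ p ∈ Δ, p.1 ≠ .var y := by
      intro p hp he
      have := hok.disj_ses p hp
      rw [he, SEnv.lookup_bindParams] at this
      simp [sharedParams] at this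
    have hU : U.Std c := by
      cases hC with
      | chan hU => exact hU
    refine ⟨h.bindChan (u := .var y) hne (by simp [Name.init]) hU ?_ rfl hD ?_ ?_ ?_,
      decompEnv_update _ hne hD⟩
    · intro v W hv
      rw [SEnv.lookup_bindParams] at hv
      by_cases hvy : v = .var y
      · simp_all [sharedParams]
      · right
        have hl : ([(.var y, U)] : List (Name ℕ × VTy)).lookup v = none :=
          lookup_eq_none_of_forall_ne (by simpa using Ne.symm hvy)
        simpa [sharedParams, hvy, hl] using hv
    · intro p hp
      rw [paramTuple_chan] at hp
      rcases List.mem_append.1 hp with hp | hp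
      · left
        simpa [sharedParams, Name.init] using hp
      · exact .inr (List.mem_of_mem_filter hp)
    · intro v hv W hW
      have : v.init ≠ .var (.idx y 1) := fun he => hv (Name.init_injective (a₂ := .var y) he)
      have hl : ([(.var (.idx y 1), U.decomp)] : List (Name TBase × VTy)).lookup v.init = none :=
        lookup_eq_none_of_forall_ne (by simpa using Ne.symm this)
      rw [paramTuple_chan, SEnv.lookup_bindParams]
      simp [sharedParams, this, hl, hW]
    · rw [paramTuple_chan, SEnv.lookup_bindParams]
      simp [sharedParams, Name.init]

end

/-! ### The invariant of the breakdown -/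

/-- The breakdown of `P` is typable, under all environments and maps that fit the given
environments of `P`: from the decomposed linear environment without the names that are no longer
used, and the propagators, of which the first one is only used for input. -/
def Good (c : Bool) (Γ : SEnv ℕ ℕ) (Λ : LEnv ℕ) (Δ : DEnv ℕ) (P : Proc ℕ ℕ) : Prop :=
  ∀ (τ : Name ℕ → CTy) (ρ : NameMap) (k : ℕ) (E : ℕ → VTy) (D : Finset (Name ℕ))
    (Γt : SEnv TBase TVar), P.Annotated → P.Tidy τ → (∀ u ∈ D, u ∉ P.fn) →
    Tracks c τ ρ E D Γ Λ Δ Γt.chans → (∀ p ∈ Γt.vals, (VTy.hot .shr p.2).Minimal c) →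
    ∃ Ms : List STy, Ms.length + 1 = P.degree ∧ (∀ M ∈ Ms, M.Minimal c) ∧
      Typed (.minimal c) Γt 0
        (decompEnv ρ D Δ + ({(propIn k, carrier E P.fv)} + propEnv (k + 1) Ms))
        (P.breakdown τ ρ k (context P.fv))

/-- The breakdown of the value `V` is typable. A variable that is used linearly has to be
available as a linear one. -/
def GoodVal (c : Bool) (Γ : SEnv ℕ ℕ) (Λ : LEnv ℕ) (Δ : DEnv ℕ) (V : Val ℕ ℕ) (U : VTy) : Prop :=
  ∀ (τ : Name ℕ → CTy) (ρ : NameMap) (k : ℕ) (E : ℕ → VTy) (D : Finset (Name ℕ))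
    (Γt : SEnv TBase TVar), V.Annotated → V.Tidy τ → (∀ u ∈ D, u ∉ V.fn) →
    Tracks c τ ρ E D Γ Λ Δ Γt.chans → ValsFor c E V.fv Γt.vals →
    (∀ x Cs, V = .var x → U = .hot .lin Cs → E x = .hot .lin Cs) →
    ∃ Ms : List STy, Ms.length = V.degree ∧ (∀ M ∈ Ms, M.Minimal c) ∧
      ValTyped (.minimal c) Γt (linPart E V.fv) (decompEnv ρ D Δ + propEnv k Ms)
        (V.breakdown τ ρ k (context V.fv)) U.decomp

theorem SesOk.of_eq {B : Type} [DecidableEq B] {F : TypeLang} {C : List (Name B × VTy)}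
    {Δ Δ' R : DEnv B} (h : SesOk F C Δ) (he : Δ = Δ' + R) : SesOk F C Δ' :=
  (he ▸ h).left

theorem Typed.par_zero {B X : Type} [DecidableEq B] [DecidableEq X] {F : TypeLang} {Γ : SEnv B X}
    {Λ : LEnv X} {Δ Δ₁ Δ₂ : DEnv B} {P Q : Proc B X} (hP : Typed F Γ Λ Δ₁ P)
    (hQ : Typed F Γ 0 Δ₂ Q) (hΔ : Δ = Δ₁ + Δ₂) (hs : SesOk F Γ.chans Δ) :
    Typed F Γ Λ Δ (.par P Q) := by
  subst hΔ
  have := Typed.par hP hQ (envOk_iff.2 ⟨by simpa using hP.envOk.valOk, hs⟩)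
  simpa using this

theorem carrier_congr {E E' : ℕ → VTy} {s : Finset ℕ} (h : ∀ x ∈ s, E x = E' x) :
    carrier E s = carrier E' s := by
  have : (context s).map (fun x => (TVar.src x, (E x).decomp)) =
      (context s).map fun x => (TVar.src x, (E' x).decomp) :=
    List.map_congr_left fun x hx => by rw [h x (mem_context.1 hx)]
  rw [carrier, carrier, carried, carried, this]

theorem forall_minimal_cons {c : Bool} {M : STy} {Ms : List STy} (hM : M.Minimal c)
    (hMs : ∀ M ∈ Ms, M.Minimal c) : ∀ N ∈ M :: Ms, N.Minimal c :=
  List.forall_mem_cons.2 ⟨hM, hMs⟩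

theorem forall_minimal_append {c : Bool} {Ms Ms' : List STy} (hMs : ∀ M ∈ Ms, M.Minimal c)
    (hMs' : ∀ M ∈ Ms', M.Minimal c) : ∀ N ∈ Ms ++ Ms', N.Minimal c := fun N hN =>
  (List.mem_append.1 hN).elim (hMs N) (hMs' N)

section
variable {c : Bool} {τ : Name ℕ → CTy} {ρ : NameMap} {E : ℕ → VTy} {D : Finset (Name ℕ)}
  {Γ : SEnv ℕ ℕ} {Λ Λ₁ Λ₂ : LEnv ℕ} {Δ Δ₁ Δ₂ : DEnv ℕ} {C : List (Name TBase × VTy)}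
  {Γt : SEnv TBase TVar} {P Q : Proc ℕ ℕ} {V : Val ℕ ℕ} {U : VTy}

theorem ValTyped.std (h : ValTyped (.std c) Γ Λ Δ V U) : U.Std c := by
  cases h with
  | shVar x Cs hx hok => exact hok.ty_val _ (List.mem_of_lookup_eq_some hx)
  | linVar x Cs hok => exact hok.ty_lin (x, Cs) (by simp)
  | absLin ps _ _ _ h => exact h
  | absShr ps _ _ _ h => exact h

/-- If `V` is a variable that is used linearly but transmitted at a shared type, then it is promoted
before it is used. -/
theorem Tracks.promote (hT : Tracks c τ ρ E D Γ Λ Δ C) (hV : ValTyped (.std c) Γ Λ Δ V U)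
    {s : Finset ℕ} (hs : ∀ p ∈ Λ, p.1 ∉ s) {Γ₁ : SEnv TBase TVar}
    (hv : ValsFor c E (V.fv ∪ s) Γ₁.vals) :
    ∃ (E' : ℕ → VTy) (Γ' : SEnv TBase TVar), Γ'.chans = Γ₁.chans ∧
      Tracks c τ ρ E' D Γ Λ Δ C ∧ (∀ y ∈ s, E' y = E y) ∧ ValsFor c E' (V.fv ∪ s) Γ'.vals ∧
      (∀ x Cs, V = .var x → U = .hot .lin Cs → E' x = .hot .lin Cs) ∧
      ∀ Δ' R, Typed (.minimal c) Γ' (linPart E' (V.fv ∪ s)) Δ' R →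
        Typed (.minimal c) Γ₁ (linPart E (V.fv ∪ s)) Δ' R := by
  by_cases hmode : ∀ x Cs, V = .var x → U = .hot .lin Cs → E x = .hot .lin Cs
  · exact ⟨E, Γ₁, rfl, hT, fun _ _ => rfl, hv, hmode, fun _ _ h => h⟩
  cases hV with
  | shVar x Cs hx hok => simp at hmode
  | absLin ps h1 h2 h3 h4 => simp at hmode
  | absShr ps h1 h2 h3 h4 => simp at hmode
  | linVar x Cs hok =>
    -- only the arrow of `E x` can differ: the target received `x` as a shared variable, and the
    -- rule `eprom` makes it linear there too
    obtain ⟨m, hm⟩ := hT.lin_mode (x, Cs) (by simp)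
    simp only at hm
    cases m
    · simp [hm] at hmode
    have hxs : x ∉ s := hs (x, Cs) (by simp)
    have hstd : (VTy.hot .lin Cs).Std c := hok.ty_lin (x, Cs) (by simp)
    have hne : ∀ y ∈ s, y ≠ x := fun y hy he => hxs (he ▸ hy)
    have hsh := hv.shr x (by simp [Val.fv]) Cs hm
    refine ⟨Function.update E x (.hot .lin Cs), Γ₁.eraseVals [.src x], rfl,
      ⟨hT.ses_ty, hT.chan_ty, hT.owner, hT.chan_name, hT.chan_lookup, ?_, ?_, hT.kind_chan,
        hT.ty_chan, hT.disj⟩, fun y hy => Function.update_of_ne (hne y hy) _ _, ⟨?_, ?_, ?_, ?_⟩,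
      ?_, ?_⟩
    · intro p hp
      rw [Multiset.mem_singleton.1 hp]
      exact ⟨.lin, by simp⟩
    · intro y Ds hy
      have : y ≠ x := by
        rintro rfl
        have := hok.disj_lin (y, Cs) (by simp)
        simp_all
      rw [Function.update_of_ne this]
      exact hT.shr_mode y Ds hy
    · intro y hy
      by_cases hyx : y = x
      · subst hyx; simpa using hstd
      · rw [Function.update_of_ne hyx]; exact hv.std y hy
    · intro y hy Ds hE
      by_cases hyx : y = x
      · subst hyx; simp at hE
      · rw [Function.update_of_ne hyx] at hE
        rw [SEnv.lookup_eraseVals, if_neg (by simpa using hyx)]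
        exact hv.shr y hy Ds hE
    · intro y hy Ds hE
      rw [SEnv.lookup_eraseVals]
      split_ifs with hyx
      · rfl
      · have hyx : y ≠ x := by simpa using hyx
        rw [Function.update_of_ne hyx] at hE
        exact hv.lin y hy Ds hE
    · exact fun p hp => hv.ty p (List.mem_of_mem_filter hp)
    · intro y Ds hy hD
      simp only [Val.var.injEq, VTy.hot.injEq, true_and] at hy hD
      subst hy; subst hD
      simp
    · intro Δ' R hR
      refine Typed.eprom (.src x) (CTy.decomps Cs) hsh (hR.cast ?_ rfl)
        (envOk_iff.2 ⟨hv.valOk, hR.envOk.sesOk⟩)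
      have hx : ∀ E : ℕ → VTy, linPart E ((Val.var x : Val ℕ ℕ).fv ∪ s) =
          linOne E x + linPart E s := by
        intro E
        rw [Val.fv, linPart, Finset.sum_union (Finset.disjoint_singleton_left.2 hxs),
          Finset.sum_singleton, ← linPart]
      rw [hx, hx, linOne_shr hm, linOne_lin (Cs := Cs) (by simp),
        linPart_congr (E := Function.update E x (.hot .lin Cs)) (E' := E)
          fun y hy => Function.update_of_ne (hne y hy) _ _, zero_add, Multiset.singleton_add]

/-- What is needed to type `c_j?(x̃).R` where `R` uses the value `V`, and the variables in `s`
afterwards. -/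
theorem GoodVal.prefix (ih : GoodVal c Γ Λ Δ V U) (hV : ValTyped (.std c) Γ Λ Δ V U)
    (ha : V.Annotated) (ht : V.Tidy τ) (hD : ∀ u ∈ D, u ∉ V.fn)
    (hT : Tracks c τ ρ E D Γ Λ Δ Γt.chans) {s : Finset ℕ} (hs : ∀ p ∈ Λ, p.1 ∉ s)
    (hE : ∀ x ∈ V.fv ∪ s, (E x).Std c) (hv : ∀ p ∈ Γt.vals, (VTy.hot .shr p.2).Minimal c) (k : ℕ) :
    ∃ (E' : ℕ → VTy) (Γ' : SEnv TBase TVar) (Ms : List STy), Ms.length = V.degree ∧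
      (∀ M ∈ Ms, M.Minimal c) ∧ Γ'.chans = Γt.chans ∧ ValsFor c E' (V.fv ∪ s) Γ'.vals ∧
      carrier E' s = carrier E s ∧ linPart E' (V.fv ∪ s) = linPart E' V.fv + linPart E' s ∧
      (∀ x ∈ V.fv, ∀ Cs, E' x = .hot .lin Cs → ∃ Ds, (x, Ds) ∈ Λ) ∧
      ValTyped (.minimal c) Γ' (linPart E' V.fv) (decompEnv ρ D Δ + propEnv k Ms)
        (V.breakdown τ ρ k (context V.fv)) U.decomp ∧
      ∀ {j : ℕ} {Δ₁ Δ₂ : DEnv TBase} {R : Proc TBase TVar},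
        Typed (.minimal c) Γ' (linPart E' (V.fv ∪ s)) Δ₁ R →
        Δ₂ = {(propIn j, carrier E (V.fv ∪ s))} + Δ₁ → SesOk (.minimal c) Γt.chans Δ₂ →
        Typed (.minimal c) Γt 0 Δ₂ (.inp (propIn j) (unpacked (context (V.fv ∪ s))) R) := by
  obtain ⟨E', Γ', hch, hT', hagree, hv', hmode, hprom⟩ :=
    hT.promote hV hs (valsFor_bindVals hE hv)
  obtain ⟨Ms, hl, hm, hty⟩ := ih τ ρ k E' D Γ' ha ht hD
    (by rw [hch]; exact hT') (hv'.mono Finset.subset_union_left) hmode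
  have hlin : ∀ x ∈ V.fv, ∀ Cs, E' x = .hot .lin Cs → ∃ Ds, (x, Ds) ∈ Λ := fun x hx Cs h =>
    hT'.mem_of_lin hV.varsOk hx h
  refine ⟨E', Γ', Ms, hl, hm, hch, hv', carrier_congr hagree, linPart_union fun x hx hx' => ?_,
    hlin, hty, fun hR hΔ hs => .rcv_context hE hv (hprom _ _ hR) hΔ hs⟩
  rcases hEx : E' x with ⟨m, Cs⟩
  cases m
  · obtain ⟨Ds, hD⟩ := hlin x hx Cs hEx
    exact (hs _ hD hx').elim
  · exact ⟨Cs, rfl⟩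

theorem Good.nil (hok : EnvOk (.std c) Γ 0 0) : Good c Γ 0 0 .nil := by
  intro τ ρ k E D Γt _ _ _ hT hv
  refine ⟨[], rfl, by simp, ?_⟩
  have hs := hT.sesOk hok (k := k) (Ms := [carrier E ∅])
    (forall_minimal_cons (carrier_minimal (by simp)) (by simp))
  rw [decompEnv_zero, zero_add, propEnv_cons, add_assoc] at hs
  rw [decompEnv_zero, zero_add, propEnv_nil, add_zero]
  have hv' : ValsFor c E ∅ (Γt.bindVals (carried E ∅)).vals := valsFor_bindVals (by simp) hv
  rw [Proc.breakdown, ← context_eq_nil.2 (rfl : (∅ : Finset ℕ) = ∅)]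
  refine Typed.rcv_context (s := ∅) (E := E) (Δ := 0) (by simp) hv ?_ (add_zero _).symm hs.left
  exact .nil (envOk_iff.2 ⟨hv'.valOk, hs.mono (Multiset.zero_le _)⟩)

theorem Good.endW {u : Name ℕ} (h : Typed (.std c) Γ Λ Δ P)
    (hok : EnvOk (.std c) Γ Λ ((u, .done) ::ₘ Δ)) (ih : Good c Γ Λ Δ P) :
    Good c Γ Λ ((u, .done) ::ₘ Δ) P := by
  intro τ ρ k E D Γt ha ht hD hT hv
  have hT' := hT.mono le_rfl (Multiset.le_cons_self Δ _)
  obtain ⟨Ms, hl, hm, hty⟩ := ih τ ρ k E D Γt ha ht hD hT' hv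
  refine ⟨Ms, hl, hm, ?_⟩
  have hs := hT.sesOk hok (k := k) (Ms := carrier E P.fv :: Ms)
    (forall_minimal_cons (carrier_minimal (hT'.std h.envOk h.varsOk)) hm)
  rw [← Multiset.singleton_add, decompEnv_add] at hs ⊢
  -- a name in `D` has left the environment of the target, so that there is nothing to weaken
  by_cases hu : u ∈ D
  · rwa [decompEnv_of_mem _ hu, zero_add]
  · rw [decompEnv_of_notMem _ hu, entry_of_decomp (M := .done) (by simp [STy.decomp]),
      Multiset.coe_singleton] at hs ⊢
    rw [add_assoc]
    refine hty.weaken (ρ u) (hs.of_eq (R := {(propOut k, (carrier E P.fv).dual)}) ?_)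
    rw [propEnv_cons]
    abel

theorem Good.eprom {x : ℕ} {Cs : List CTy} (hx : Γ.vals.lookup x = some Cs)
    (ih : Good c (Γ.eraseVals [x]) ((x, Cs) ::ₘ Λ) Δ P) : Good c Γ Λ Δ P := by
  intro τ ρ k E D Γt ha ht hD hT hv
  -- promotion is not mirrored here: `E` still transmits `x` at its shared type
  exact ih τ ρ k E D Γt ha ht hD (hT.eraseVals hx) hv

theorem Good.par (hP : Typed (.std c) Γ Λ₁ Δ₁ P) (hQ : Typed (.std c) Γ Λ₂ Δ₂ Q)
    (hok : EnvOk (.std c) Γ (Λ₁ + Λ₂) (Δ₁ + Δ₂)) (ihP : Good c Γ Λ₁ Δ₁ P)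
    (ihQ : Good c Γ Λ₂ Δ₂ Q) : Good c Γ (Λ₁ + Λ₂) (Δ₁ + Δ₂) (.par P Q) := by
  intro τ ρ k E D Γt ha ht hD hT hv
  simp only [Proc.fn, Finset.mem_union, not_or] at hD
  obtain ⟨Ms, hl, hm, hty⟩ := ihP τ ρ (k + 1) E D Γt ha.1 ht.1 (fun u hu => (hD u hu).1)
    (hT.mono (Multiset.le_add_right _ _) (Multiset.le_add_right _ _)) hv
  obtain ⟨Ms', hl', hm', hty'⟩ := ihQ τ ρ (k + P.degree + 1) E D Γt ha.2 ht.2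
    (fun u hu => (hD u hu).2) (hT.mono (Multiset.le_add_left _ _) (Multiset.le_add_left _ _)) hv
  have hE := hT.std hok (hP.varsOk.add hQ.varsOk)
  have hc := carrier_minimal (c := c) (E := E) (s := P.fv) fun x hx =>
    hE x (Finset.mem_union_left _ hx)
  have hc' := carrier_minimal (c := c) (E := E) (s := Q.fv) fun x hx =>
    hE x (Finset.mem_union_right _ hx)
  have hMs := forall_minimal_append (forall_minimal_cons hc hm) (forall_minimal_cons hc' hm')
  have hs := hT.sesOk hok (k := k)
    (forall_minimal_cons (carrier_minimal hE) hMs)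
  have hj : k + 1 + (carrier E P.fv :: Ms).length = k + P.degree + 1 := by
    simp only [List.length_cons]; omega
  refine ⟨(carrier E P.fv :: Ms) ++ (carrier E Q.fv :: Ms'), ?_, hMs, ?_⟩
  · simp only [Proc.degree, List.length_append, List.length_cons]; omega
  rw [propEnv_cons, propEnv_append, hj, propEnv_cons, propEnv_cons, decompEnv_add] at hs
  rw [propEnv_append, hj, propEnv_cons, propEnv_cons, decompEnv_add]
  have hv' := valsFor_bindVals (Γ := Γt) hE hv
  have hlin := hT.linPart_union hok.valOk hP.varsOk hQ.varsOk
  have hA : Typed (.minimal c) Γt 0 ({(propIn k, carrier E (P.fv ∪ Q.fv))} +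
      ({(propOut (k + 1), (carrier E P.fv).dual)} +
        {(propOut (k + P.degree + 1), (carrier E Q.fv).dual)}))
      (.inp (propIn k) (unpacked (context (P.fv ∪ Q.fv)))
        (.out (propOut (k + 1)) (packed (context P.fv))
          (.out (propOut (k + P.degree + 1)) (packed (context Q.fv)) .nil))) := by
    refine .rcv_context hE hv (Typed.cast (Typed.send_context
      (hv'.mono Finset.subset_union_left) (Typed.send_context_nil
        (hv'.mono Finset.subset_union_right) ?_) rfl ?_ ?_) hlin rfl) rfl ?_
    · exact hs.mono (Multiset.singleton_le.2 (by simp))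
    · exact hlin ▸ hv'.valOk
    · exact hs.of_eq (R := decompEnv ρ D Δ₁ + decompEnv ρ D Δ₂ +
        {(propIn k, carrier E (P.fv ∪ Q.fv))} + {(propOut k, (carrier E (P.fv ∪ Q.fv)).dual)} +
        {(propIn (k + 1), carrier E P.fv)} + propEnv (k + 1 + 1) Ms +
        {(propIn (k + P.degree + 1), carrier E Q.fv)} + propEnv (k + P.degree + 1 + 1) Ms')
        (by abel)
    · exact hs.of_eq (R := decompEnv ρ D Δ₁ + decompEnv ρ D Δ₂ +
        {(propOut k, (carrier E (P.fv ∪ Q.fv)).dual)} +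
        {(propIn (k + 1), carrier E P.fv)} + propEnv (k + 1 + 1) Ms +
        {(propIn (k + P.degree + 1), carrier E Q.fv)} + propEnv (k + P.degree + 1 + 1) Ms')
        (by abel)
  refine Typed.par_zero hA (Typed.par_zero hty hty' rfl ?_) (by rw [Proc.fv]; abel) ?_
  · exact hs.of_eq (R := {(propIn k, carrier E (P.fv ∪ Q.fv))} +
      {(propOut k, (carrier E (P.fv ∪ Q.fv)).dual)} + {(propOut (k + 1), (carrier E P.fv).dual)} +
        {(propOut (k + P.degree + 1), (carrier E Q.fv).dual)}) (by abel)
  · exact hs.of_eq (R := {(propOut k, (carrier E (P.fv ∪ Q.fv)).dual)}) (by rw [Proc.fv]; abel)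

end

/-! ### Breakdown of communications and applications -/

section
variable {c : Bool} {τ : Name ℕ → CTy} {ρ : NameMap} {E : ℕ → VTy} {D : Finset (Name ℕ)}
  {Γ : SEnv ℕ ℕ} {Λ Λ₁ Λ₂ : LEnv ℕ} {Δ Δ₁ Δ₂ : DEnv ℕ} {C : List (Name TBase × VTy)}
  {Γt : SEnv TBase TVar} {P Q : Proc ℕ ℕ} {V : Val ℕ ℕ} {U : VTy}

theorem Proc.fv_out_singleton {B X : Type} [DecidableEq B] [DecidableEq X] (u : Name B)
    (V : Val B X) (P : Proc B X) : (Proc.out u [V] P).fv = V.fv ∪ P.fv := by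
  simp [Proc.fv, Val.fvs]

/-- Linear variables of a value do not occur in the continuation. -/
theorem notMem_fv_of_linear (hP : Typed (.std c) Γ Λ₁ Δ₁ P)
    (hok : ValOk (.std c) Γ.vals (Λ₁ + Λ₂)) : ∀ p ∈ Λ₂, p.1 ∉ P.fv := fun p hp =>
  hP.varsOk.notMem (by rwa [add_comm]) (x := p.1) (Cs := p.2) hp

/-- The breakdown of a process that sends one value, given how to type the output itself. -/
theorem Good.output {τ' : Name ℕ → CTy} {ρ' : NameMap} {D' : Finset (Name ℕ)} {k : ℕ}
    {n : Name TBase} {Δn Δc : DEnv TBase}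
    (hP : Typed (.std c) Γ Λ₁ Δ₁ P) (hV : ValTyped (.std c) Γ Λ₂ Δ₂ V U)
    (ihP : Good c Γ Λ₁ Δ₁ P) (ihV : GoodVal c Γ Λ₂ Δ₂ V U)
    (hok : EnvOk (.std c) Γ (Λ₁ + Λ₂) (Δ₁ + Δ₂))
    (haV : V.Annotated) (htV : V.Tidy τ') (haP : P.Annotated) (htP : P.Tidy τ')
    (hDV : ∀ u ∈ D', u ∉ V.fn) (hDP : ∀ u ∈ D', u ∉ P.fn)
    (hT : Tracks c τ' ρ' E D' Γ (Λ₁ + Λ₂) (Δ₁ + Δ₂) Γt.chans)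
    (hv : ∀ p ∈ Γt.vals, (VTy.hot .shr p.2).Minimal c)
    (hs : ∀ k Ms, (∀ M ∈ Ms, STy.Minimal c M) →
      SesOk (.minimal c) Γt.chans (Δn + decompEnv ρ' D' (Δ₁ + Δ₂) + propEnv k Ms))
    (hsend : ∀ {Γ' : SEnv TBase TVar} {Λ' Λ'' : LEnv TVar} {Δ' Δ'' : DEnv TBase}
      {V' : Val TBase TVar} {R : Proc TBase TVar}, Γ'.chans = Γt.chans →
      ValTyped (.minimal c) Γ' Λ' Δ' V' U.decomp → Typed (.minimal c) Γ' Λ'' Δ'' R →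
      (Λ₂ = 0 → Λ' = 0) → ValOk (.minimal c) Γ'.vals (Λ' + Λ'') →
      SesOk (.minimal c) Γt.chans (Δn + Δ'' + Δ') →
      Typed (.minimal c) Γ' (Λ' + Λ'') (Δn + Δ'' + Δ') (.out n [V'] R))
    (hΔc : Δc = Δn + decompEnv ρ' D' (Δ₁ + Δ₂)) :
    ∃ Ms : List STy, Ms.length = V.degree + P.degree ∧ (∀ M ∈ Ms, M.Minimal c) ∧
      Typed (.minimal c) Γt 0
        (Δc + ({(propIn k, carrier E (V.fv ∪ P.fv))} + propEnv (k + 1) Ms))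
        (.par
          (.inp (propIn k) (unpacked (context (V.fv ∪ P.fv)))
            (.out n [V.breakdown τ' ρ' (k + 1) (context V.fv)]
              (.out (propOut (k + V.degree + 1)) (packed (context P.fv)) .nil)))
          (P.breakdown τ' ρ' (k + V.degree + 1) (context P.fv))) := by
  subst hΔc
  have hE := hT.std hok (hP.varsOk.add hV.varsOk)
  rw [Finset.union_comm] at hE
  obtain ⟨Ms', hl', hm', hty'⟩ := ihP τ' ρ' (k + V.degree + 1) E D' Γt haP htP hDP
    (hT.mono (Multiset.le_add_right _ _) (Multiset.le_add_right _ _)) hv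
  obtain ⟨E', Γ', Ms, hl, hm, hch, hv', hcar, hlin, hmem, hty, hrcv⟩ := ihV.prefix hV haV htV hDV
    (hT.mono (Multiset.le_add_left _ _) (Multiset.le_add_left _ _))
    (notMem_fv_of_linear hP hok.valOk) hE hv (k + 1)
  have hc' := carrier_minimal (c := c) (E := E) (s := P.fv) fun x hx =>
    hE x (Finset.mem_union_right _ hx)
  have hMs := forall_minimal_append hm (forall_minimal_cons hc' hm')
  have hs := hs k _ (forall_minimal_cons (carrier_minimal hE) hMs)
  have hj : k + 1 + Ms.length = k + V.degree + 1 := by omega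
  refine ⟨Ms ++ (carrier E P.fv :: Ms'), ?_, hMs, ?_⟩
  · simp only [List.length_append, List.length_cons]; omega
  rw [propEnv_cons, propEnv_append, hj, propEnv_cons, decompEnv_add] at hs
  rw [propEnv_append, hj, propEnv_cons, decompEnv_add]
  have hsA := hs.of_eq
    (Δ' := {(propIn k, carrier E (V.fv ∪ P.fv))} +
      (Δn + {(propOut (k + V.degree + 1), (carrier E P.fv).dual)} +
        (decompEnv ρ' D' Δ₂ + propEnv (k + 1) Ms)))
    (R := {(propOut k, (carrier E (V.fv ∪ P.fv)).dual)} + decompEnv ρ' D' Δ₁ +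
      {(propIn (k + V.degree + 1), carrier E P.fv)} + propEnv (k + V.degree + 1 + 1) Ms')
    (by abel)
  have hcont := Typed.send_context_nil (k := k + V.degree + 1)
    (hv'.mono Finset.subset_union_right) (by
      rw [hcar, hch]
      exact hsA.right.left.right)
  rw [hcar] at hcont
  -- on a shared name the value has no linear variables, also in the target
  have h0 : Λ₂ = 0 → linPart E' V.fv = 0 := by
    rintro rfl
    refine linPart_eq_zero fun x hx => ?_
    rcases hEx : E' x with ⟨m, Cs⟩
    cases m
    · obtain ⟨Ds, hD⟩ := hmem x hx Cs hEx
      simp at hD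
    · exact ⟨Cs, rfl⟩
  have hA := hrcv ((hsend hch hty hcont h0 (hlin ▸ hv'.valOk) hsA.right).cast hlin rfl) rfl hsA
  refine Typed.par_zero hA hty' (by abel) ?_
  exact hs.of_eq (R := {(propOut k, (carrier E (V.fv ∪ P.fv)).dual)}) (by abel)

theorem Good.send {u : Name ℕ} {S : STy} (hP : Typed (.std c) Γ Λ₁ Δ₁ P)
    (hV : ValTyped (.std c) Γ Λ₂ Δ₂ V U) (heq : Δ₁ + Δ₂ = (u, S) ::ₘ Δ)
    (hok : EnvOk (.std c) Γ (Λ₁ + Λ₂) ((u, .out [U] S) ::ₘ Δ))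
    (ihP : Good c Γ Λ₁ Δ₁ P) (ihV : GoodVal c Γ Λ₂ Δ₂ V U) :
    Good c Γ (Λ₁ + Λ₂) ((u, .out [U] S) ::ₘ Δ) (.out u [V] P) := by
  intro τ ρ k E D Γt ha ht hD hT hv
  rw [← Multiset.singleton_add] at *
  simp only [Proc.fn, Val.fns, Finset.union_empty, Finset.mem_union, Finset.mem_singleton,
    not_or] at hD
  simp only [Proc.Tidy, Val.fns, Finset.union_empty, Val.Tidys, and_true] at ht
  have hu : u ∉ D := fun h => (hD u h).1.1 rfl
  obtain ⟨-, hUU, hU, hS⟩ := STy.Std.out_inv (hok.ty_ses (u, .out [U] S) (by simp))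
  have hU' : U.Std c := hV.std
  have hM : STy.Minimal c (.out [U.decomp] .done) :=
    .out (by simp) (by simpa using hU'.decomp)
  obtain ⟨D', hD', hT', hdec⟩ := hT.comm (S := S) (M := .out [U.decomp] .done) hok hu rfl (by
    by_cases hd : S = .done
    · exact .inl ⟨hd, by simp [hd, STy.decomp, VTy.decomps]⟩
    · exact .inr ⟨hd, by simp [STy.decomp_out hd, VTy.decomps]⟩)
  rw [← heq] at hT' hdec
  have hok' : EnvOk (.std c) Γ (Λ₁ + Λ₂) (Δ₁ + Δ₂) := by
    rw [heq]
    exact envOk_iff.2 ⟨hok.valOk, hok.sesOk.retype hS⟩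
  -- `u` may have joined the names that must not occur any more, but then this was its last
  -- communication and tidiness applies
  have hDV : ∀ v ∈ D', v ∉ V.fn := fun v hv => by
    rcases hD' v hv with h | ⟨rfl, h⟩
    · exact (hD v h).1.2
    · exact (ht.1 h).1
  have hDP : ∀ v ∈ D', v ∉ P.fn := fun v hv => by
    rcases hD' v hv with h | ⟨rfl, h⟩
    · exact (hD v h).2
    · exact (ht.1 h).2
  refine Exists.elim (Good.output (k := k) (n := ρ u) hP hV ihP ihV hok' ha.1.1 ht.2.1 ha.2
    ht.2.2 hDV hDP hT' hv
    (fun k Ms hMs => hdec ▸ hT.sesOk hok hMs) ?_ hdec) fun Ms ⟨hl, hm, hty⟩ => ?_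
  · intro Γ' Λ' Λ'' Δ' Δ'' V' R hch hV' hR _ hvo hso
    rw [add_assoc] at hso ⊢
    refine Typed.send_one (Δ₁ := Δ'') (Δ₂ := Δ') _ (hR.weaken (ρ u) ?_)
      (valsTyped_singleton.2 hV') rfl hvo (hch ▸ hso)
    rw [← add_assoc] at hso
    exact hch ▸ hso.left.retype .done
  · refine ⟨Ms, by simp [Proc.degree, Val.degrees, hl], hm, ?_⟩
    rw [Proc.fv_out_singleton]
    simpa only [Proc.breakdown, Val.degrees, Val.breakdowns, Nat.add_zero] using hty

theorem Good.req {u : Name ℕ} (hu : Γ.chans.lookup u = some U) (hP : Typed (.std c) Γ Λ Δ₁ P)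
    (hV : ValTyped (.std c) Γ 0 Δ₂ V U) (hok : EnvOk (.std c) Γ Λ (Δ₁ + Δ₂))
    (ihP : Good c Γ Λ Δ₁ P) (ihV : GoodVal c Γ 0 Δ₂ V U) :
    Good c Γ Λ (Δ₁ + Δ₂) (.out u [V] P) := by
  intro τ ρ k E D Γt ha ht hD hT hv
  simp only [Proc.fn, Val.fns, Finset.union_empty, Finset.mem_union, Finset.mem_singleton,
    not_or] at hD
  have hτ : τ u = .chan U := hT.chan_ty u U hu
  have hτ' : Function.update τ u (τ u).tail = τ := by
    rw [hτ, CTy.tail, ← hτ, Function.update_eq_self]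
    all_goals simp
  have hρ : incrName τ ρ u = ρ := by simp [incrName, hτ]
  simp only [Proc.Tidy, Val.fns, Finset.union_empty, Val.Tidys, and_true, hτ'] at ht
  have hlook : Γt.chans.lookup (ρ u) = some U.decomp := by
    rw [hT.chan_name u U hu]
    exact hT.chan_lookup u U hu
  have hok' : EnvOk (.std c) Γ (Λ + 0) (Δ₁ + Δ₂) := by rwa [add_zero]
  refine Exists.elim (Good.output (τ' := τ) (ρ' := ρ) (E := E) (D' := D) (k := k) (n := ρ u)
    (Δn := 0) hP hV ihP ihV hok' ha.1.1 ht.2.1 ha.2 ht.2.2 (fun v hv => (hD v hv).1.2)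
    (fun v hv => (hD v hv).2) (by rwa [add_zero]) hv
    (fun k Ms hMs => by rw [zero_add]; exact hT.sesOk hok hMs) ?_
    (zero_add _).symm) fun Ms ⟨hl, hm, hty⟩ => ?_
  · intro Γ' Λ' Λ'' Δ' Δ'' V' R hch hV' hR h0 hvo hso
    have h0 := h0 rfl
    subst h0
    rw [zero_add] at hso hvo ⊢
    rw [zero_add]
    exact .req U.decomp (by rw [hch, hlook]) hR hV' (envOk_iff.2 ⟨hvo, hch ▸ hso⟩)
  · refine ⟨Ms, by simp [Proc.degree, Val.degrees, hl], hm, ?_⟩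
    rw [Proc.fv_out_singleton]
    simpa only [Proc.breakdown, Val.degrees, Val.breakdowns, Nat.add_zero, hτ', hρ] using hty

theorem ValsFor.bind {y : ℕ} {s : Finset ℕ} (h : ValsFor c E (s \ [y].toFinset) Γt.vals)
    (hU : U.Std c) :
    ValsFor c (Function.update E y U) s (Γt.bindVals [(.src y, U.decomp)]).vals := by
  have hmem : ∀ x ∈ s, x ≠ y → x ∈ s \ [y].toFinset := fun x hx hxy => by simp [hx, hxy]
  have hne : ∀ x, x ≠ y → TVar.src x ∉ [(TVar.src y, U.decomp)].map Prod.fst := fun x hxy => by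
    simpa using hxy
  refine ⟨?_, ?_, ?_, ?_⟩
  · intro x hx
    by_cases hxy : x = y
    · subst hxy; simpa using hU
    · rw [Function.update_of_ne hxy]; exact h.std x (hmem x hx hxy)
  · intro x hx Cs hE
    by_cases hxy : x = y
    · subst hxy
      rw [Function.update_self] at hE
      subst hE
      rw [SEnv.lookup_bindVals_of_mem (m := .shr) (Cs := CTy.decomps Cs) _ (by simp)
        (by simp [VTy.decomp])]
      rfl
    · rw [Function.update_of_ne hxy] at hE
      rw [SEnv.lookup_bindVals_of_notMem _ (hne x hxy)]
      exact h.shr x (hmem x hx hxy) Cs hE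
  · intro x hx Cs hE
    by_cases hxy : x = y
    · subst hxy
      rw [Function.update_self] at hE
      subst hE
      rw [SEnv.lookup_bindVals_of_mem (m := .lin) (Cs := CTy.decomps Cs) _ (by simp)
        (by simp [VTy.decomp])]
      rfl
    · rw [Function.update_of_ne hxy] at hE
      rw [SEnv.lookup_bindVals_of_notMem _ (hne x hxy)]
      exact h.lin x (hmem x hx hxy) Cs hE
  · intro p hp
    rcases SEnv.mem_bindVals hp with hp | hp
    · rw [List.mem_singleton, Prod.mk.injEq] at hp
      rw [hp.2]
      exact hU.decomp
    · exact h.ty p hp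

theorem linPart_bind {y : ℕ} {s : Finset ℕ} (h : ∀ Cs, U = .hot .lin Cs → y ∈ s) :
    linPart (Function.update E y U) s =
      linearVars [(TVar.src y, U.decomp)] + linPart E (s \ [y].toFinset) := by
  have h1 : linPart (Function.update E y U) (s \ [y].toFinset) = linPart E (s \ [y].toFinset) :=
    linPart_congr fun x hx => Function.update_of_ne (by simp at hx; exact hx.2) _ _
  have h2 : (linearVars [(TVar.src y, U.decomp)] : LEnv TVar) =
      linOne (Function.update E y U) y := by
    rcases U with ⟨m, Cs⟩
    cases m
    · rw [linOne_lin (Cs := Cs) (by simp)]; simp [linearVars, VTy.decomp]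
    · rw [linOne_shr (Cs := Cs) (by simp)]; simp [linearVars, VTy.decomp]
  rw [← h1, h2]
  by_cases hy : y ∈ s
  · have : s \ [y].toFinset = s.erase y := by ext x; simp [and_comm]
    rw [linPart, linPart, this, Finset.add_sum_erase _ _ hy]
  · have : s \ [y].toFinset = s := by simp [hy]
    rcases U with ⟨m, Cs⟩
    cases m
    · exact (hy (h Cs rfl)).elim
    · rw [this, linOne_shr (Cs := Cs) (by simp), zero_add]

/-- The breakdown of a process that receives one value, given how to type the input itself. -/
theorem Good.input {τ' : Name ℕ → CTy} {ρ' : NameMap} {D' : Finset (Name ℕ)} {k y : ℕ}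
    {n : Name TBase} {Δn Δc : DEnv TBase} (hU : U.Std c)
    (hP : Typed (.std c) (Γ.bindVals [(y, U)]) (linearVars [(y, U)] + Λ) Δ P)
    (ihP : Good c (Γ.bindVals [(y, U)]) (linearVars [(y, U)] + Λ) Δ P)
    (haP : P.Annotated) (htP : P.Tidy τ') (hDP : ∀ u ∈ D', u ∉ P.fn)
    (hok : EnvOk (.std c) Γ Λ Δ)
    (hT : Tracks c τ' ρ' E D' Γ Λ Δ Γt.chans)
    (hv : ∀ p ∈ Γt.vals, (VTy.hot .shr p.2).Minimal c)
    (hs : ∀ k Ms, (∀ M ∈ Ms, STy.Minimal c M) →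
      SesOk (.minimal c) Γt.chans (Δn + decompEnv ρ' D' Δ + propEnv k Ms))
    (hrcv : ∀ {Γ' : SEnv TBase TVar} {Λ' : LEnv TVar} {Δ' : DEnv TBase} {R : Proc TBase TVar},
      Γ'.chans = Γt.chans →
      Typed (.minimal c) (Γ'.bindVals [(.src y, U.decomp)])
        (linearVars [(TVar.src y, U.decomp)] + Λ') Δ' R →
      ValOk (.minimal c) Γ'.vals Λ' → SesOk (.minimal c) Γt.chans (Δn + Δ') →
      Typed (.minimal c) Γ' Λ' (Δn + Δ') (.inp n [.src y] R))
    (hΔc : Δc = Δn + decompEnv ρ' D' Δ) :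
    ∃ Ms : List STy, Ms.length = P.degree ∧ (∀ M ∈ Ms, M.Minimal c) ∧
      Typed (.minimal c) Γt 0
        (Δc + ({(propIn k, carrier E (P.fv \ [y].toFinset))} + propEnv (k + 1) Ms))
        (.par
          (.inp (propIn k) (unpacked (context (P.fv \ [y].toFinset)))
            (.inp n [.src y] (.out (propOut (k + 1)) (packed (context P.fv)) .nil)))
          (P.breakdown τ' ρ' (k + 1) (context P.fv))) := by
  subst hΔc
  have hvar := hP.varsOk.of_bindVals hP.envOk.valOk
  have hE := hT.std hok hvar
  obtain ⟨Ms, hl, hm, hty⟩ := ihP τ' ρ' (k + 1) (Function.update E y U) D' Γt haP htP hDP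
    (hT.bindVals (ne_of_valOk_bindVals hP.envOk.valOk)) hv
  have hv' := valsFor_bindVals (Γ := Γt) hE hv
  have hv'' := hv'.bind hU
  have hMs := forall_minimal_cons (carrier_minimal hv''.std) hm
  have hs := hs k _ (forall_minimal_cons (carrier_minimal hE) hMs)
  refine ⟨carrier (Function.update E y U) P.fv :: Ms, hl, hMs, ?_⟩
  rw [propEnv_cons, propEnv_cons] at hs
  rw [propEnv_cons]
  have hsA := hs.of_eq
    (Δ' := {(propIn k, carrier E (P.fv \ [y].toFinset))} +
      (Δn + {(propOut (k + 1), (carrier (Function.update E y U) P.fv).dual)}))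
    (R := {(propOut k, (carrier E (P.fv \ [y].toFinset)).dual)} + decompEnv ρ' D' Δ +
      {(propIn (k + 1), carrier (Function.update E y U) P.fv)} + propEnv (k + 1 + 1) Ms)
    (by abel)
  have hlin : linPart (Function.update E y U) P.fv =
      linearVars [(TVar.src y, U.decomp)] + linPart E (P.fv \ [y].toFinset) := by
    refine linPart_bind fun Cs hCs => hP.varsOk.1 (y, Cs) ?_
    simp [hCs, linearVars]
  have hcont := (Typed.send_context_nil (k := k + 1) hv'' hsA.right.right).cast hlin.symm rfl
  have hA := Typed.rcv_context hE hv (hrcv rfl hcont hv'.valOk hsA.right) rfl hsA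
  refine Typed.par_zero hA hty (by abel) ?_
  exact hs.of_eq (R := {(propOut k, (carrier E (P.fv \ [y].toFinset)).dual)}) (by abel)

theorem Good.rcv {u : Name ℕ} {y : ℕ} {S : STy}
    (hP : Typed (.std c) (Γ.bindVals [(y, U)]) (linearVars [(y, U)] + Λ) ((u, S) ::ₘ Δ) P)
    (hok : EnvOk (.std c) Γ Λ ((u, .inp [U] S) ::ₘ Δ))
    (ihP : Good c (Γ.bindVals [(y, U)]) (linearVars [(y, U)] + Λ) ((u, S) ::ₘ Δ) P) :
    Good c Γ Λ ((u, .inp [U] S) ::ₘ Δ) (.inp u [y] P) := by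
  intro τ ρ k E D Γt ha ht hD hT hv
  rw [← Multiset.singleton_add] at *
  simp only [Proc.fn, Finset.mem_union, Finset.mem_singleton, not_or] at hD
  simp only [Proc.Tidy] at ht
  have hu : u ∉ D := fun h => (hD u h).1 rfl
  obtain ⟨U', hUU, hU, hS⟩ := STy.Std.inp_inv (hok.ty_ses (u, .inp [U] S) (by simp))
  rw [List.cons.injEq] at hUU
  rw [← hUU.1] at hU
  have hM : STy.Minimal c (.inp [U.decomp] .done) :=
    .inp (by simp) (by simpa using hU.decomp)
  obtain ⟨D', hD', hT', hdec⟩ := hT.comm (S := S) (M := .inp [U.decomp] .done) hok hu rfl (by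
    by_cases hd : S = .done
    · exact .inl ⟨hd, by simp [hd, STy.decomp, VTy.decomps]⟩
    · exact .inr ⟨hd, by simp [STy.decomp_inp hd, VTy.decomps]⟩)
  have hDP : ∀ v ∈ D', v ∉ P.fn := fun v hv => by
    rcases hD' v hv with h | ⟨rfl, h⟩
    · exact (hD v h).2
    · exact ht.1 h
  refine Exists.elim (Good.input (k := k) (n := ρ u) hU hP ihP ha ht.2 hDP
    (envOk_iff.2 ⟨hok.valOk, hok.sesOk.retype hS⟩) hT' hv
    (fun k Ms hMs => hdec ▸ hT.sesOk hok hMs) ?_ hdec) fun Ms ⟨hl, hm, hty⟩ => ?_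
  · intro Γ' Λ' Δ' R hch hR hvo hso
    exact Typed.rcv_one (Us := [U.decomp]) (by simp) rfl
      (hR.weaken (ρ u) (by rw [SEnv.bindVals, hch]; exact hso.retype .done)) rfl hvo hM
  · exact ⟨Ms, by simp [Proc.degree, hl], hm, hty⟩

theorem Good.acc {u : Name ℕ} {y : ℕ} (hu : Γ.chans.lookup u = some U)
    (hP : Typed (.std c) (Γ.bindVals [(y, U)]) (linearVars [(y, U)] + Λ) Δ P)
    (hok : EnvOk (.std c) Γ Λ Δ)
    (ihP : Good c (Γ.bindVals [(y, U)]) (linearVars [(y, U)] + Λ) Δ P) :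
    Good c Γ Λ Δ (.inp u [y] P) := by
  intro τ ρ k E D Γt ha ht hD hT hv
  simp only [Proc.fn, Finset.mem_union, Finset.mem_singleton, not_or] at hD
  have hτ : τ u = .chan U := hT.chan_ty u U hu
  have hτ' : Function.update τ u (τ u).tail = τ := by
    rw [hτ, CTy.tail, ← hτ, Function.update_eq_self]
    all_goals simp
  have hρ : incrName τ ρ u = ρ := by simp [incrName, hτ]
  simp only [Proc.Tidy, hτ'] at ht
  have hlook : Γt.chans.lookup (ρ u) = some U.decomp := by
    rw [hT.chan_name u U hu]
    exact hT.chan_lookup u U hu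
  refine Exists.elim (Good.input (k := k) (n := ρ u) (Δn := 0)
    (hok.ty_chan _ (List.mem_of_lookup_eq_some hu)) hP ihP ha ht.2
    (fun v hv => (hD v hv).2) hok hT hv
    (fun k Ms hMs => by rw [zero_add]; exact hT.sesOk hok hMs) ?_ (zero_add _).symm)
    fun Ms ⟨hl, hm, hty⟩ => ?_
  · intro Γ' Λ' Δ' R hch hR hvo hso
    rw [zero_add] at hso ⊢
    exact .acc U.decomp (by rw [hch, hlook]) hR (envOk_iff.2 ⟨hvo, hch ▸ hso⟩)
  · refine ⟨Ms, by simp [Proc.degree, hl], hm, ?_⟩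
    rw [Proc.breakdown, hτ', hρ]
    exact hty

theorem namesTyped_sessions {B X : Type} [DecidableEq B] {Γ : SEnv B X} (l : List (Name B × STy)) :
    NamesTyped Γ l (l.map Prod.fst) (l.map fun p => .sess p.2) := by
  induction l with
  | nil => exact .nil
  | cons p l ih => exact .sess p.1 p.2 ih

theorem namesTyped_entry {Γ : SEnv TBase TVar} (n : Name TBase) (S : STy) :
    NamesTyped Γ (entry n S) (n.tuple S.decomp.length) (S.decomp.map .sess) := by
  have := namesTyped_sessions (Γ := Γ) (entry n S)
  rwa [entry_map_fst, show (entry n S).map (fun p => CTy.sess p.2) =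
    ((entry n S).map Prod.snd).map .sess by simp, entry, List.map_snd_zip
      (by simp [Name.tuple_length])] at this

theorem Good.app {us : List (Name ℕ)} {m : Arrow} {Cs : List CTy}
    (hV : ValTyped (.std c) Γ Λ Δ₁ V (.hot m Cs)) (hus : NamesTyped Γ Δ₂ us Cs)
    (hok : EnvOk (.std c) Γ Λ (Δ₁ + Δ₂)) (ihV : GoodVal c Γ Λ Δ₁ V (.hot m Cs)) :
    Good c Γ Λ (Δ₁ + Δ₂) (.app V us) := by
  intro τ ρ k E D Γt ha ht hD hT hv
  simp only [Proc.fn, Finset.mem_union, List.mem_toFinset, not_or] at hD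
  obtain ⟨C₀, rfl, hC₀⟩ := VTy.Std.hot_inv hV.std
  have hT₁ := hT.mono le_rfl (Multiset.le_add_right Δ₁ Δ₂)
  have hE : ∀ x ∈ V.fv ∪ ∅, (E x).Std c := by
    rw [Finset.union_empty]
    exact hT₁.std hV.envOk hV.varsOk
  have hnames : ∀ Γ' : SEnv TBase TVar, Γ'.chans = Γt.chans →
      NamesTyped Γ' (decompEnv ρ D Δ₂) (us.flatMap fun u => (ρ u).tuple (τ u).decomp.length)
        (CTy.decomps [C₀]) := by
    intro Γ' hch
    cases hus with
    | sess u S h =>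
      cases h
      have hτ : τ u = .sess S := hT.ses_ty (u, S) (by simp)
      have hu : u ∉ D := fun h => (hD u h).2 (by simp)
      rw [← Multiset.singleton_add, add_zero, decompEnv_of_notMem _ hu]
      simpa [hτ, CTy.decomps, CTy.decomp] using namesTyped_entry (Γ := Γ') (ρ u) S
    | shared u U hu h =>
      cases h
      have hτ : τ u = .chan U := hT.chan_ty u U hu
      have hl : Γ'.chans.lookup (ρ u) = some U.decomp := by
        rw [hch, hT.chan_name u U hu]
        exact hT.chan_lookup u U hu
      have := NamesTyped.shared (ρ u) U.decomp hl (.nil (Γ := Γ'))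
      simpa [hτ, CTy.decomps, CTy.decomp, Name.tuple, Name.shift_zero, decompEnv_zero] using this
  obtain ⟨E', Γ', Ms, hl, hm, hch, hv', -, -, -, hty, hrcv⟩ := ihV.prefix hV ha ht
    (fun u hu => (hD u hu).1) hT₁ (s := ∅) (by simp) hE hv (k + 1)
  have hs := hT.sesOk hok (k := k) (Ms := carrier E (V.fv ∪ ∅) :: Ms)
    (forall_minimal_cons (carrier_minimal hE) hm)
  refine ⟨Ms, by simp [Proc.degree, hl], hm, ?_⟩
  rw [propEnv_cons, decompEnv_add] at hs
  rw [decompEnv_add]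
  rw [Finset.union_empty] at hs hrcv hv'
  have hsA := hs.of_eq (Δ' := {(propIn k, carrier E V.fv)} +
      (decompEnv ρ D Δ₁ + propEnv (k + 1) Ms + decompEnv ρ D Δ₂))
    (R := {(propOut k, (carrier E V.fv).dual)}) (by abel)
  refine hrcv (.app m _ hty (hnames Γ' hch) ?_) (by rw [Proc.fv]; abel) (by
    rw [Proc.fv]; exact hs.of_eq (R := {(propOut k, (carrier E V.fv).dual)}) (by abel))
  exact envOk_iff.2 ⟨hv'.valOk, hch ▸ hsA.right⟩

end

/-! ### Breakdown of restrictions and abstractions -/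

section
variable {c : Bool} {τ : Name ℕ → CTy} {ρ : NameMap} {E : ℕ → VTy} {D : Finset (Name ℕ)}
  {Γ : SEnv ℕ ℕ} {Λ Λ₁ Λ₂ : LEnv ℕ} {Δ Δ₁ Δ₂ : DEnv ℕ} {C : List (Name TBase × VTy)}
  {Γt : SEnv TBase TVar} {P Q : Proc ℕ ℕ} {V : Val ℕ ℕ} {U : VTy}

theorem sessionTuple_eq (b : TBase) (S : STy) :
    sessionTuple b S = ((b.tuple S.decomp.length).zip S.decomp).map fun p => (p.1, some p.2) := by
  rw [sessionTuple, List.zip_map_right]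
  rfl

theorem props_eq (k : ℕ) (Ms : List STy) :
    props k Ms.length = (((TBase.prop k).tuple Ms.length).zip Ms).map fun p => (p.1, none) := by
  have : ((TBase.prop k).tuple Ms.length) =
      (((TBase.prop k).tuple Ms.length).zip Ms).map Prod.fst := by
    rw [List.map_fst_zip]
    simp [TBase.tuple_length]
  rw [props, this, List.map_map, ← this]
  rfl

/-- A breakdown together with the output that starts it. -/
theorem Typed.trigger {s : Finset ℕ} {k : ℕ} {Δt : DEnv TBase} {Ms : List STy}
    {R : Proc TBase TVar} (hv : ValsFor c E s Γt.vals)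
    (hR : Typed (.minimal c) Γt 0 (Δt + ({(propIn k, carrier E s)} + propEnv (k + 1) Ms)) R)
    (hs : SesOk (.minimal c) Γt.chans (Δt + propEnv k (carrier E s :: Ms))) :
    Typed (.minimal c) Γt (linPart E s) (Δt + propEnv k (carrier E s :: Ms))
      (.par (.out (propOut k) (packed (context s)) .nil) R) := by
  rw [propEnv_cons] at hs ⊢
  have he : Δt + ({(propIn k, carrier E s)} + {(propOut k, (carrier E s).dual)} +
      propEnv (k + 1) Ms) = {(propOut k, (carrier E s).dual)} +
        (Δt + ({(propIn k, carrier E s)} + propEnv (k + 1) Ms)) := by abel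
  exact (Typed.send_context_nil hv (hs.of_eq he)).par_zero hR he hs

theorem Typed.trigger_res {s : Finset ℕ} {k n : ℕ} {Δt : DEnv TBase} {Ms : List STy}
    {R : Proc TBase TVar} (hv : ValsFor c E s Γt.vals) (hn : Ms.length + 1 = n)
    (hR : Typed (.minimal c) Γt 0 (Δt + ({(propIn k, carrier E s)} + propEnv (k + 1) Ms)) R)
    (hs : SesOk (.minimal c) Γt.chans (Δt + propEnv k (carrier E s :: Ms))) :
    Typed (.minimal c) Γt (linPart E s) Δt
      (.resMany (props k n) (.par (.out (propOut k) (packed (context s)) .nil) R)) := by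
  rw [← hn, ← List.length_cons (a := carrier E s), props_eq]
  refine Typed.resMany (ann := fun _ => none) (fun _ => .inl rfl) _ ?_
  exact (Typed.trigger hv hR hs).cast rfl (add_comm _ _)

theorem Good.resS {s : ℕ} {ann : Option STy} {S : STy} (hann : ann = none ∨ ann = some S)
    (hP : Typed (.std c) Γ Λ ((.sess s false, S) ::ₘ (.sess s true, S.dual) ::ₘ Δ) P)
    (ih : Good c Γ Λ ((.sess s false, S) ::ₘ (.sess s true, S.dual) ::ₘ Δ) P) :
    Good c Γ Λ Δ (.resS s ann P) := by
  intro τ ρ k E D Γt ha ht hD hT hv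
  obtain rfl : ann = some S := hann.resolve_left ha.1
  have he : (.sess s false, S) ::ₘ (.sess s true, S.dual) ::ₘ Δ =
      {(Name.sess s true, S.dual)} + ({(Name.sess s false, S)} + Δ) := by
    simp only [← Multiset.singleton_add]; abel
  rw [he] at hP ih
  obtain ⟨D', hD', hT', hdec⟩ := hT.resS hP.envOk
  obtain ⟨Ms, hl, hm, hty⟩ := ih _ _ k E D' Γt ha.2 ht (fun u hu hu' => by
    obtain ⟨h1, h2, h3⟩ := hD' u hu
    exact hD u h1 (by simp [Proc.fn, hu', h2, h3])) hT' hv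
  refine ⟨Ms, hl, hm, ?_⟩
  rw [hdec, add_assoc] at hty
  rw [Proc.breakdown, Option.getD_some, sessionTuple_eq]
  exact Typed.resMany (ann := some) (fun _ => .inr rfl) _ hty

theorem Good.resA {a : ℕ} (hP : Typed (.std c) (Γ.bindShared a U) Λ Δ P)
    (hok : EnvOk (.std c) Γ Λ Δ) (ih : Good c (Γ.bindShared a U) Λ Δ P) :
    Good c Γ Λ Δ (.resA a U P) := by
  intro τ ρ k E D Γt ha ht hD hT hv
  have hU : U.Std c := hP.envOk.ty_chan (.shared a, U) (by simp [SEnv.bindShared])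
  obtain ⟨hT', hdec⟩ := hT.resA hU hP.envOk
  obtain ⟨Ms, hl, hm, hty⟩ := ih _ _ k E _ (Γt.bindShared (.idx a 1) U.decomp) ha ht
    (fun u hu hu' => by
      rw [Finset.mem_erase] at hu
      exact hD u hu.2 (by simp [Proc.fn, hu', hu.1])) hT' hv
  refine ⟨Ms, hl, hm, ?_⟩
  rw [hdec] at hty
  have hs := hT.sesOk hok (k := k) (Ms := carrier E P.fv :: Ms)
    (forall_minimal_cons (carrier_minimal (hT'.std hP.envOk hP.varsOk)) hm)
  rw [propEnv_cons] at hs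
  refine .resA _ _ hty (envOk_iff.2 ⟨valOk_zero hv,
    hs.of_eq (R := {(propOut k, (carrier E P.fv).dual)}) ?_⟩)
  rw [Proc.fv]
  abel

theorem GoodVal.shVar {x : ℕ} {Cs : List CTy} (hok : EnvOk (.std c) Γ 0 0)
    (hx : Γ.vals.lookup x = some Cs) : GoodVal c Γ 0 0 (.var x) (.hot .shr Cs) := by
  intro τ ρ k E D Γt _ _ _ hT hv _
  have hE := hT.shr_mode x Cs hx
  have hs := hT.sesOk hok (k := k) (Ms := []) (by simp)
  have hlin : linPart E (Val.var x : Val ℕ ℕ).fv = 0 := by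
    rw [linPart, Val.fv, Finset.sum_singleton, linOne_shr hE]
  have hvo := hv.valOk
  rw [hlin] at hvo
  refine ⟨[], rfl, by simp, ?_⟩
  rw [hlin, decompEnv_zero, propEnv_nil, add_zero]
  exact .shVar _ _ (hv.shr x (by simp [Val.fv]) Cs hE)
    (envOk_iff.2 ⟨hvo, hs.mono (Multiset.zero_le _)⟩)

theorem GoodVal.linVar {x : ℕ} {Cs : List CTy} (hok : EnvOk (.std c) Γ {(x, Cs)} 0) :
    GoodVal c Γ {(x, Cs)} 0 (.var x) (.hot .lin Cs) := by
  intro τ ρ k E D Γt _ _ _ hT hv hmode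
  have hE := hmode x Cs rfl rfl
  have hs := hT.sesOk hok (k := k) (Ms := []) (by simp)
  have hlin : linPart E (Val.var x : Val ℕ ℕ).fv = {(.src x, CTy.decomps Cs)} := by
    rw [linPart, Val.fv, Finset.sum_singleton, linOne_lin hE]
  have hvo := hv.valOk
  rw [hlin] at hvo
  refine ⟨[], rfl, by simp, ?_⟩
  rw [hlin, decompEnv_zero, propEnv_nil, add_zero]
  exact .linVar _ _ (envOk_iff.2 ⟨hvo, hs.mono (Multiset.zero_le _)⟩)

theorem paramTuple_nodup (b : TBase) (C : CTy) : ((paramTuple b C).map Prod.fst).Nodup := by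
  rw [paramTuple_map_fst]
  exact TBase.tuple_nodup _ _

theorem GoodVal.absLin {y : ℕ} {C₀ : CTy}
    (hP : Typed (.std c) (Γ.bindParams [(y, C₀)]) Λ (sessionParams [(y, C₀)] + Δ) P)
    (hok : EnvOk (.std c) Γ Λ Δ) (hC : C₀.Std c)
    (ih : Good c (Γ.bindParams [(y, C₀)]) Λ (sessionParams [(y, C₀)] + Δ) P) :
    GoodVal c Γ Λ Δ (.abs .lin [(y, C₀)] P) (.hot .lin [C₀]) := by
  intro τ ρ k E D Γt ha ht hD hT hv _
  obtain ⟨hT', hdec⟩ := hT.bindParam hC hP.envOk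
  obtain ⟨Ms, hl, hm, hty⟩ := ih _ _ k E _ (Γt.bindParams (paramTuple (.idx y 1) C₀)) ha ht
    (fun u hu hu' => by
      rw [Finset.mem_erase] at hu
      exact hD u hu.2 (by simp [Val.fn, hu', hu.1])) hT' hv.ty
  have hMs := forall_minimal_cons (carrier_minimal (hT'.std hP.envOk hP.varsOk)) hm
  have hs' := hT'.sesOk hP.envOk (k := k) hMs
  refine ⟨carrier E P.fv :: Ms, hl, hMs, ?_⟩
  rw [hdec] at hty hs'
  have hbody := (Typed.trigger (Γt := Γt.bindParams (paramTuple (.idx y 1) C₀)) (s := P.fv)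
    hv hty hs').cast rfl (add_assoc _ _ _).symm
  have hmin : (VTy.hot .lin ((paramTuple (.idx y 1) C₀).map Prod.snd)).Minimal c := by
    rw [paramTuple_map_snd]
    exact .hot (CTy.decomp_ne_nil _) hC.decomp
  have h := ValTyped.absLin _ (paramTuple_nodup (.idx y 1) C₀) hbody
    (envOk_iff.2 ⟨hv.valOk, hT.sesOk hok hMs⟩) hmin
  rw [paramTuple_map_snd] at h
  rw [Val.breakdown]
  simpa [Proc.resMany, VTy.decomp, CTy.decomps, initParams, Val.fv] using h

theorem GoodVal.absShr {y : ℕ} {C₀ : CTy}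
    (hP : Typed (.std c) (Γ.bindParams [(y, C₀)]) 0 (sessionParams [(y, C₀)]) P)
    (hok : EnvOk (.std c) Γ 0 0) (hC : C₀.Std c)
    (ih : Good c (Γ.bindParams [(y, C₀)]) 0 (sessionParams [(y, C₀)]) P) :
    GoodVal c Γ 0 0 (.abs .shr [(y, C₀)] P) (.hot .shr [C₀]) := by
  intro τ ρ k E D Γt ha ht hD hT hv _
  rw [← add_zero (sessionParams [(y, C₀)] : DEnv ℕ)] at hP ih
  obtain ⟨hT', hdec⟩ := hT.bindParam hC hP.envOk
  obtain ⟨Ms, hl, hm, hty⟩ := ih _ _ k E _ (Γt.bindParams (paramTuple (.idx y 1) C₀)) ha ht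
    (fun u hu hu' => by
      rw [Finset.mem_erase] at hu
      exact hD u hu.2 (by simp [Val.fn, hu', hu.1])) hT' hv.ty
  have hMs := forall_minimal_cons (carrier_minimal (hT'.std hP.envOk hP.varsOk)) hm
  have hs' := hT'.sesOk hP.envOk (k := k) hMs
  refine ⟨[], rfl, by simp, ?_⟩
  rw [hdec, decompEnv_zero, add_zero] at hty hs'
  -- the free variables of a `λ→` are all shared
  have hlin : linPart E P.fv = 0 := by
    refine linPart_eq_zero fun x hx => ?_
    rcases hEx : E x with ⟨m, Cs⟩
    cases m
    · obtain ⟨Ds, hD⟩ := hT'.mem_of_lin hP.varsOk hx hEx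
      simp at hD
    · exact ⟨Cs, rfl⟩
  have hbody := Typed.trigger_res (Γt := Γt.bindParams (paramTuple (.idx y 1) C₀)) (s := P.fv)
    hv hl hty hs'
  rw [hlin] at hbody
  rw [Val.fv, hlin, decompEnv_zero, propEnv_nil, add_zero]
  have hs0 : SesOk (.minimal c) Γt.chans 0 :=
    (hT.sesOk hok (k := k) hMs).mono (Multiset.zero_le _)
  have hmin : (VTy.hot .shr ((paramTuple (.idx y 1) C₀).map Prod.snd)).Minimal c := by
    rw [paramTuple_map_snd]
    exact .hot (CTy.decomp_ne_nil _) hC.decomp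
  have h := ValTyped.absShr _ (paramTuple_nodup (.idx y 1) C₀) hbody
    (envOk_iff.2 ⟨valOk_zero hv.ty, hs0⟩) hmin
  rw [paramTuple_map_snd] at h
  rw [Val.breakdown]
  simpa [VTy.decomp, CTy.decomps, initParams] using h

/-! ### Breakdown of selection and branching -/

theorem CTy.choose_bra {L : Finset Label} (S : L → STy) (l : L) :
    (CTy.sess (.bra L S)).choose l = S l := by
  simp [CTy.choose]

theorem CTy.choose_sel {L : Finset Label} (S : L → STy) (l : L) :
    (CTy.sess (.sel L S)).choose l = S l := by
  simp [CTy.choose]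

theorem Good.bra {u : Name ℕ} {L : Finset Label} {Ps : L → Proc ℕ ℕ} {S : L → STy}
    (hP : ∀ l : L, Typed (.std c) Γ Λ ((u, S l) ::ₘ Δ) (Ps l))
    (hok : EnvOk (.std c) Γ Λ ((u, .bra L S) ::ₘ Δ))
    (ih : ∀ l : L, Good c Γ Λ ((u, S l) ::ₘ Δ) (Ps l)) :
    Good c Γ Λ ((u, .bra L S) ::ₘ Δ) (.bra u L Ps) := by
  intro τ ρ k E D Γt ha ht hD hT hv
  have hvar := (Typed.bra L S hP hok).varsOk
  have hE := hT.std hok hvar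
  simp only [← Multiset.singleton_add] at *
  simp only [Proc.fn, Finset.mem_union, Finset.mem_singleton, not_or] at hD
  have hu : u ∉ D := fun h => (hD u h).1 rfl
  have hτ : τ u = .sess (.bra L S) := hT.ses_ty (u, .bra L S) (by simp)
  have hstd : (STy.bra L S).Std c := hok.ty_ses (u, .bra L S) (by simp)
  have hne := ne_of_envOk hok
  set s := (Proc.bra u L Ps).fv with hsdef
  have hs := hT.sesOk hok (k := k) (Ms := [carrier E s])
    (forall_minimal_cons (carrier_minimal hE) (by simp))
  -- the propagators of the branches are restricted inside of the abstractions
  refine ⟨[], rfl, by simp, ?_⟩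
  have hdec : decompEnv ρ D ({(u, .bra L S)} + Δ) = {(ρ u, .bra L fun l =>
      .out [.hot .lin ((S l).decomp.map fun M => .sess M)] .done)} + decompEnv ρ D Δ := by
    rw [decompEnv_add, decompEnv_of_notMem _ hu, entry_of_decomp (by rw [STy.decomp]),
      Multiset.coe_singleton]
  rw [hdec, propEnv_cons, propEnv_nil, add_zero] at hs
  rw [hdec, propEnv_nil, add_zero, Proc.breakdown]
  have hsA := hs.of_eq
    (Δ' := {(propIn k, carrier E s)} + ({(ρ u, .bra L fun l =>
      .out [.hot .lin ((S l).decomp.map fun M => .sess M)] .done)} + decompEnv ρ D Δ))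
    (R := {(propOut k, (carrier E s).dual)}) (by abel)
  have hv' := valsFor_bindVals (Γ := Γt) hE hv
  refine Typed.rcv_context hE hv (Typed.bra L _ (fun l => ?_)
    (envOk_iff.2 ⟨hv'.valOk, hsA.right⟩)) (add_comm _ _) (by rwa [add_comm])
  have hsl : (Ps l).fv ⊆ s := Finset.subset_biUnion_of_mem (fun l => (Ps l).fv) (Finset.mem_univ l)
  -- all branches have the same linear variables, those of `Λ`
  have hlin : linPart E (Ps l).fv = linPart E s := by
    refine linPart_subset hsl fun x hx Cs hEx => ?_
    obtain ⟨Ds, hD⟩ := hT.mem_of_lin hvar hx hEx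
    exact (hP l).varsOk.1 _ hD
  have hch : (τ u).choose l = S l := by rw [hτ, CTy.choose_bra]
  have hT₀ := hT.mono le_rfl (Multiset.le_add_left Δ {(u, .bra L S)})
  obtain ⟨hT', hdec'⟩ := Tracks.bindSessionParam (Γt := Γt.bindVals (carried E s)) (T := S l)
    (b := .bra u 1) hT₀ hne (fun v U hv => ⟨ne_of_lookup_chans hok hv, hv⟩) rfl rfl
    (fun _ _ => Iff.rfl) hu
  have hvl := hv'.mono hsl
  have htl : (Ps l).Tidy (Function.update τ u (.sess (S l))) := hch ▸ ht l
  obtain ⟨Ms, hl, hm, hty⟩ := ih l _ _ (k + 1) E D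
    ((Γt.bindVals (carried E s)).bindParams (paramTuple (.bra u 1) (.sess (S l)))) (ha l) htl
    (fun v hv hv' => (hD v hv).2 (Finset.mem_biUnion.2 ⟨l, Finset.mem_univ l, hv'⟩)) hT' hv'.ty
  have hs' := hT'.sesOk (hP l).envOk (k := k + 1)
    (forall_minimal_cons (carrier_minimal hvl.std) hm)
  rw [hdec'] at hty hs'
  have hbody := Typed.trigger_res
    (Γt := (Γt.bindVals (carried E s)).bindParams (paramTuple (.bra u 1) (.sess (S l))))
    hvl hl hty hs'
  have hS : (S l).Std c := by
    cases hstd with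
    | bra _ h => exact h l
  have habs := ValTyped.absLin _ (paramTuple_nodup (.bra u 1) (.sess (S l))) hbody
    (envOk_iff.2 ⟨hvl.valOk, hsA.right.right⟩) (by
      rw [paramTuple_map_snd]
      exact .hot (CTy.decomp_ne_nil _) (CTy.Std.sess hS).decomp)
  rw [paramTuple_map_snd, hlin] at habs
  have hsu : SesOk (.minimal c) (Γt.bindVals (carried E s)).chans
      ({(ρ u, .out [.hot .lin ((S l).decomp.map fun M => .sess M)] .done)} +
        decompEnv ρ D Δ) := by
    refine hsA.right.retype (.out (by simp) ?_)
    simp only [List.mem_singleton, forall_eq]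
    exact .hot (CTy.decomp_ne_nil (.sess (S l))) (CTy.Std.sess hS).decomp
  have hnil : Typed (.minimal c) (Γt.bindVals (carried E s)) 0 ({(ρ u, .done)} + 0) .nil :=
    Typed.weaken _ (.nil (envOk_iff.2 ⟨valOk_zero hv'.ty, hsu.mono (Multiset.zero_le _)⟩)) (by
      rw [add_zero]
      simpa using hsu.left.retype (Δ := 0) (S' := .done) .done)
  have := Typed.send_one (Δ₁ := 0) _ hnil (valsTyped_singleton.2 habs)
    (Δ := {(ρ u, .out [.hot .lin ((S l).decomp.map fun M => .sess M)] .done)} + decompEnv ρ D Δ)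
    (by rw [zero_add]; rfl) (by rw [add_zero]; exact hv'.valOk) hsu
  rw [add_zero] at this
  simpa only [hch, Multiset.singleton_add] using this

theorem ValsFor.bind_aux {s : Finset ℕ} {i : ℕ} {Cs : List CTy} (h : ValsFor c E s Γt.vals) :
    ValsFor c E s (Γt.bindVals [(.aux i, .hot .lin Cs)]).vals := by
  have hne : ∀ x, TVar.src x ∉ [(TVar.aux i, VTy.hot .lin Cs)].map Prod.fst := by simp
  refine ⟨h.std, fun x hx Ds hE => ?_, fun x hx Ds hE => ?_, fun p hp => ?_⟩
  · rw [SEnv.lookup_bindVals_of_notMem _ (hne x)]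
    exact h.shr x hx Ds hE
  · rw [SEnv.lookup_bindVals_of_notMem _ (hne x)]
    exact h.lin x hx Ds hE
  · rcases SEnv.mem_bindVals hp with hp | hp
    · simp at hp
    · exact h.ty p hp

theorem ValsFor.valOk_aux {s : Finset ℕ} {i : ℕ} {Cs : List CTy} (h : ValsFor c E s Γt.vals)
    (hC : (VTy.hot .lin Cs).Minimal c) :
    ValOk (.minimal c) (Γt.bindVals [(.aux i, .hot .lin Cs)]).vals
      (linPart E s + {(.aux i, Cs)}) := by
  have h' := (h.bind_aux (i := i) (Cs := Cs)).valOk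
  refine ⟨?_, ?_, h'.ty_val, ?_⟩
  · rw [add_comm, Multiset.singleton_add, Multiset.map_cons, Multiset.nodup_cons]
    refine ⟨fun hm => ?_, h'.nodup⟩
    obtain ⟨p, hp, he⟩ := Multiset.mem_map.1 hm
    obtain ⟨x, -, Ds, -, rfl⟩ := mem_linPart hp
    simp at he
  · intro p hp
    rcases Multiset.mem_add.1 hp with hp | hp
    · exact h'.disj p hp
    · rw [Multiset.mem_singleton] at hp
      subst hp
      rw [SEnv.lookup_bindVals_of_mem (m := .lin) (Cs := Cs) _ (by simp) (by simp)]
      rfl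
  · intro p hp
    rcases Multiset.mem_add.1 hp with hp | hp
    · exact h'.ty_lin p hp
    · rw [Multiset.mem_singleton] at hp
      subst hp
      exact hC

theorem sesOk_entry {n : Name TBase} {S : STy} (hS : S.Std c)
    (hk : ∀ p ∈ C, ∀ s bar, p.1 ≠ .sess s bar) (ht : ∀ p ∈ C, p.2.Minimal c)
    (hn : ∀ a, n ≠ .shared a) (hd : ∀ q ∈ entry n S, C.lookup q.1 = none) :
    SesOk (.minimal c) C (entry n S) := by
  refine ⟨?_, hd, hk, ?_, ht, fun q hq => hS.decomp _ (mem_entry hq).2⟩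
  · rw [Multiset.map_coe, entry_map_fst]
    exact Name.tuple_nodup _ _
  · intro q hq a
    obtain ⟨j, -, hj⟩ := List.mem_map.1 (mem_entry hq).1
    rw [← hj]
    cases n with
    | shared a => exact (hn a rfl).elim
    | _ => simp [Name.shift]

/-- The parameters `b_1, …, b_n` of an abstraction are fresh. -/
theorem SesOk.bindParams_entry {b : TBase} {S : STy} {Δt : DEnv TBase} (hS : S.Std c)
    (h : SesOk (.minimal c) Γt.chans Δt) (hne : ∀ p ∈ Δt, ∀ j, p.1 ≠ .var (b.shift j)) :
    SesOk (.minimal c) (Γt.bindParams (paramTuple b (.sess S))).chans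
      (sessionParams (paramTuple b (.sess S)) + Δt) := by
  have hch : ∀ p ∈ (Γt.bindParams (paramTuple b (.sess S))).chans, p ∈ Γt.chans := by
    intro p hp
    rw [SEnv.bindParams, sharedParams_paramTuple] at hp
    exact List.mem_of_mem_filter hp
  have hnames : (paramTuple b (.sess S)).map (fun q => Name.var q.1) =
      (Name.var b).tuple S.decomp.length := by
    rw [Name.var_tuple, show S.decomp.length = (CTy.sess S).decomp.length by simp [CTy.decomp],
      ← paramTuple_map_fst, List.map_map]
    rfl
  rw [sessionParams_paramTuple]
  refine .add (sesOk_entry hS (fun p hp => h.3 p (hch p hp)) (fun p hp => h.5 p (hch p hp))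
    (by simp) ?_) ⟨h.1, ?_, fun p hp => h.3 p (hch p hp), h.4, fun p hp => h.5 p (hch p hp), h.6⟩ ?_
  · intro q hq
    rw [SEnv.lookup_bindParams, sharedParams_paramTuple, hnames, if_pos (mem_entry hq).1]
    rfl
  · intro p hp
    have := h.2 p hp
    rw [List.lookup_eq_none_iff] at this ⊢
    exact fun q hq => this q (hch q hq)
  · intro q hq p hp he
    obtain ⟨j, -, hj⟩ := List.mem_map.1 (mem_entry hq).1
    exact hne p hp j (by rw [← he, ← hj]; rfl)

end

section
variable {c : Bool} {τ : Name ℕ → CTy} {ρ : NameMap} {E : ℕ → VTy} {D : Finset (Name ℕ)}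
  {Γ : SEnv ℕ ℕ} {Λ : LEnv ℕ} {Δ : DEnv ℕ} {Γt : SEnv TBase TVar} {P : Proc ℕ ℕ}

/-- The abstraction that performs a selection on `n`, receives the continuation of its partner, and
runs it with the parameters `ỹ` after handing over to the next propagator. -/
theorem Typed.selection {s : Finset ℕ} {k : ℕ} {n : Name TBase} {L : Finset Label} {S : L → STy}
    (l : L) (hS : (S l).dual.Std c) (hv : ValsFor c E s Γt.vals) (hn : ∀ j, n ≠ .var (.aux j))
    (hs : SesOk (.minimal c) Γt.chans
      ({(n, .sel L fun l => .inp [.hot .lin ((S l).dual.decomp.map fun M => .sess M)] .done)} +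
        {(propOut k, (carrier E s).dual)})) :
    ValTyped (.minimal c) Γt (linPart E s)
      ({(n, .sel L fun l => .inp [.hot .lin ((S l).dual.decomp.map fun M => .sess M)] .done)} +
        {(propOut k, (carrier E s).dual)})
      (.abs .lin (paramTuple (.aux 1) (.sess (S l).dual))
        (.sel n l (.inp n [.aux 1] (.out (propOut k) (packed (context s))
          (.app (.var (.aux 1))
            ((paramTuple (.aux 1) (.sess (S l).dual)).map fun p => .var p.1))))))
      (.hot .lin ((S l).dual.decomp.map fun M => .sess M)) := by
  set Cs : List CTy := (S l).dual.decomp.map fun M => .sess M with hCs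
  have hC : (VTy.hot .lin Cs).Minimal c :=
    .hot (CTy.decomp_ne_nil (.sess _)) (CTy.Std.sess hS).decomp
  have hM : (STy.inp [.hot .lin Cs] .done).Minimal c := .inp (by simp) (by simpa using hC)
  have hs' := SesOk.bindParams_entry (b := .aux 1) hS hs (by
    intro p hp j
    rcases Multiset.mem_add.1 hp with hp | hp <;> rw [Multiset.mem_singleton] at hp <;> subst hp
    · exact hn _
    · simp [propOut])
  have hmin : (VTy.hot .lin ((paramTuple (.aux 1) (.sess (S l).dual)).map Prod.snd)).Minimal c := by
    rw [paramTuple_map_snd]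
    exact hC
  refine ValTyped.cast (.absLin (paramTuple (.aux 1) (.sess (S l).dual)) (paramTuple_nodup _ _) ?_
    (envOk_iff.2 ⟨hv.valOk, hs⟩) hmin) rfl rfl (by rw [paramTuple_map_snd]; rfl)
  rw [sessionParams_paramTuple] at hs' ⊢
  set Γ₂ := Γt.bindParams (paramTuple (.aux 1) (.sess (S l).dual))
  have hv₂ : ValsFor c E s Γ₂.vals := hv
  set e : DEnv TBase := ↑(entry (.var (.aux 1)) (S l).dual) with he
  have hs₂ : SesOk (.minimal c) Γ₂.chans
      ({(n, .sel L fun l => .inp [.hot .lin ((S l).dual.decomp.map fun M => .sess M)] .done)} +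
        ({(propOut k, (carrier E s).dual)} + e)) := hs'.of_eq (R := 0) (by abel)
  have hsd : SesOk (.minimal c) Γ₂.chans
      ({(n, .done)} + ({(propOut k, (carrier E s).dual)} + e)) := hs₂.retype .done
  have hvo := hv₂.valOk_aux (i := 1) hC
  set Γ₃ := Γ₂.bindVals [(.aux 1, .hot .lin Cs)] with hΓ₃
  have happ : Typed (.minimal c) Γ₃ {(.aux 1, Cs)} (0 + e) (.app (.var (.aux 1))
      ((paramTuple (.aux 1) (.sess (S l).dual)).map fun p => .var p.1)) := by
    refine .app .lin Cs (.linVar _ _ (envOk_iff.2 ⟨hvo.right, hsd.mono (Multiset.zero_le _)⟩)) ?_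
      (envOk_iff.2 ⟨hvo.right, ?_⟩)
    · have := namesTyped_entry (Γ := Γ₃) (.var (.aux 1)) (S l).dual
      rwa [Name.var_tuple, show (S l).dual.decomp.length = (CTy.sess (S l).dual).decomp.length by
        simp [CTy.decomp], ← paramTuple_map_fst, List.map_map] at this
    · rw [zero_add]
      exact hsd.right.right
  have hw := Typed.weaken n happ (hsd.of_eq (R := {(propOut k, (carrier E s).dual)})
    (by rw [zero_add]; abel))
  have hout := Typed.send_context (Γ := Γ₃) (k := k)
    (Δ' := {(n, .done)} + ({(propOut k, (carrier E s).dual)} + e))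
    (hv₂.bind_aux (i := 1) (Cs := Cs)) hw (by rw [zero_add]; abel) hvo
    (show SesOk _ Γ₂.chans _ from hsd)
  have hinp := Typed.rcv_one (Γ := Γ₂) (xs := [TVar.aux 1]) [.hot .lin Cs] (by simp) rfl hout
    (add_comm _ _) hv₂.valOk hM
  have := Typed.sel (F := .minimal c) L
    (fun l => STy.inp [.hot .lin ((S l).dual.decomp.map fun M => .sess M)] .done) l
    (by rw [← Multiset.singleton_add]; exact hinp)
    (envOk_iff.2 ⟨hv₂.valOk, by rw [← Multiset.singleton_add]; exact hs₂⟩)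
  exact this.cast rfl (by rw [← Multiset.singleton_add]; abel)

theorem Good.sel {u : Name ℕ} {L : Finset Label} {S : L → STy} (l : L)
    (hP : Typed (.std c) Γ Λ ((u, S l) ::ₘ Δ) P)
    (hok : EnvOk (.std c) Γ Λ ((u, .sel L S) ::ₘ Δ)) (ih : Good c Γ Λ ((u, S l) ::ₘ Δ) P) :
    Good c Γ Λ ((u, .sel L S) ::ₘ Δ) (.sel u l P) := by
  intro τ ρ k E D Γt ha ht hD hT hv
  simp only [← Multiset.singleton_add] at *
  simp only [Proc.fn, Finset.mem_union, Finset.mem_singleton, not_or] at hD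
  have hu : u ∉ D := fun h => (hD u h).1 rfl
  have hτ : τ u = .sess (.sel L S) := hT.ses_ty (u, .sel L S) (by simp)
  have hstd : (STy.sel L S).Std c := hok.ty_ses (u, .sel L S) (by simp)
  have hS : (S l).Std c := by
    cases hstd with
    | sel _ h => exact h l
  have hSd : (S l).dual.Std c := hS.of_dual
  have hch : (τ u).choose l = S l := by rw [hτ, CTy.choose_sel]
  have hown : (ρ u).owner = some u := hT.owner (u, .sel L S) (by simp)
  have hE := hT.std hok hP.varsOk
  obtain ⟨hT', hdec'⟩ := hT.sel (T' := S l) hok hu ((ρ u).base.index + 1)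
  set new : TBase := .sel u ((ρ u).base.index + 1) with hnew
  obtain ⟨Ms, hl, hm, hty⟩ := ih _ _ (k + 2) E D Γt ha (hch ▸ ht) (fun v hv => (hD v hv).2) hT' hv
  set Cs : List CTy := (S l).dual.decomp.map fun M => .sess M with hCs
  have hC : (VTy.hot .lin Cs).Minimal c :=
    .hot (CTy.decomp_ne_nil (.sess _)) (CTy.Std.sess hSd).decomp
  have hM : (STy.inp [.hot .lin Cs] .done).Minimal c := .inp (by simp) (by simpa using hC)
  set M₀ := carrier E P.fv with hM₀
  have hMs : ∀ M ∈ STy.inp [.hot .lin Cs] .done :: M₀ :: Ms, M.Minimal c :=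
    forall_minimal_cons hM (forall_minimal_cons (carrier_minimal hE) hm)
  refine ⟨_, by simp [Proc.degree, ← hl], hMs, ?_⟩
  have hs := hT.sesOk hok (k := k) (forall_minimal_cons (carrier_minimal hE) hMs)
  have hs' := hT'.sesOk hP.envOk (k := k + 1) hMs
  have hdec : decompEnv ρ D ({(u, .sel L S)} + Δ) = {(ρ u, .sel L fun l =>
      .inp [.hot .lin ((S l).dual.decomp.map fun M => .sess M)] .done)} + decompEnv ρ D Δ := by
    rw [decompEnv_add, decompEnv_of_notMem _ hu, entry_of_decomp (STy.decomp_sel L S),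
      Multiset.coe_singleton]
  rw [hdec] at hs
  have hdual : ∀ q ∈ entry (.sess new true) (S l).dual, ∃ j, q.1 = .sess (.sel u j) true := by
    intro q hq
    obtain ⟨j, -, hj⟩ := List.mem_map.1 (mem_entry hq).1
    exact ⟨_, hj.symm⟩
  -- the dual endpoints `v̄` are new: they have no owner, and they are not propagators
  have hs'' : SesOk (.minimal c) Γt.chans (entry (.sess new true) (S l).dual +
      (decompEnv (Function.update ρ u (.sess new false)) D ({(u, S l)} + Δ) +
        propEnv (k + 1) (STy.inp [.hot .lin Cs] .done :: M₀ :: Ms))) := by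
    refine .add (sesOk_entry hSd hT.kind_chan hT.ty_chan (by simp)
      fun q hq => hT.lookup_entry_sess hq) hs' ?_
    intro q hq p hp he
    obtain ⟨j, hj⟩ := hdual q hq
    rcases Multiset.mem_add.1 hp with hp | hp
    · obtain ⟨p', hp', -, hp⟩ := mem_decompEnv.1 hp
      have := (owner_of_mem_entry hp).trans (hT'.owner p' hp')
      rw [← he, hj] at this
      simp [Name.owner] at this
    · obtain ⟨i, bar, -, hi⟩ := (mem_propEnv hp).1
      rw [← he, hj] at hi
      simp at hi
  rw [hdec'] at hty hs''
  set en : DEnv TBase := ↑(entry (.sess new false) (S l)) with hen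
  set ed : DEnv TBase := ↑(entry (.sess new true) (S l).dual) with hed
  simp only [propEnv_cons, add_assoc k 1 1, add_assoc k 1 2, Nat.reduceAdd] at hs'' hs
  rw [hdec, propEnv_cons, propEnv_cons, Proc.breakdown, hch, Proc.fv, ← hM₀]
  have hv₁ := valsFor_bindVals (Γ := Γt) hE hv
  -- the component that performs the selection
  have hsel : Typed (.minimal c) Γt 0 ({(propIn k, M₀)} + ({(propOut (k + 1),
      (STy.inp [.hot .lin Cs] .done).dual)} + ({(ρ u, .sel L fun l => .inp [.hot .lin
        ((S l).dual.decomp.map fun M => .sess M)] .done)} + {(propOut (k + 2), M₀.dual)})))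
      (.inp (propIn k) (unpacked (context P.fv)) (.out (propOut (k + 1))
        [.abs .lin (paramTuple (.aux 1) (.sess (S l).dual))
          (.sel (ρ u) l (.inp (ρ u) [.aux 1] (.out (propOut (k + 2)) (packed (context P.fv))
            (.app (.var (.aux 1))
              ((paramTuple (.aux 1) (.sess (S l).dual)).map fun p => .var p.1)))))] .nil)) := by
    have hsA := hs.of_eq (Δ' := {(propIn k, M₀)} + ({(propOut (k + 1),
      (STy.inp [.hot .lin Cs] .done).dual)} + ({(ρ u, .sel L fun l => .inp [.hot .lin
        ((S l).dual.decomp.map fun M => .sess M)] .done)} + {(propOut (k + 2), M₀.dual)})))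
      (R := decompEnv ρ D Δ + {(propOut k, M₀.dual)} +
        {(propIn (k + 1), STy.inp [.hot .lin Cs] .done)} + {(propIn (k + 2), M₀)} +
        propEnv (k + 3) Ms) (by abel)
    refine Typed.rcv_context hE hv ?_ rfl hsA
    have hlam := Typed.selection (Γt := Γt.bindVals (carried E P.fv)) (n := ρ u) (k := k + 2) l hSd
      hv₁ (by rintro j h; rw [h] at hown; simp [Name.owner] at hown) hsA.right.right
    have hnil : Typed (.minimal c) (Γt.bindVals (carried E P.fv)) 0
        ({(propOut (k + 1), .done)} + 0) .nil :=
      Typed.weaken _ (.nil (envOk_iff.2 ⟨valOk_zero hv₁.ty, hsA.mono (Multiset.zero_le _)⟩)) (by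
        have := hsA.right.left
        exact (this.of_eq (R := 0) (by rw [add_zero, add_zero])).retype (Δ := 0) .done)
    exact (Typed.send_one _ hnil (valsTyped_singleton.2 hlam) (by rw [zero_add]; rfl)
      (by rw [add_zero]; exact hv₁.valOk) hsA.right).cast (add_zero _).symm rfl
  -- the component that runs the continuation of the partner
  have hrun : Typed (.minimal c) Γt 0 ({(propIn (k + 1), STy.inp [.hot .lin Cs] .done)} +
      (0 + ed)) (.inp (propIn (k + 1)) [.aux 2]
        (.app (.var (.aux 2)) ((new.tuple (S l).decomp.length).map fun b => .sess b true))) := by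
    have hsB := hs''.of_eq (Δ' := {(propIn (k + 1), STy.inp [.hot .lin Cs] .done)} +
      (0 + ed))
      (R := en + decompEnv ρ D Δ +
        {(propOut (k + 1), (STy.inp [.hot .lin Cs] .done).dual)} + {(propIn (k + 2), M₀)} +
        {(propOut (k + 2), M₀.dual)} + propEnv (k + 3) Ms) (by rw [zero_add]; abel)
    have hvo := (ValsFor.valOk_aux (Γt := Γt) (s := ∅) (i := 2) (E := E)
      ⟨by simp, by simp, by simp, hv⟩ hC).right
    refine Typed.rcv_one [.hot .lin Cs] (by simp) rfl (Typed.weaken _ (.app .lin Cs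
      (.linVar _ _ (envOk_iff.2 ⟨hvo, hsB.mono (Multiset.zero_le _)⟩)) ?_
      (envOk_iff.2 ⟨hvo, hsB.right⟩)) (hsB.retype .done)) rfl (valOk_zero hv) hM
    have := namesTyped_entry (Γ := Γt.bindVals [(.aux 2, .hot .lin Cs)]) (.sess new true)
      (S l).dual
    rwa [STy.decomp_dual, List.length_map, Name.sess_tuple, ← STy.decomp_dual] at this
  refine hsel.par_zero (Δ₂ := decompEnv ρ D Δ + ({(propIn (k + 1), STy.inp [.hot .lin Cs] .done)} +
    ({(propIn (k + 2), M₀)} + propEnv (k + 3) Ms))) ?_ ?_ ?_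
  · rw [sessionTuple_eq]
    refine Typed.resMany (ann := some) (fun _ => .inr rfl) _ (hrun.par_zero hty ?_ ?_)
    · rw [bothEnds_eq, ← entry_sess, ← entry_sess_dual, ← hed, ← hen, zero_add]
      abel
    · rw [bothEnds_eq, ← entry_sess, ← entry_sess_dual, ← hed, ← hen]
      exact hs''.of_eq (R := {(propOut (k + 1), (STy.inp [.hot .lin Cs] .done).dual)} +
        {(propOut (k + 2), M₀.dual)}) (by abel)
  · abel
  · exact hs.of_eq (R := {(propOut k, M₀.dual)}) (by abel)

end

/-! ### Typability of the breakdown and of the decomposition -/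

/-- The breakdown of a well-typed process is typable with minimal session types. -/
theorem Typed.good {c : Bool} {Γ : SEnv ℕ ℕ} {Λ : LEnv ℕ} {Δ : DEnv ℕ} {P : Proc ℕ ℕ}
    (h : Typed (.std c) Γ Λ Δ P) : Good c Γ Λ Δ P := by
  refine Typed.rec (F := .std c)
    (motive_1 := fun Γ Λ Δ P _ => Good c Γ Λ Δ P)
    (motive_2 := fun Γ Λ Δ V U _ => GoodVal c Γ Λ Δ V U)
    (motive_3 := fun Γ Λ Δ Vs Us _ => ∀ V U, Vs = [V] → Us = [U] → GoodVal c Γ Λ Δ V U)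
    ?_ ?_ ?_ ?_ ?_ ?_ ?_ ?_ ?_ ?_ ?_ ?_ ?_ ?_ ?_ ?_ ?_ ?_ ?_ h
  case refine_1 => intro Γ hok; exact .nil hok
  case refine_2 => intro Γ Λ Δ P u hP hok ih; exact .endW hP hok ih
  case refine_3 => intro Γ Λ Δ P x Cs hx _ _ ih; exact .eprom hx ih
  case refine_4 => intro Γ Λ Δ₁ Δ₂ V us m Cs hV hus hok ih; exact .app hV hus hok ih
  case refine_5 =>
    intro Γ Λ₁ Λ₂ Δ₁ Δ₂ Δ u P Vs Us S hP hV he hok ih ih'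
    obtain ⟨U, rfl, -, -⟩ := STy.Std.out_inv (hok.ty_ses _ (Multiset.mem_cons_self _ _))
    cases hV with
    | cons hV h => cases h with
      | nil =>
        simp only [add_zero] at he hok ih' ⊢
        exact .send hP hV he hok ih (ih' _ _ rfl rfl)
  case refine_6 =>
    intro Γ Λ Δ u xs P Us S _ hl hP hok ih
    obtain ⟨U, rfl, -, -⟩ := STy.Std.inp_inv (hok.ty_ses _ (Multiset.mem_cons_self _ _))
    obtain ⟨y, rfl⟩ := List.length_eq_one_iff.1 hl
    exact .rcv hP hok ih
  case refine_7 =>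
    intro Γ Λ Δ₁ Δ₂ u P V U hu hP hV hok ih ih'
    exact .req hu hP hV hok ih ih'
  case refine_8 => intro Γ Λ Δ u x P U hu hP hok ih; exact .acc hu hP hok ih
  case refine_9 => intro Γ Λ Δ u P L S l hP hok ih; exact .sel l hP hok ih
  case refine_10 => intro Γ Λ Δ u L P S hP hok ih; exact .bra hP hok ih
  case refine_11 => intro Γ Λ₁ Λ₂ Δ₁ Δ₂ P Q hP hQ hok ih ih'; exact .par hP hQ hok ih ih'
  case refine_12 => intro Γ Λ Δ P s ann S hann hP _ ih; exact .resS hann hP ih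
  case refine_13 => intro Γ Λ Δ P a U hP hok ih; exact .resA hP hok ih
  case refine_14 => intro Γ x Cs hx hok; exact .shVar hok hx
  case refine_15 => intro Γ x Cs hok; exact .linVar hok
  case refine_16 =>
    intro Γ Λ Δ P ps _ hP hok hU ih
    obtain ⟨C, hC, hstd⟩ := VTy.Std.hot_inv hU
    obtain ⟨⟨y, C'⟩, rfl⟩ := List.length_eq_one_iff.1 (by
      rw [← List.length_map (f := Prod.snd), hC, List.length_singleton])
    obtain rfl : C' = C := by simpa using hC
    exact .absLin hP hok hstd ih
  case refine_17 =>
    intro Γ P ps _ hP hok hU ih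
    obtain ⟨C, hC, hstd⟩ := VTy.Std.hot_inv hU
    obtain ⟨⟨y, C'⟩, rfl⟩ := List.length_eq_one_iff.1 (by
      rw [← List.length_map (f := Prod.snd), hC, List.length_singleton])
    obtain rfl : C' = C := by simpa using hC
    exact .absShr hP hok hstd ih
  case refine_18 => intro Γ V U h; simp at h
  case refine_19 =>
    intro Γ Λ₁ Λ₂ Δ₁ Δ₂ V Vs U Us _ hVs ih _ V' U' hV hU
    obtain ⟨rfl, rfl⟩ := List.cons.inj hV
    obtain ⟨rfl, rfl⟩ := List.cons.inj hU
    cases hVs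
    simpa using ih

theorem List.lookup_map_of_injective {α β γ δ : Type} [DecidableEq α] [DecidableEq γ] {f : α → γ}
    (hf : Function.Injective f) (g : β → δ) (l : List (α × β)) (k : α) :
    (l.map fun p => (f p.1, g p.2)).lookup (f k) = (l.lookup k).map g := by
  induction l with
  | nil => rfl
  | cons p l ih =>
    obtain ⟨a, b⟩ := p
    by_cases h : k = a
    · subst h
      simp
    · simp [List.lookup_cons, ih, beq_eq_false_iff_ne.2 h, beq_eq_false_iff_ne.2 (hf.ne h)]

theorem List.lookup_eq_some_of_mem {α β : Type} [DecidableEq α] {l : List (α × β)}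
    (hl : (l.map Prod.fst).Nodup) {p : α × β} (hp : p ∈ l) : l.lookup p.1 = some p.2 := by
  cases h : l.lookup p.1 with
  | none => simpa using List.lookup_eq_none_iff.1 h p hp
  | some b => exact congrArg some (congrArg Prod.snd
      (List.inj_on_of_nodup_map hl (List.mem_of_lookup_eq_some h) hp rfl))

/-- Initially every name `n` stands for `n_1`, and no session is finished. -/
theorem tracks_init {c : Bool} {Γ : SEnv ℕ ℕ} {Δ : List (Name ℕ × STy)} {E : ℕ → VTy}
    (hE : ∀ x Cs, Γ.vals.lookup x = some Cs → E x = .hot .shr Cs) (hok : EnvOk (.std c) Γ 0 ↑Δ) :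
    Tracks c (typesEnv Γ Δ) Name.init E ∅ Γ 0 ↑Δ Γ.init.decomp.chans := by
  have hch : Γ.init.decomp.chans = Γ.chans.map fun p => (p.1.init, p.2.decomp) := by
    simp [SEnv.init, SEnv.decomp]
  have hnodup : (Δ.map Prod.fst).Nodup := by simpa using hok.nodup_ses
  refine ⟨fun p hp => ?_, fun u U hu => ?_, fun p _ => Name.owner_init _, fun u _ _ => rfl,
    fun u U hu => ?_, by simp, hE, fun p hp => ?_, fun p hp => ?_, fun q hq => ?_⟩
  · rw [typesEnv, List.lookup_eq_some_of_mem hnodup hp]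
  · have hn : Δ.lookup u = none := by
      cases h : Δ.lookup u with
      | none => rfl
      | some S =>
        have := hok.disj_ses (u, S) (List.mem_of_lookup_eq_some h)
        simp [hu] at this
    simp [typesEnv, hn, hu]
  · rw [hch, List.lookup_map_of_injective Name.init_injective, hu]
    rfl
  · rw [hch] at hp
    obtain ⟨⟨u, U⟩, hu, rfl⟩ := List.mem_map.1 hp
    have := hok.kind_chan _ hu
    cases u with
    | sess s bar => exact (this s bar rfl).elim
    | _ => simp [Name.init]
  · rw [hch] at hp
    obtain ⟨⟨u, U⟩, hu, rfl⟩ := List.mem_map.1 hp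
    exact (show U.Std c from hok.ty_chan _ hu).decomp
  · obtain ⟨p, hp, -, hq⟩ := mem_decompEnv.1 hq
    refine lookup_eq_none_of_forall_ne fun r hr he => ?_
    rw [hch] at hr
    obtain ⟨r', hr', rfl⟩ := List.mem_map.1 hr
    have ho := owner_of_mem_entry hq
    rw [← he, Name.owner_init, Name.owner_init, Option.some_inj] at ho
    simpa [ho] using List.lookup_eq_none_iff.1 (hok.disj_ses p hp) r' hr'

theorem theoremt (choice : Bool) (Γ : SEnv ℕ ℕ) (Δ : List (Name ℕ × STy)) (P : Proc ℕ ℕ)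
    (k : ℕ) (hk : 0 < k) (hclosed : P.Closed) (hann : P.Annotated)
    (htidy : P.Tidy (typesEnv Γ Δ))
    (htyped : Typed (TypeLang.std choice) Γ 0 ↑Δ P) :
    Typed (TypeLang.minimal choice) Γ.init.decomp 0 ↑(decompSessions (initSessions Δ))
      (P.decomp Γ Δ k) := by
  -- the default `[]` does not matter, since `E` is used at the variables of `Γ` only
  set E : ℕ → VTy := fun x => .hot .shr ((Γ.vals.lookup x).getD []) with hE
  have hT := tracks_init (E := E) (fun x Cs hx => by simp [hE, hx]) htyped.envOk
  have hvals : ∀ p ∈ Γ.init.decomp.vals, (VTy.hot .shr p.2).Minimal choice := by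
    intro p hp
    simp only [SEnv.init, SEnv.decomp, List.map_map, List.mem_map, Function.comp_apply] at hp
    obtain ⟨q, hq, rfl⟩ := hp
    exact VTy.Std.decomps_shr (htyped.envOk.ty_val q hq) .shr
  obtain ⟨Ms, hl, hm, hty⟩ := htyped.good (typesEnv Γ Δ) Name.init k E ∅ Γ.init.decomp hann htidy
    (by simp) hT hvals
  have hs := hT.sesOk htyped.envOk (k := k) (Ms := carrier E P.fv :: Ms)
    (forall_minimal_cons (carrier_minimal (hT.std htyped.envOk htyped.varsOk)) hm)
  rw [hclosed.1] at hty hs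
  have hΔ : decompEnv Name.init ∅ ↑Δ = ↑(decompSessions (initSessions Δ)) := by
    simp [decompEnv, decompSessions, initSessions, entry, List.flatMap_map]
  have := Typed.trigger_res (s := ∅) ⟨by simp, by simp, by simp, hvals⟩ hl hty hs
  rw [hΔ, context_eq_nil.2 rfl] at this
  exact this.cast (by simp [linPart]) rfl
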